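/- **Conventions.** Let $g\ge 2$ and $i\in\{1,2\}$. Let $\widehat{\mathbb Z}=\prod_\ell\mathbb Z_\ell$ be the profinite completion of $\mathbb Z$. For a commutative ring $R$, let $\mathrm{GSp}_{2g}(R)$ be the group of $S\in \mathrm{GL}_{2g}(R)$ with $S^{T}\Omega S=m\,\Omega$ for some $m=\operatorname{mult}(S)\in R^\times$, where $\Omega$ is the standard alternating form, and let $\mathrm{Sp}_{2g}(R)$ be the subgroup where $m=1$. Let $V=\mathbb F_2^{2g+2}$ with its standard inner product, $t=(1,\dots,1)$, and $W=t^\perp/\langle t\rangle$ with the induced alternating form. Permuting coordinates makes $S_{2g+2}$ act on $W$; through any fixed symplectic basis of $W$ this gives $S_{2g+2}\subset \mathrm{Sp}_{2g}(\mathbb F_2)$. Let $S_{2g+1}\subset S_{2g+2}$ be the subgroup fixing the last coordinate, and let $A_{2g+i}\subset S_{2g+i}$ be the alternating group. For $H\subset \mathrm{GSp}_{2g}(\widehat{\mathbb Z})$ write $H_2$ for its image in $\mathrm{GSp}_{2g}(\mathbb Z_2)$ and $H(\ell)$ for its image in $\mathrm{GSp}_{2g}(\mathbb F_\ell)$, and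 let $[H,H]$ be the closure of the commutator subgroup. Let $\widehat{\mathcal S}_{2g+i}$ be the preimage of $S_{2g+i}$ in $\mathrm{Sp}_{2g}(\widehat{\mathbb Z})$. **Statement.** Let $H\subset \mathrm{GSp}_{2g}(\widehat{\mathbb Z})$ be a closed subgroup such that $H_2$ is the full preimage of $S_{2g+i}$ under $\mathrm{GSp}_{2g}(\mathbb Z_2)\to \mathrm{GSp}_{2g}(\mathbb F_2)=\mathrm{Sp}_{2g}(\mathbb F_2)$, and such that $H(\ell)\supset \mathrm{Sp}_{2g}(\mathbb F_\ell)$ for every prime $\ell\ge 3$. Then $$[H,H]=\bigl(\mathrm{Sp}_{2g}(\mathbb Z_2)\to \mathrm{Sp}_{2g}(\mathbb F_2)\bigr)^{-1}(A_{2g+i})\times\prod_{\ell\ge 3}\mathrm{Sp}_{2g}(\mathbb Z_\ell).$$ Consequently $[H,H]$ is a subgroup of $\widehat{\mathcal S}_{2g+i}$ of index $2$. In particular, for a number field $K$ with cyclotomic character $\chi\colon \mathrm{Gal}(\overline K/K)\to\widehat{\mathbb Z}^\times$, let $G_K$ be the group of those $S\in \mathrm{GSp}_{2g}(\widehat{\mathbb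 Z})$ whose multiplier lies in the image of $\chi$ and whose reduction modulo $2$ lies in $S_{2g+i}$. If the $2$-adic cyclotomic character $\mathrm{Gal}(\overline K/K)\to\mathbb Z_2^\times$ is surjective, then $[G_K,G_K]$ is a subgroup of $\widehat{\mathcal S}_{2g+i}$ of index $2$. This holds for $K=\mathbb Q$. -/

import Mathlib

universe u

namespace HypSp

open Matrix

noncomputable section

/-- A prime, regarded as an element of the type of all primes, is prime. -/
instance factPrimes (p : Nat.Primes) : Fact (p : ℕ).Prime := ⟨p.2⟩

/-- The prime `2`. -/
abbrev two : Nat.Primes := ⟨2, Nat.prime_two⟩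

/-- The profinite completion of the integers, as the product over all primes of the rings of
`p`-adic integers, with the product ring structure and the product topology. -/
abbrev ZHat : Type := ∀ p : Nat.Primes, ℤ_[(p : ℕ)]

/-- Square matrices of size `2g`, invertible. -/
abbrev GL2g (g : ℕ) (R : Type*) [CommRing R] : Type _ := GL (Fin g ⊕ Fin g) R

/-- `S` is a symplectic similitude with multiplier `m`, for the standard alternating form,
whose Gram matrix is `J`. -/
def IsSimilitude {g : ℕ} {R : Type*} [CommRing R] (S : GL2g g R) (m : Rˣ) : Prop :=
  (S.val)ᵀ * J (Fin g) R * S.val = (m : R) • J (Fin g) R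

theorem IsSimilitude.one {g : ℕ} {R : Type*} [CommRing R] :
    IsSimilitude (1 : GL2g g R) 1 := by
  simp [IsSimilitude]

theorem IsSimilitude.mul {g : ℕ} {R : Type*} [CommRing R] {S T : GL2g g R} {m n : Rˣ}
    (hS : IsSimilitude S m) (hT : IsSimilitude T n) : IsSimilitude (S * T) (m * n) := by
  unfold IsSimilitude at *
  calc ((S * T).val)ᵀ * J (Fin g) R * (S * T).val
      = (T.val)ᵀ * ((S.val)ᵀ * J (Fin g) R * S.val) * T.val := by
        simp [Matrix.mul_assoc, Matrix.transpose_mul]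
    _ = _ := by
        rw [hS, Matrix.mul_smul, Matrix.smul_mul, hT, smul_smul, Units.val_mul]

theorem IsSimilitude.inv {g : ℕ} {R : Type*} [CommRing R] {S : GL2g g R} {m : Rˣ}
    (hS : IsSimilitude S m) : IsSimilitude S⁻¹ m⁻¹ := by
  unfold IsSimilitude at *
  have h1 : S.val * (S⁻¹).val = 1 := by rw [← Units.val_mul]; simp
  have h2 : ((S⁻¹).val)ᵀ * (S.val)ᵀ = 1 := by
    rw [← Matrix.transpose_mul, h1, Matrix.transpose_one]
  have h3 : J (Fin g) R = (m : R) • (((S⁻¹).val)ᵀ * J (Fin g) R * (S⁻¹).val) := by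
    calc J (Fin g) R
        = (((S⁻¹).val)ᵀ * (S.val)ᵀ) * J (Fin g) R * (S.val * (S⁻¹).val) := by
          rw [h1, h2]; simp
      _ = ((S⁻¹).val)ᵀ * ((S.val)ᵀ * J (Fin g) R * S.val) * (S⁻¹).val := by
          simp only [Matrix.mul_assoc]
      _ = _ := by rw [hS, Matrix.mul_smul, Matrix.smul_mul]
  conv_rhs => rw [h3]
  rw [smul_smul, Units.inv_mul, one_smul]

/-- The group of symplectic similitudes whose multiplier lies in the subgroup `C`. -/
def GSpWith (g : ℕ) {R : Type*} [CommRing R] (C : Subgroup Rˣ) : Subgroup (GL2g g R) where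
  carrier := {S | ∃ m ∈ C, IsSimilitude S m}
  one_mem' := ⟨1, C.one_mem, IsSimilitude.one⟩
  mul_mem' := by
    rintro S T ⟨m, hm, hS⟩ ⟨n, hn, hT⟩
    exact ⟨m * n, C.mul_mem hm hn, hS.mul hT⟩
  inv_mem' := by
    rintro S ⟨m, hm, hS⟩
    exact ⟨m⁻¹, C.inv_mem hm, hS.inv⟩

/-- The general symplectic group: all multipliers are allowed. -/
def GSp (g : ℕ) (R : Type*) [CommRing R] : Subgroup (GL2g g R) := GSpWith g ⊤

/-- The symplectic group: the multiplier is `1`. -/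
def Sp (g : ℕ) (R : Type*) [CommRing R] : Subgroup (GL2g g R) := GSpWith g ⊥

/-- The projection to the `p`-adic component. -/
def adic (g : ℕ) (p : Nat.Primes) : GL2g g ZHat →* GL2g g ℤ_[(p : ℕ)] :=
  GeneralLinearGroup.map (Pi.evalRingHom (fun q : Nat.Primes => ℤ_[(q : ℕ)]) p)

/-- Reduction of `p`-adic matrices modulo `p`. -/
def red (g : ℕ) (p : Nat.Primes) : GL2g g ℤ_[(p : ℕ)] →* GL2g g (ZMod (p : ℕ)) :=
  GeneralLinearGroup.map PadicInt.toZMod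

/-! The symmetric group on `2g+2` letters in the symplectic group over the field with two
elements. -/

/-- The vector `(1, ..., 1)`. -/
def tVec (g : ℕ) : Fin (2 * g + 2) → ZMod 2 := fun _ => 1

/-- The hyperplane of vectors orthogonal to `(1, ..., 1)`. -/
def tPerp (g : ℕ) : Submodule (ZMod 2) (Fin (2 * g + 2) → ZMod 2) where
  carrier := {v | v ⬝ᵥ tVec g = 0}
  zero_mem' := by simp
  add_mem' := by
    intro v w hv hw
    simp only [Set.mem_ofPred_eq] at *
    rw [add_dotProduct, hv, hw, add_zero]
  smul_mem' := by
    intro c v hv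
    simp only [Set.mem_ofPred_eq] at *
    rw [smul_dotProduct, hv, smul_zero]

/-- The line spanned by `(1, ..., 1)`, inside that hyperplane. -/
def tLine (g : ℕ) : Submodule (ZMod 2) (tPerp g) :=
  (Submodule.span (ZMod 2) {tVec g}).comap (tPerp g).subtype

/-- The space `W`, the hyperplane modulo the line. -/
abbrev W (g : ℕ) : Type := tPerp g ⧸ tLine g

/-- The standard inner product, restricted to the hyperplane. -/
def perpForm (g : ℕ) : tPerp g →ₗ[ZMod 2] tPerp g →ₗ[ZMod 2] ZMod 2 :=
  LinearMap.mk₂ (ZMod 2) (fun v w => v.1 ⬝ᵥ w.1)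
    (by intros; simp [add_dotProduct]) (by intros; simp [smul_dotProduct])
    (by intros; simp [dotProduct_add]) (by intros; simp [dotProduct_smul])

theorem perpForm_apply (g : ℕ) (v w : tPerp g) : perpForm g v w = v.1 ⬝ᵥ w.1 := rfl

theorem perpForm_line_left (g : ℕ) {v : tPerp g} (hv : v ∈ tLine g) (w : tPerp g) :
    perpForm g v w = 0 := by
  obtain ⟨c, hc⟩ := Submodule.mem_span_singleton.1 (Submodule.mem_comap.1 hv)
  have hw : w.1 ⬝ᵥ tVec g = 0 := w.2
  have hc' : v.1 = c • tVec g := hc.symm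
  rw [perpForm_apply, hc', smul_dotProduct, dotProduct_comm, hw, smul_zero]

theorem perpForm_line_right (g : ℕ) (v : tPerp g) {w : tPerp g} (hw : w ∈ tLine g) :
    perpForm g v w = 0 := by
  rw [perpForm_apply, dotProduct_comm, ← perpForm_apply]
  exact perpForm_line_left g hw v

/-- The bilinear form on `W` induced by the standard inner product. -/
def wForm (g : ℕ) : W g →ₗ[ZMod 2] W g →ₗ[ZMod 2] ZMod 2 :=
  (tLine g).liftQ
    ((tLine g).liftQ (perpForm g)
      (fun _ hv => LinearMap.ext fun w => perpForm_line_left g hv w)).flip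
    (fun w hw => by
      refine LinearMap.ext fun x => ?_
      obtain ⟨v, rfl⟩ := Submodule.Quotient.mk_surjective _ x
      exact perpForm_line_right g v hw)
  |>.flip

theorem wForm_mk (g : ℕ) (v w : tPerp g) :
    wForm g (Submodule.Quotient.mk v) (Submodule.Quotient.mk w) = v.1 ⬝ᵥ w.1 := rfl

/-- A permutation acts on the hyperplane by permuting the coordinates. -/
def permPerp (g : ℕ) (σ : Equiv.Perm (Fin (2 * g + 2))) : tPerp g →ₗ[ZMod 2] tPerp g :=
  (LinearMap.funLeft (ZMod 2) (ZMod 2) σ.symm).restrict (p := tPerp g) (q := tPerp g) (by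
    intro v hv
    have h : v ⬝ᵥ tVec g = 0 := hv
    change (v ∘ σ.symm) ⬝ᵥ tVec g = 0
    rw [comp_equiv_symm_dotProduct]
    exact h)

theorem permPerp_apply (g : ℕ) (σ : Equiv.Perm (Fin (2 * g + 2))) (v : tPerp g)
    (k : Fin (2 * g + 2)) : (permPerp g σ v).1 k = v.1 (σ⁻¹ k) := rfl

theorem permPerp_line (g : ℕ) (σ : Equiv.Perm (Fin (2 * g + 2))) :
    tLine g ≤ (tLine g).comap (permPerp g σ) := by
  intro v hv
  obtain ⟨c, hc⟩ := Submodule.mem_span_singleton.1 (Submodule.mem_comap.1 hv)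
  refine Submodule.mem_span_singleton.2 ⟨c, ?_⟩
  funext k
  exact congrFun hc (σ⁻¹ k)

/-- The action of the symmetric group on `W`. -/
def permW (g : ℕ) :
    Equiv.Perm (Fin (2 * g + 2)) →* LinearMap.GeneralLinearGroup (ZMod 2) (W g) :=
  MonoidHom.toHomUnits
    { toFun := fun σ => (tLine g).mapQ (tLine g) (permPerp g σ) (permPerp_line g σ)
      map_one' := by
        refine LinearMap.ext fun x => ?_
        obtain ⟨v, rfl⟩ := Submodule.Quotient.mk_surjective _ x
        rfl
      map_mul' := by
        intro σ τ
        refine LinearMap.ext fun x => ?_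
        obtain ⟨v, rfl⟩ := Submodule.Quotient.mk_surjective _ x
        rfl }

/-- A basis of `W` in which the induced form has the standard Gram matrix `J`. -/
def IsSymplecticBasis {g : ℕ} (b : Module.Basis (Fin g ⊕ Fin g) (ZMod 2) (W g)) : Prop :=
  ∀ r s, wForm g (b r) (b s) = J (Fin g) (ZMod 2) r s

/-- The permutations of the `2g+2` letters that move only the first `2g+i` letters. For `i = 2`
these are all permutations, and for `i = 1` those that fix the last letter. -/
def letters (g i : ℕ) : Subgroup (Equiv.Perm (Fin (2 * g + 2))) where
  carrier := {σ | ∀ k : Fin (2 * g + 2), 2 * g + i ≤ (k : ℕ) → σ k = k}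
  one_mem' := by intro k _; rfl
  mul_mem' := by
    intro σ τ hσ hτ k hk
    rw [Equiv.Perm.mul_apply, hτ k hk, hσ k hk]
  inv_mem' := by
    intro σ hσ k hk
    rw [Equiv.Perm.inv_eq_iff_eq, hσ k hk]

/-- Permutations as matrices, through the action on `W` and a basis of `W`. -/
def permMatrix {g : ℕ} (b : Module.Basis (Fin g ⊕ Fin g) (ZMod 2) (W g)) :
    Equiv.Perm (Fin (2 * g + 2)) →* GL2g g (ZMod 2) :=
  (GeneralLinearGroup.toLin' b).symm.toMonoidHom.comp (permW g)

/-- The symmetric group on the first `2g+i` letters, as a group of matrices. -/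
def symGrp {g : ℕ} (b : Module.Basis (Fin g ⊕ Fin g) (ZMod 2) (W g)) (i : ℕ) :
    Subgroup (GL2g g (ZMod 2)) :=
  (letters g i).map (permMatrix b)

/-- The alternating group on the first `2g+i` letters, as a group of matrices. -/
def altGrp {g : ℕ} (b : Module.Basis (Fin g ⊕ Fin g) (ZMod 2) (W g)) (i : ℕ) :
    Subgroup (GL2g g (ZMod 2)) :=
  (letters g i ⊓ alternatingGroup (Fin (2 * g + 2))).map (permMatrix b)

/-- The preimage of a group of matrices modulo `2` in the 2-adic general symplectic group. -/
def preGSp2 (g : ℕ) (A : Subgroup (GL2g g (ZMod 2))) : Subgroup (GL2g g ℤ_[(two : ℕ)]) :=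
  GSp g ℤ_[(two : ℕ)] ⊓ A.comap (red g two)

/-- The preimage of a group of matrices modulo `2` in the 2-adic symplectic group. -/
def preSp2 (g : ℕ) (A : Subgroup (GL2g g (ZMod 2))) : Subgroup (GL2g g ℤ_[(two : ℕ)]) :=
  Sp g ℤ_[(two : ℕ)] ⊓ A.comap (red g two)

/-- The preimage of a group of matrices modulo `2` in the symplectic group over `ZHat`. -/
def preSpHat (g : ℕ) (A : Subgroup (GL2g g (ZMod 2))) : Subgroup (GL2g g ZHat) :=
  Sp g ZHat ⊓ A.comap ((red g two).comp (adic g two))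

/-- The product of a group `B` of 2-adic matrices with the `p`-adic symplectic groups for all
primes `p ≥ 3`, as a group of matrices over `ZHat`. -/
def prodSp (g : ℕ) (B : Subgroup (GL2g g ℤ_[(two : ℕ)])) : Subgroup (GL2g g ZHat) :=
  B.comap (adic g two) ⊓
    ⨅ (p : Nat.Primes) (_ : 3 ≤ (p : ℕ)), (Sp g ℤ_[(p : ℕ)]).comap (adic g p)

/-- The closure of the commutator subgroup. -/
def closedComm {G : Type*} [Group G] [TopologicalSpace G] [IsTopologicalGroup G]
    (H : Subgroup G) : Subgroup G :=
  ⁅H, H⁆.topologicalClosure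

/-- The `p`-adic cyclotomic character of the absolute Galois group of `K`. -/
def cycloP (K : Type*) [Field K] (p : ℕ) [Fact p.Prime] :
    (AlgebraicClosure K ≃ₐ[K] AlgebraicClosure K) →* ℤ_[p]ˣ where
  toFun σ := cyclotomicCharacter (AlgebraicClosure K) p σ.toRingEquiv
  map_one' := map_one (cyclotomicCharacter (AlgebraicClosure K) p)
  map_mul' σ τ := map_mul (cyclotomicCharacter (AlgebraicClosure K) p)
    σ.toRingEquiv τ.toRingEquiv

/-- The cyclotomic character of the absolute Galois group of `K`. -/
def cyclo (K : Type*) [Field K] :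
    (AlgebraicClosure K ≃ₐ[K] AlgebraicClosure K) →* ZHatˣ :=
  MulEquiv.piUnits.symm.toMonoidHom.comp
    (MonoidHom.pi fun p : Nat.Primes => cycloP K (p : ℕ))

/-- The similitudes over `ZHat` whose multiplier is a value of the cyclotomic character of `K` and
whose reduction modulo `2` lies in the symmetric group on the first `2g+i` letters. -/
def hypGSp {g : ℕ} (b : Module.Basis (Fin g ⊕ Fin g) (ZMod 2) (W g)) (i : ℕ)
    (K : Type*) [Field K] : Subgroup (GL2g g ZHat) :=
  GSpWith g (cyclo K).range ⊓ (symGrp b i).comap ((red g two).comp (adic g two))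

end

end HypSp

open HypSp

/-! One inclusion is formal: commutators of similitudes have multiplier 1, commutators of
permutations are even, and both conditions are closed. The content is that the closed group N =
[H,H] is large enough. Each ℓ-adic projection of N is as large as allowed, and N is the product of
its projections.

At ℓ = 2, a transposition acts on W as a transvection. Lift its direction to a vector u. A
similitude of multiplier -1 that fixes u and is trivial modulo 2 inverts the transvection along u,
so the square of that transvection is a commutator (`exists_lift_tv`). Its iterated squares reach
every layer of the congruence filtration, and by polarization the directions of the transpositions
of the first 2g+1 letters generate the whole symplectic Lie algebra modulo 2 (`nil_mem_of_pair`).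
Thus N has full principal congruence part at 2; modulo 2 it contains the alternating group because
2g+i ≥ 5.

At odd ℓ, the group Sp modulo ℓ is perfect (`commutator_Sp`), so N maps onto it, and a closed
subgroup of the ℓ-adic symplectic group mapping onto the residual one is everything, also for ℓ = 3
(`Sp_le_of_red`).

Independence of the primes is a Goursat argument. A normal subgroup of Sp modulo an odd q is
everything or has exponent two (`normal_dichotomy`). If the part of N trivial modulo p were small
modulo q, a q-group covering an elementary abelian group of rank g+1 would embed into the image
modulo p. For p = 2 this contradicts Legendre's formula for (2g+2)!. For odd p the q-group is itself
elementary abelian, while diagonalization bounds its rank by g (`card_le_pow`). Raising to powers of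
p passes from modulo p to p-adic, perfectness combines finitely many primes, and compactness
combines all of them (`prodSp_le`).

The index is 2 because the symmetric group acts faithfully on W, so that the sign is defined on its
matrices. For a number field, a prescribed 2-adic multiplier is the value of some Galois element,
and the other components can be taken diagonal. Over ℚ, surjectivity comes from irreducibility of
cyclotomic polynomials. -/

namespace HypSp

open Matrix

/-! ### The symplectic form and transvections -/

section Form

variable {g : ℕ} {R : Type*} [CommRing R]

/-- The standard alternating form. -/
def om (v w : Fin g ⊕ Fin g → R) : R := v ⬝ᵥ (J (Fin g) R *ᵥ w)

/-- The nilpotent matrix of `x ↦ om u x • u`. -/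
def nil (u : Fin g ⊕ Fin g → R) : Matrix (Fin g ⊕ Fin g) (Fin g ⊕ Fin g) R :=
  vecMulVec u u * J (Fin g) R

theorem om_apply (v w : Fin g ⊕ Fin g → R) :
    om v w = ∑ j, (v (.inr j) * w (.inl j) - v (.inl j) * w (.inr j)) := by
  simp only [om, J, dotProduct, fromBlocks_mulVec, Fintype.sum_sum_type, Sum.elim_inl,
    Sum.elim_inr, Finset.sum_sub_distrib, zero_mulVec, neg_mulVec, one_mulVec, Pi.add_apply,
    Pi.neg_apply, Pi.zero_apply, Function.comp]
  simp [mul_neg, sub_eq_add_neg, add_comm]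

theorem om_swap (v w : Fin g ⊕ Fin g → R) : om v w = -om w v := by
  rw [om_apply, om_apply, ← Finset.sum_neg_distrib]
  exact Finset.sum_congr rfl fun j _ => by ring

@[simp] theorem om_self (v : Fin g ⊕ Fin g → R) : om v v = 0 := by
  rw [om_apply]
  exact Finset.sum_eq_zero fun j _ => by ring

@[simp] theorem om_add_left (u v w : Fin g ⊕ Fin g → R) : om (u + v) w = om u w + om v w := by
  simp [om, add_dotProduct]

@[simp] theorem om_add_right (u v w : Fin g ⊕ Fin g → R) : om u (v + w) = om u v + om u w := by
  simp [om, mulVec_add, dotProduct_add]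

@[simp] theorem om_sub_left (u v w : Fin g ⊕ Fin g → R) : om (u - v) w = om u w - om v w := by
  simp [om, sub_dotProduct]

@[simp] theorem om_sub_right (u v w : Fin g ⊕ Fin g → R) : om u (v - w) = om u v - om u w := by
  simp [om, mulVec_sub, dotProduct_sub]

@[simp] theorem om_smul_left (c : R) (v w : Fin g ⊕ Fin g → R) : om (c • v) w = c * om v w := by
  simp [om]

@[simp] theorem om_smul_right (c : R) (v w : Fin g ⊕ Fin g → R) : om v (c • w) = c * om v w := by
  simp [om, mulVec_smul]

@[simp] theorem om_zero_left (w : Fin g ⊕ Fin g → R) : om 0 w = 0 := by simp [om]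

theorem nil_mulVec (u v : Fin g ⊕ Fin g → R) : nil u *ᵥ v = om u v • u := by
  rw [nil, ← mulVec_mulVec, vecMulVec_mulVec, om]
  simp

theorem ext_mulVec {A B : Matrix (Fin g ⊕ Fin g) (Fin g ⊕ Fin g) R}
    (h : ∀ v, A *ᵥ v = B *ᵥ v) : A = B := Matrix.mulVec_injective (funext h)

theorem nil_mul_nil (u : Fin g ⊕ Fin g → R) : nil u * nil u = 0 :=
  ext_mulVec fun v => by
    rw [← mulVec_mulVec, nil_mulVec, nil_mulVec, om_smul_right, om_self]; simp

theorem om_eq_of_transpose {S : Matrix (Fin g ⊕ Fin g) (Fin g ⊕ Fin g) R} {m : R}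
    (hS : Sᵀ * J (Fin g) R * S = m • J (Fin g) R) (v w : Fin g ⊕ Fin g → R) :
    om (S *ᵥ v) (S *ᵥ w) = m * om v w := by
  have : om (S *ᵥ v) (S *ᵥ w) = v ⬝ᵥ ((Sᵀ * J (Fin g) R * S) *ᵥ w) := by
    rw [om, ← mulVec_mulVec, ← mulVec_mulVec, dotProduct_mulVec v Sᵀ, vecMul_transpose]
  rw [this, hS, smul_mulVec, dotProduct_smul, om, smul_eq_mul]

theorem transpose_of_om_eq {S : Matrix (Fin g ⊕ Fin g) (Fin g ⊕ Fin g) R} {m : R}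
    (hS : ∀ v w, om (S *ᵥ v) (S *ᵥ w) = m * om v w) :
    Sᵀ * J (Fin g) R * S = m • J (Fin g) R := by
  refine ext_mulVec fun w => ?_
  refine dotProduct_eq _ _ fun v => ?_
  have := hS v w
  rw [om, om, ← smul_eq_mul, ← dotProduct_smul, ← smul_mulVec] at this
  rw [dotProduct_comm, dotProduct_comm _ v, ← this, ← mulVec_mulVec, ← mulVec_mulVec,
    dotProduct_mulVec v Sᵀ, vecMul_transpose]

theorem isSimilitude_iff {S : GL2g g R} {m : Rˣ} :
    IsSimilitude S m ↔ ∀ v w, om (S.val *ᵥ v) (S.val *ᵥ w) = (m : R) * om v w :=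
  ⟨fun h => om_eq_of_transpose h, fun h => transpose_of_om_eq h⟩

theorem mem_Sp {S : GL2g g R} : S ∈ Sp g R ↔ IsSimilitude S 1 := by
  constructor
  · rintro ⟨m, hm, h⟩
    rwa [Subgroup.mem_bot.1 hm] at h
  · exact fun h => ⟨1, Subgroup.one_mem _, h⟩

theorem mem_Sp_iff {S : GL2g g R} :
    S ∈ Sp g R ↔ ∀ v w, om (S.val *ᵥ v) (S.val *ᵥ w) = om v w := by
  rw [mem_Sp, isSimilitude_iff]; simp

theorem om_mulVec {S : GL2g g R} (hS : S ∈ Sp g R) (v w : Fin g ⊕ Fin g → R) :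
    om (S.val *ᵥ v) (S.val *ᵥ w) = om v w := mem_Sp_iff.1 hS v w

@[simp] theorem val_inv_mulVec (S : GL2g g R) (v : Fin g ⊕ Fin g → R) :
    (S⁻¹).val *ᵥ (S.val *ᵥ v) = v := by
  rw [mulVec_mulVec, ← Units.val_mul]; simp

@[simp] theorem val_mulVec_inv (S : GL2g g R) (v : Fin g ⊕ Fin g → R) :
    S.val *ᵥ ((S⁻¹).val *ᵥ v) = v := by
  rw [mulVec_mulVec, ← Units.val_mul]; simp

theorem mul_val_mulVec (S T : GL2g g R) (v : Fin g ⊕ Fin g → R) :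
    (S * T).val *ᵥ v = S.val *ᵥ (T.val *ᵥ v) := by
  rw [mulVec_mulVec, ← Units.val_mul]

theorem gl_ext {S T : GL2g g R} (h : ∀ v, S.val *ᵥ v = T.val *ᵥ v) : S = T :=
  Units.ext (ext_mulVec h)

/-- The transvection `x ↦ x + a * om u x • u`. -/
def tv (u : Fin g ⊕ Fin g → R) (a : R) : GL2g g R where
  val := 1 + a • nil u
  inv := 1 - a • nil u
  val_inv := by
    rw [add_mul, mul_sub, mul_sub, smul_mul_smul_comm, nil_mul_nil]; simp
  inv_val := by
    rw [sub_mul, mul_add, mul_add, smul_mul_smul_comm, nil_mul_nil]; simp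

theorem tv_val (u : Fin g ⊕ Fin g → R) (a : R) : (tv u a).val = 1 + a • nil u := rfl

theorem tv_mulVec (u : Fin g ⊕ Fin g → R) (a : R) (v : Fin g ⊕ Fin g → R) :
    (tv u a).val *ᵥ v = v + (a * om u v) • u := by
  rw [tv_val, add_mulVec, one_mulVec, smul_mulVec, nil_mulVec, smul_smul]

theorem tv_mem (u : Fin g ⊕ Fin g → R) (a : R) : tv u a ∈ Sp g R := by
  rw [mem_Sp_iff]
  intro v w
  simp only [tv_mulVec, om_add_left, om_add_right, om_smul_left, om_smul_right, om_self]
  rw [om_swap v u]; ring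

theorem tv_add (u : Fin g ⊕ Fin g → R) (a b : R) : tv u (a + b) = tv u a * tv u b := by
  refine gl_ext fun v => ?_
  simp only [mul_val_mulVec, tv_mulVec, om_add_right, om_smul_right, om_self]
  module

@[simp] theorem tv_zero (u : Fin g ⊕ Fin g → R) : tv u (0 : R) = 1 := by
  refine gl_ext fun v => ?_
  simp [tv_mulVec]

theorem tv_inv (u : Fin g ⊕ Fin g → R) (a : R) : (tv u a)⁻¹ = tv u (-a) := by
  rw [inv_eq_iff_mul_eq_one, ← tv_add, add_neg_cancel, tv_zero]

theorem tv_pow (u : Fin g ⊕ Fin g → R) (a : R) (n : ℕ) : tv u a ^ n = tv u (n * a) := by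
  induction n with
  | zero => simp
  | succ n ih => rw [pow_succ, ih, ← tv_add]; congr 1; push_cast; ring

/-- The form occurs once in a transvection, so a similitude rescales the parameter by the inverse
multiplier. With multiplier -1 this turns the square of a transvection into a commutator. -/
theorem conj_tv {S : GL2g g R} {m : Rˣ} (hS : IsSimilitude S m) (u : Fin g ⊕ Fin g → R) (a : R) :
    S * tv u a * S⁻¹ = tv (S.val *ᵥ u) ((m⁻¹ : Rˣ) * a) := by
  refine gl_ext fun v => ?_
  simp only [mul_val_mulVec, tv_mulVec, mulVec_add, val_mulVec_inv, mulVec_smul]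
  have := isSimilitude_iff.1 hS u ((S⁻¹).val *ᵥ v)
  rw [val_mulVec_inv] at this
  rw [this]
  congr 2
  rw [show ((m⁻¹ : Rˣ) : R) * a * (m * om u ((S⁻¹).val *ᵥ v)) =
    ((m⁻¹ : Rˣ) * (m : R)) * (a * om u ((S⁻¹).val *ᵥ v)) by ring, Units.inv_mul, one_mul]

theorem conj_tv_Sp {S : GL2g g R} (hS : S ∈ Sp g R) (u : Fin g ⊕ Fin g → R) (a : R) :
    S * tv u a * S⁻¹ = tv (S.val *ᵥ u) a := by
  rw [conj_tv (mem_Sp.1 hS)]; simp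

end Form

/-! ### Functoriality -/

section Map

variable {g : ℕ} {R S : Type*} [CommRing R] [CommRing S] (f : R →+* S)

theorem map_val (A : GL2g g R) : (GeneralLinearGroup.map f A).val = A.val.map f := rfl

theorem map_om (v w : Fin g ⊕ Fin g → R) : f (om v w) = om (f ∘ v) (f ∘ w) := by
  simp [om_apply]

theorem map_nil (u : Fin g ⊕ Fin g → R) : (nil u).map f = nil (f ∘ u) := by
  rw [nil, nil, Matrix.map_mul, map_J]
  congr 1
  ext i j
  simp [vecMulVec_apply]

theorem map_tv (u : Fin g ⊕ Fin g → R) (a : R) :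
    GeneralLinearGroup.map f (tv u a) = tv (f ∘ u) (f a) := by
  refine Units.ext ?_
  rw [map_val, tv_val, tv_val, ← map_nil]
  ext i j
  simp [Matrix.one_apply, apply_ite f]

theorem map_similitude {A : GL2g g R} {m : Rˣ} (h : IsSimilitude A m) :
    IsSimilitude (GeneralLinearGroup.map f A) (Units.map f m) := by
  unfold IsSimilitude at *
  have := congrArg (fun X => X.map f) h
  simp only [Matrix.map_mul, map_J] at this
  rw [map_val, ← Matrix.transpose_map, this]
  ext i j
  have hJ : f (J (Fin g) R i j) = J (Fin g) S i j := by
    rw [← map_J (Fin g) f]; rfl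
  simp [hJ]

theorem map_mem_Sp {A : GL2g g R} (h : A ∈ Sp g R) : GeneralLinearGroup.map f A ∈ Sp g S := by
  rw [mem_Sp] at *
  simpa using map_similitude f h

theorem map_mulVec_comp (A : GL2g g R) (v : Fin g ⊕ Fin g → R) :
    (GeneralLinearGroup.map f A).val *ᵥ (f ∘ v) = f ∘ (A.val *ᵥ v) := by
  rw [map_val]
  ext i
  simp [mulVec, dotProduct]

end Map

/-! ### Transitivity and generation over a field -/

section Field

variable {g : ℕ} {F : Type*} [Field F]

/-- The vectors whose coordinates at the hyperbolic planes with index in `s` vanish. -/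
def Vs (s : Finset (Fin g)) : Submodule F (Fin g ⊕ Fin g → F) where
  carrier := {v | ∀ j ∈ s, v (.inl j) = 0 ∧ v (.inr j) = 0}
  zero_mem' := fun _ _ => ⟨rfl, rfl⟩
  add_mem' := fun hv hw j hj => by simp [hv j hj, hw j hj]
  smul_mem' := fun c v hv j hj => by simp [hv j hj]

/-- The group generated by the transvections along the vectors in `Vs s`. -/
def Ts (F : Type*) [Field F] (s : Finset (Fin g)) : Subgroup (GL2g g F) :=
  Subgroup.closure {t | ∃ u ∈ Vs (F := F) s, ∃ a, t = tv u a}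

theorem tv_mem_Ts {s : Finset (Fin g)} {u : Fin g ⊕ Fin g → F} (hu : u ∈ Vs s) (a : F) :
    tv u a ∈ Ts F s := Subgroup.subset_closure ⟨u, hu, a, rfl⟩

theorem Ts_le_Sp (s : Finset (Fin g)) : Ts F s ≤ Sp g F := by
  rw [Ts, Subgroup.closure_le]
  rintro _ ⟨u, -, a, rfl⟩
  exact tv_mem u a

/-- Standard basis vectors. -/
abbrev ve (F : Type*) [Zero F] [One F] (j : Fin g) : Fin g ⊕ Fin g → F := Pi.single (.inl j) 1

/-- Standard basis vectors, second half. -/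
abbrev vf (F : Type*) [Zero F] [One F] (j : Fin g) : Fin g ⊕ Fin g → F := Pi.single (.inr j) 1

theorem om_ve {R : Type*} [CommRing R] (j : Fin g) (v : Fin g ⊕ Fin g → R) :
    om (ve R j) v = -v (.inr j) := by
  rw [om_apply, Finset.sum_eq_single j]
  · simp
  · intro k _ hk; simp [hk]
  · simp

theorem om_vf {R : Type*} [CommRing R] (j : Fin g) (v : Fin g ⊕ Fin g → R) :
    om (vf R j) v = v (.inl j) := by
  rw [om_apply, Finset.sum_eq_single j]
  · simp
  · intro k _ hk; simp [hk]
  · simp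

theorem ve_mem {s : Finset (Fin g)} {j : Fin g} (h : j ∉ s) : ve F j ∈ Vs s := by
  intro k hk
  have : k ≠ j := fun e => h (e ▸ hk)
  simp [this]

theorem vf_mem {s : Finset (Fin g)} {j : Fin g} (h : j ∉ s) : vf F j ∈ Vs s := by
  intro k hk
  have : k ≠ j := fun e => h (e ▸ hk)
  simp [this]

theorem exists_om_ne {s : Finset (Fin g)} {v : Fin g ⊕ Fin g → F} (hv : v ∈ Vs s) (h0 : v ≠ 0) :
    ∃ z ∈ Vs (F := F) s, om v z ≠ 0 := by
  obtain ⟨k, hk⟩ := Function.ne_iff.1 h0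
  rcases k with j | j
  · refine ⟨vf F j, vf_mem fun hj => hk (hv j hj).1, ?_⟩
    rw [om_swap, om_vf]; simpa using hk
  · refine ⟨ve F j, ve_mem fun hj => hk (hv j hj).2, ?_⟩
    rw [om_swap, om_ve]; simpa using hk

/-- A vector space is not the union of two proper subspaces, here the orthogonal complements of `v`
and `w`. -/
theorem exists_om_ne₂ {s : Finset (Fin g)} {v w : Fin g ⊕ Fin g → F} (hv : v ∈ Vs s)
    (hw : w ∈ Vs s) (hv0 : v ≠ 0) (hw0 : w ≠ 0) :
    ∃ z ∈ Vs (F := F) s, om v z ≠ 0 ∧ om w z ≠ 0 := by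
  obtain ⟨x, hx, hvx⟩ := exists_om_ne hv hv0
  obtain ⟨y, hy, hwy⟩ := exists_om_ne hw hw0
  by_cases h1 : om w x = 0
  · by_cases h2 : om v y = 0
    · exact ⟨x + y, add_mem hx hy, by simpa [h2] using hvx, by simpa [h1] using hwy⟩
    · exact ⟨y, hy, h2, hwy⟩
  · exact ⟨x, hx, hvx, h1⟩

theorem tv_sub_mulVec {v w : Fin g ⊕ Fin g → F} (h : om v w ≠ 0) :
    (tv (w - v) (om w v)⁻¹).val *ᵥ v = w := by
  have h' : om w v ≠ 0 := by rw [om_swap]; exact neg_ne_zero.2 h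
  rw [tv_mulVec, om_sub_left, om_self, sub_zero, inv_mul_cancel₀ h', one_smul, add_sub_cancel]

/-- One transvection along the difference moves a vector to any other that is not orthogonal to it;
an intermediate `z` orthogonal to neither end handles the general case. -/
theorem exists_Ts_mulVec {s : Finset (Fin g)} {v w : Fin g ⊕ Fin g → F} (hv : v ∈ Vs s)
    (hw : w ∈ Vs s) (hv0 : v ≠ 0) (hw0 : w ≠ 0) : ∃ t ∈ Ts F s, t.val *ᵥ v = w := by
  obtain ⟨z, hz, h1, h2⟩ := exists_om_ne₂ hv hw hv0 hw0
  refine ⟨tv (w - z) (om w z)⁻¹ * tv (z - v) (om z v)⁻¹,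
    mul_mem (tv_mem_Ts (sub_mem hw hz) _) (tv_mem_Ts (sub_mem hz hv) _), ?_⟩
  rw [mul_val_mulVec, tv_sub_mulVec h1, tv_sub_mulVec]
  rw [om_swap]; exact neg_ne_zero.2 h2

/-- The difference of two vectors with the same pairing with `e` is orthogonal to `e`, so the
transvection along it fixes `e`. This is the second half of moving hyperbolic pairs. -/
theorem exists_Ts_mulVec_fix {s : Finset (Fin g)} {e v w : Fin g ⊕ Fin g → F} (he : e ∈ Vs s)
    (hv : v ∈ Vs s) (hw : w ∈ Vs s) (h : om e v = om e w) (h0 : om e v ≠ 0) :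
    ∃ t ∈ Ts F s, t.val *ᵥ e = e ∧ t.val *ᵥ v = w := by
  have key : ∀ x y : Fin g ⊕ Fin g → F, x ∈ Vs s → y ∈ Vs s → om e x = om e y → om x y ≠ 0 →
      ∃ t ∈ Ts F s, t.val *ᵥ e = e ∧ t.val *ᵥ x = y := by
    intro x y hx hy hxy hne
    refine ⟨_, tv_mem_Ts (sub_mem hy hx) (om y x)⁻¹, ?_, tv_sub_mulVec hne⟩
    rw [tv_mulVec, om_sub_left, om_swap y e, om_swap x e, hxy]; simp
  by_cases hvw : om v w = 0
  -- The detour through `e + v` works because it has the same pairing with `e` as `v` and is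
  -- orthogonal to neither `v` nor `w`.
  · obtain ⟨t, ht, h1, h2⟩ := key v (e + v) hv (add_mem he hv) (by simp) (by
      rw [om_add_right, om_self, add_zero, om_swap]; exact neg_ne_zero.2 h0)
    obtain ⟨t', ht', h1', h2'⟩ := key (e + v) w (add_mem he hv) hw (by simpa using h) (by
      rw [om_add_left, hvw, add_zero, ← h]; exact h0)
    exact ⟨t' * t, mul_mem ht' ht, by rw [mul_val_mulVec, h1, h1'],
      by rw [mul_val_mulVec, h2, h2']⟩
  · exact key v w hv hw h hvw

theorem Ts_fix {s : Finset (Fin g)} {t : GL2g g F} (ht : t ∈ Ts F s) {j : Fin g} (hj : j ∈ s) :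
    t.val *ᵥ ve F j = ve F j ∧ t.val *ᵥ vf F j = vf F j := by
  induction ht using Subgroup.closure_induction with
  | mem x hx =>
    obtain ⟨u, hu, a, rfl⟩ := hx
    rw [tv_mulVec, tv_mulVec, om_swap u, om_swap u, om_ve, om_vf, (hu j hj).1, (hu j hj).2]
    simp
  | one => exact ⟨one_mulVec _, one_mulVec _⟩
  | mul x y _ _ hx hy =>
    rw [mul_val_mulVec, mul_val_mulVec, hy.1, hy.2, hx.1, hx.2]; exact ⟨rfl, rfl⟩
  | inv x _ hx =>
    constructor
    · conv_lhs => rw [← hx.1]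
      rw [val_inv_mulVec]
    · conv_lhs => rw [← hx.2]
      rw [val_inv_mulVec]

theorem Ts_mono {s s' : Finset (Fin g)} (h : s ⊆ s') : Ts F s' ≤ Ts F s := by
  refine Subgroup.closure_mono ?_
  rintro _ ⟨u, hu, a, rfl⟩
  exact ⟨u, fun j hj => hu j (h hj), a, rfl⟩

/-- Induction on the number of hyperbolic planes not yet fixed: transvections orthogonal to the
fixed planes bring one more hyperbolic pair back to its standard position. -/
theorem mem_Ts_of_fix (s : Finset (Fin g)) (S : GL2g g F) (hS : S ∈ Sp g F)
    (hfix : ∀ j ∈ s, S.val *ᵥ ve F j = ve F j ∧ S.val *ᵥ vf F j = vf F j) : S ∈ Ts F s := by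
  induction hn : (Finset.univ \ s).card generalizing s S with
  | zero =>
    have hs : ∀ j, j ∈ s := by
      intro j
      have := Finset.card_eq_zero.1 hn
      by_contra hj
      have hmem : j ∈ Finset.univ \ s := by simp [hj]
      rw [this] at hmem
      simp at hmem
    have : S = 1 := by
      refine Units.ext ?_
      refine Matrix.ext_of_mulVec_single fun i => ?_
      rcases i with j | j
      · exact (hfix j (hs j)).1.trans (one_mulVec _).symm
      · exact (hfix j (hs j)).2.trans (one_mulVec _).symm
    rw [this]; exact one_mem _
  | succ n ih =>
    obtain ⟨a, ha⟩ : (Finset.univ \ s).Nonempty := by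
      rw [← Finset.card_pos]; omega
    have has : a ∉ s := by simpa using ha
    -- `Vs s` is the orthogonal complement of the fixed planes, hence stable.
    have hmemV : ∀ (T : GL2g g F) (_ : T ∈ Sp g F)
        (_ : ∀ j ∈ s, T.val *ᵥ ve F j = ve F j ∧ T.val *ᵥ vf F j = vf F j)
        (v : Fin g ⊕ Fin g → F) (_ : v ∈ Vs s), T.val *ᵥ v ∈ Vs s := by
      intro T hT hf v hv j hj
      constructor
      · rw [← om_vf j (_ *ᵥ v), ← (hf j hj).2, om_mulVec hT, om_vf, (hv j hj).1]
      · rw [← neg_eq_zero, ← om_ve j (_ *ᵥ v), ← (hf j hj).1, om_mulVec hT, om_ve, (hv j hj).2, neg_zero]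
    have hom : om (ve F a) (vf F a) ≠ 0 := by rw [om_ve]; simp
    obtain ⟨t, ht, h1⟩ := exists_Ts_mulVec (hmemV S hS hfix _ (ve_mem has)) (ve_mem (F := F) has)
      (by
        intro h0
        have := om_mulVec hS (ve F a) (vf F a)
        rw [h0, om_zero_left] at this
        exact hom this.symm)
      (by
        intro h0
        rw [h0, om_zero_left] at hom
        exact hom rfl)
    have hS1 : t * S ∈ Sp g F := mul_mem (Ts_le_Sp _ ht) hS
    have hf1 : ∀ j ∈ s, (t * S).val *ᵥ ve F j = ve F j ∧ (t * S).val *ᵥ vf F j = vf F j := by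
      intro j hj
      rw [mul_val_mulVec, mul_val_mulVec, (hfix j hj).1, (hfix j hj).2]
      exact Ts_fix ht hj
    have he1 : (t * S).val *ᵥ ve F a = ve F a := by rw [mul_val_mulVec, h1]
    have hom1 : om (ve F a) ((t * S).val *ᵥ vf F a) = om (ve F a) (vf F a) := by
      conv_lhs => rw [← he1]
      rw [om_mulVec hS1]
    obtain ⟨t', ht', h2, h3⟩ := exists_Ts_mulVec_fix (ve_mem (F := F) has)
      (hmemV _ hS1 hf1 _ (vf_mem has)) (vf_mem (F := F) has) hom1 (by rw [hom1]; exact hom)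
    have hmem : t' * (t * S) ∈ Ts F s := by
      refine Ts_mono (Finset.subset_insert a s) (ih (insert a s) (t' * (t * S))
        (mul_mem (Ts_le_Sp _ ht') hS1) ?_ ?_)
      · intro j hj
        rw [mul_val_mulVec t', mul_val_mulVec t']
        rcases Finset.mem_insert.1 hj with rfl | hj
        · rw [he1, h2, h3]; exact ⟨rfl, rfl⟩
        · rw [(hf1 j hj).1, (hf1 j hj).2]; exact Ts_fix ht' hj
      · rw [← Finset.compl_eq_univ_sdiff, Finset.card_compl] at hn ⊢
        rw [Finset.card_insert_of_notMem has]; omega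
    rwa [Subgroup.mul_mem_cancel_left _ ht', Subgroup.mul_mem_cancel_left _ ht] at hmem

theorem Sp_eq_Ts : Sp g F = Ts F ∅ :=
  le_antisymm (fun S hS => mem_Ts_of_fix ∅ S hS (by simp)) (Ts_le_Sp _)

theorem mem_Vs_empty (v : Fin g ⊕ Fin g → F) : v ∈ Vs (F := F) ∅ := by intro j hj; simp at hj

theorem exists_Sp_mulVec {v w : Fin g ⊕ Fin g → F} (hv0 : v ≠ 0) (hw0 : w ≠ 0) :
    ∃ t ∈ Sp g F, t.val *ᵥ v = w := by
  obtain ⟨t, ht, h⟩ := exists_Ts_mulVec (mem_Vs_empty v) (mem_Vs_empty w) hv0 hw0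
  exact ⟨t, Ts_le_Sp _ ht, h⟩

theorem exists_Sp_mulVec₂ {v w v' w' : Fin g ⊕ Fin g → F} (h : om v w = om v' w')
    (h0 : om v w ≠ 0) : ∃ t ∈ Sp g F, t.val *ᵥ v = v' ∧ t.val *ᵥ w = w' := by
  have hv : v ≠ 0 := by rintro rfl; simp at h0
  have hv' : v' ≠ 0 := by rintro rfl; simp [h] at h0
  obtain ⟨t, ht, h1⟩ := exists_Sp_mulVec hv hv'
  have h2 : om v' (t.val *ᵥ w) = om v w := by rw [← h1, om_mulVec ht]
  obtain ⟨t', ht', h3, h4⟩ := exists_Ts_mulVec_fix (mem_Vs_empty v') (mem_Vs_empty (t.val *ᵥ w))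
    (mem_Vs_empty w') (h2.trans h) (by rwa [h2])
  exact ⟨t' * t, mul_mem (Ts_le_Sp _ ht') ht, by rw [mul_val_mulVec, h1, h3],
    by rw [mul_val_mulVec, h4]⟩

theorem Sp_le_of_tv_mem {K : Subgroup (GL2g g F)} (h : ∀ u a, tv u a ∈ K) : Sp g F ≤ K := by
  rw [Sp_eq_Ts, Ts, Subgroup.closure_le]
  rintro _ ⟨u, -, a, rfl⟩
  exact h u a

end Field

/-! ### Normal subgroups of the symplectic group over a prime field of odd order -/

section Normal

variable {g : ℕ}

/-- A transvection as an element of the symplectic group. -/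
def tvS {R : Type*} [CommRing R] (u : Fin g ⊕ Fin g → R) (a : R) : Sp g R := ⟨tv u a, tv_mem u a⟩

theorem conj_tvS {R : Type*} [CommRing R] (s : Sp g R) (u : Fin g ⊕ Fin g → R) (a : R) :
    s * tvS u a * s⁻¹ = tvS (s.1.val *ᵥ u) a :=
  Subtype.ext (conj_tv_Sp s.2 u a)

theorem tvS_pow {R : Type*} [CommRing R] (u : Fin g ⊕ Fin g → R) (a : R) (n : ℕ) :
    tvS u a ^ n = tvS u (n * a) := Subtype.ext (tv_pow u a n)

theorem tvS_zero {R : Type*} [CommRing R] (u : Fin g ⊕ Fin g → R) : tvS u (0 : R) = 1 :=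
  Subtype.ext (tv_zero u)

/-- The parallelogram identity for the squares of linear forms, in multiplicative form. If a
quotient identifies all four directions, it forces T² = T⁴. -/
theorem tvS_add_mul_tvS_sub {R : Type*} [CommRing R] {u v : Fin g ⊕ Fin g → R} (h : om u v = 0) :
    tvS (u + v) 1 * tvS (u - v) 1 = tvS u 1 * tvS u 1 * (tvS v 1 * tvS v 1) := by
  refine Subtype.ext (gl_ext fun x => ?_)
  change (tv (u + v) 1 * tv (u - v) 1).val *ᵥ x =
    (tv u 1 * tv u 1 * (tv v 1 * tv v 1)).val *ᵥ x
  have h' : om v u = 0 := by rw [om_swap, h, neg_zero]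
  simp only [mul_val_mulVec, tv_mulVec, om_add_right, om_sub_right, om_smul_right, om_self,
    om_add_left, om_sub_left, h, h']
  module

theorem exists_om_eq_one {F : Type*} [Field F] {v : Fin g ⊕ Fin g → F} (hv : v ≠ 0) :
    ∃ y, om v y = 1 := by
  obtain ⟨y, -, hy⟩ := exists_om_ne (mem_Vs_empty v) hv
  exact ⟨(om v y)⁻¹ • y, by rw [om_smul_right, inv_mul_cancel₀ hy]⟩

/-- Supplies a transvection that fixes `v` but moves `w`. -/
theorem exists_om_separating {F : Type*} [Field F] {v w : Fin g ⊕ Fin g → F} (hv : v ≠ 0)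
    (hw : ∀ c : F, w ≠ c • v) : ∃ z, om z v = 0 ∧ om z w = 1 := by
  obtain ⟨y, hy⟩ := exists_om_eq_one hv
  have h1 : w - om w y • v ≠ 0 := fun h => hw _ (sub_eq_zero.1 h)
  obtain ⟨x, hx⟩ := exists_om_eq_one h1
  refine ⟨om v x • y - x, ?_, ?_⟩
  · rw [om_sub_left, om_smul_left, om_swap y, om_swap x, hy]; ring
  · rw [om_sub_left, om_smul_left, om_swap y, om_swap x]
    rw [om_sub_left, om_smul_left] at hx
    linear_combination hx

/-- Comparing a vector, a partner of pairing 1 and their sum gives a common eigenvalue; preservation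
of the form makes its square 1. -/
theorem sq_eq_one_of_forall_eigenvector {F : Type*} [Field F] {n : GL2g g F} (hn : n ∈ Sp g F)
    (h : ∀ v, ∃ c : F, n.val *ᵥ v = c • v) : n ^ 2 = 1 := by
  refine gl_ext fun v => ?_
  rw [pow_two, mul_val_mulVec, Units.val_one, one_mulVec]
  by_cases hv : v = 0
  · simp [hv]
  obtain ⟨w, hw⟩ := exists_om_eq_one hv
  obtain ⟨c, hc⟩ := h v
  obtain ⟨d, hd⟩ := h w
  obtain ⟨e, he⟩ := h (v + w)
  have h1 := om_mulVec hn v w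
  rw [mulVec_add, hc, hd] at he
  rw [hc, hd] at h1
  have h2 := congrArg (om v) he
  have h3 := congrArg (fun x => om x w) he
  simp only [om_add_left, om_add_right, om_smul_left, om_smul_right, om_self, hw] at h1 h2 h3
  have hcd : c = d := by linear_combination h3 - h2
  rw [hc, mulVec_smul, hc, smul_smul]
  rw [hcd] at h1 ⊢
  rw [show d * d = 1 by linear_combination h1, one_smul]

variable {q : ℕ} [Fact q.Prime]

/-- Conjugation by the kernel element identifies the images of the transvections along `v` and `w =
n v`. A transvection fixing `v` and moving `w` then gives two directions with pairing 1 and the same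
image; transitivity extends this to all such pairs. Chains of such pairs feed the parallelogram
identity, so the image T of a transvection satisfies T² = 1 as well as T^q = 1. -/
theorem hom_eq_one_of_not_eigenvector (hg : 2 ≤ g) (hq : q ≠ 2) {Q : Type*} [Group Q]
    (φ : Sp g (ZMod q) →* Q) {n : Sp g (ZMod q)} (hn : φ n = 1) {v : Fin g ⊕ Fin g → ZMod q}
    (hv : ∀ c : ZMod q, n.1.val *ᵥ v ≠ c • v) : φ = 1 := by
  set τ : (Fin g ⊕ Fin g → ZMod q) → Q := fun u => φ (tvS u 1) with hτ
  have hconj : ∀ (s : Sp g (ZMod q)) u, τ (s.1.val *ᵥ u) = φ s * τ u * (φ s)⁻¹ := by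
    intro s u
    rw [hτ]
    simp only
    rw [← conj_tvS, map_mul, map_mul, map_inv]
  have hinv : ∀ (s : Sp g (ZMod q)) x y, τ x = τ y → τ (s.1.val *ᵥ x) = τ (s.1.val *ᵥ y) := by
    intro s x y h
    rw [hconj, hconj, h]
  have hv0 : v ≠ 0 := by
    rintro rfl
    exact hv 0 (by simp)
  set w := n.1.val *ᵥ v with hw
  have h1 : τ v = τ w := by rw [hw, hconj, hn]; simp
  obtain ⟨z, hz1, hz2⟩ := exists_om_separating hv0 hv
  have h2 := hinv (tvS z 1) v w h1
  have h3 : (tvS z 1).1.val *ᵥ v = v := by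
    change (tv z 1).val *ᵥ v = v
    rw [tv_mulVec, hz1]; simp
  have h4 : (tvS z 1).1.val *ᵥ w = w + z := by
    change (tv z 1).val *ᵥ w = w + z
    rw [tv_mulVec, hz2]; simp
  rw [h3, h4, h1] at h2
  have hpair : ∀ x y, om x y = 1 → τ x = τ y := by
    intro x y hxy
    have h0 : om (w + z) w = 1 := by simp [hz2]
    obtain ⟨s, hs, e1, e2⟩ := exists_Sp_mulVec₂ (h0.trans hxy.symm) (by rw [h0]; exact one_ne_zero)
    rw [← e1, ← e2]
    exact hinv ⟨s, hs⟩ _ _ h2.symm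
  let a : Fin g := ⟨0, by omega⟩
  let b : Fin g := ⟨1, by omega⟩
  have hab : a ≠ b := by simp [a, b, Fin.ext_iff]
  -- The vectors `ve a`, `ve b` and `ve a ± ve b` are linked to `ve a` through a common partner
  -- having pairing 1 with both.
  have e1 : τ (ve _ a) = τ (ve _ b) :=
    (hpair _ (-(vf _ a) - vf _ b) (by rw [om_ve]; simp [hab])).trans
    (hpair _ (-(vf _ a) - vf _ b) (by rw [om_ve]; simp [hab.symm])).symm
  have e2 : τ (ve _ a) = τ (ve _ a + ve _ b) :=
    (hpair _ (-(vf _ a)) (by rw [om_ve]; simp)).trans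
    (hpair _ (-(vf _ a)) (by rw [om_add_left, om_ve, om_ve]; simp [hab.symm])).symm
  have e3 : τ (ve _ a) = τ (ve _ a - ve _ b) :=
    (hpair _ (-(vf _ a)) (by rw [om_ve]; simp)).trans
    (hpair _ (-(vf _ a)) (by rw [om_sub_left, om_ve, om_ve]; simp [hab.symm])).symm
  have hom : om (ve (ZMod q) a) (ve (ZMod q) b) = 0 := by rw [om_ve]; simp
  have h5 : τ (ve _ a) * τ (ve _ a) =
      τ (ve _ a) * τ (ve _ a) * (τ (ve _ a) * τ (ve _ a)) := by
    have : τ (ve _ a + ve _ b) * τ (ve _ a - ve _ b) =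
        τ (ve _ a) * τ (ve _ a) * (τ (ve _ b) * τ (ve _ b)) := by
      simp only [hτ, ← map_mul]
      rw [tvS_add_mul_tvS_sub hom]
    rwa [← e2, ← e3, ← e1] at this
  have h6 : τ (ve _ a) ^ 2 = 1 := by
    rw [pow_two]
    exact left_eq_mul.1 h5
  have h7 : τ (ve _ a) ^ q = 1 := by
    rw [hτ]
    simp only
    rw [← map_pow, tvS_pow]
    simp [tvS_zero]
  have h8 : τ (ve _ a) = 1 := by
    have hc : Nat.Coprime 2 q :=
      (Nat.coprime_primes Nat.prime_two Fact.out).2 (Ne.symm hq)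
    have := pow_gcd_eq_one.2 ⟨h6, h7⟩
    rwa [hc, pow_one] at this
  have h9 : ∀ u, τ u = 1 := by
    intro u
    by_cases hu : u = 0
    · have : tvS (0 : Fin g ⊕ Fin g → ZMod q) 1 = 1 :=
        Subtype.ext (gl_ext fun x => by
          change (tv _ 1).val *ᵥ x = _
          rw [tv_mulVec]; simp)
      rw [hu, hτ]
      simp only
      rw [this, map_one]
    · have ha0 : (ve (ZMod q) a) ≠ 0 := by simp
      obtain ⟨s, hs, e⟩ := exists_Sp_mulVec ha0 hu
      rw [← e]
      have := hconj ⟨s, hs⟩ (ve _ a)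
      rw [h8] at this
      simpa using this
  have hall : Sp g (ZMod q) ≤ φ.ker.map (Sp g (ZMod q)).subtype := by
    refine Sp_le_of_tv_mem fun u c => ⟨tvS u c, ?_, rfl⟩
    have : tvS u c = tvS u 1 ^ c.val := by rw [tvS_pow]; simp
    change tvS u c ∈ φ.ker
    rw [MonoidHom.mem_ker, this, map_pow]
    change τ u ^ _ = 1
    rw [h9, one_pow]
  refine MonoidHom.ext fun s => ?_
  obtain ⟨s', hs', e⟩ := hall s.2
  rw [← Subtype.ext (a1 := s') (a2 := s) e]
  exact hs'

theorem hom_eq_one_or_sq_eq_one (hg : 2 ≤ g) (hq : q ≠ 2) {Q : Type*} [Group Q]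
    (φ : Sp g (ZMod q) →* Q) : φ = 1 ∨ ∀ n, φ n = 1 → n ^ 2 = 1 := by
  by_cases h : ∀ n : Sp g (ZMod q), φ n = 1 → ∀ v, ∃ c : ZMod q, n.1.val *ᵥ v = c • v
  · exact .inr fun n hn => Subtype.ext (sq_eq_one_of_forall_eigenvector n.2 (h n hn))
  · push Not at h
    obtain ⟨n, hn, v, hv⟩ := h
    exact .inl (hom_eq_one_of_not_eigenvector hg hq φ hn hv)

/-- A group of symplectic matrices normalized by the symplectic group either has exponent two or
is the whole symplectic group. -/
theorem normal_dichotomy (hg : 2 ≤ g) (hq : q ≠ 2) {A : Subgroup (GL2g g (ZMod q))}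
    (hA : ∀ s ∈ Sp g (ZMod q), ∀ a ∈ A, s * a * s⁻¹ ∈ A) :
    Sp g (ZMod q) ≤ A ∨ ∀ a ∈ A, a ∈ Sp g (ZMod q) → a ^ 2 = 1 := by
  have hn : (A.subgroupOf (Sp g (ZMod q))).Normal :=
    ⟨fun a ha s => hA s.1 s.2 a.1 ha⟩
  rcases hom_eq_one_or_sq_eq_one hg hq (QuotientGroup.mk' (A.subgroupOf (Sp g (ZMod q)))) with h | h
  · left
    intro s hs
    have := DFunLike.congr_fun h ⟨s, hs⟩
    exact (QuotientGroup.eq_one_iff (N := A.subgroupOf (Sp g (ZMod q))) ⟨s, hs⟩).1 this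
  · right
    intro a ha hs
    exact congrArg Subtype.val (h ⟨a, hs⟩ ((QuotientGroup.eq_one_iff _).2 ha))

/-- All transvections with parameter 1 along nonzero vectors are conjugate, so a quotient of two of
them dies in the abelianization. Such a quotient is not scalar, and the abelianization is therefore
trivial. -/
theorem commutator_Sp (hg : 2 ≤ g) (hq : q ≠ 2) :
    ⁅Sp g (ZMod q), Sp g (ZMod q)⁆ = Sp g (ZMod q) := by
  refine le_antisymm (Subgroup.commutator_le.2 fun x hx y hy =>
    mul_mem (mul_mem (mul_mem hx hy) (inv_mem hx)) (inv_mem hy)) ?_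
  let a : Fin g := ⟨0, by omega⟩
  let b : Fin g := ⟨1, by omega⟩
  have hne : a ≠ b := by simp [a, b, Fin.ext_iff]
  obtain ⟨s, hs, e⟩ := exists_Sp_mulVec (v := ve (ZMod q) a) (w := ve (ZMod q) b)
    (by simp) (by simp)
  have hab : Abelianization.of (G := Sp g (ZMod q)) = 1 := by
    refine hom_eq_one_of_not_eigenvector hg hq _
      (n := tvS (ve (ZMod q) b) 1 * (tvS (ve (ZMod q) a) 1)⁻¹) (v := vf (ZMod q) a) ?_ ?_
    · have := conj_tvS ⟨s, hs⟩ (ve (ZMod q) a) 1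
      rw [e] at this
      rw [← this, map_mul, map_mul, map_mul, map_inv, map_inv]
      simp
    · intro c hc
      have h1 : (tv (ve (ZMod q) b) 1 * (tv (ve (ZMod q) a) 1)⁻¹).val *ᵥ vf (ZMod q) a =
          c • vf (ZMod q) a := hc
      rw [tv_inv, mul_val_mulVec, tv_mulVec, tv_mulVec, om_add_right, om_smul_right, om_ve, om_ve,
        om_ve] at h1
      have := congrFun h1 (.inl a)
      simp [hne.symm] at this
  intro s hs
  have := DFunLike.congr_fun hab ⟨s, hs⟩
  have h2 : (⟨s, hs⟩ : Sp g (ZMod q)) ∈ commutator (Sp g (ZMod q)) := by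
    rw [← Abelianization.ker_of]; exact this
  rw [commutator_def] at h2
  have h3 := Subgroup.mem_map_of_mem (Sp g (ZMod q)).subtype h2
  rw [Subgroup.map_commutator] at h3
  rwa [← MonoidHom.range_eq_map, Subgroup.range_subtype] at h3

end Normal

/-! ### Congruences between `p`-adic matrices -/

section Congruence

variable {g : ℕ} {p : Nat.Primes}

/-- Square matrices of size `2g`. -/
abbrev Mat (g : ℕ) (R : Type*) : Type _ := Matrix (Fin g ⊕ Fin g) (Fin g ⊕ Fin g) R

instance compactSpace_matrix {m n R : Type*} [TopologicalSpace R] [CompactSpace R] :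
    CompactSpace (Matrix m n R) := inferInstanceAs (CompactSpace (m → n → R))

instance compactSpace_GL2g {R : Type*} [CommRing R] [TopologicalSpace R] [IsTopologicalRing R]
    [T1Space R] [CompactSpace R] : CompactSpace (GL2g g R) :=
  haveI : T1Space (Mat g R) := inferInstanceAs (T1Space (Fin g ⊕ Fin g → Fin g ⊕ Fin g → R))
  inferInstanceAs (CompactSpace (Mat g R)ˣ)

/-- Reduction modulo `p` of `p`-adic matrices. -/
noncomputable def rho (g : ℕ) (p : Nat.Primes) : Mat g ℤ_[(p : ℕ)] →+* Mat g (ZMod (p : ℕ)) :=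
  (PadicInt.toZMod (p := (p : ℕ))).mapMatrix

/-- Congruence modulo `p ^ k`. -/
def Cg (k : ℕ) (A B : Mat g ℤ_[(p : ℕ)]) : Prop := ∃ Z, A = B + ((p : ℕ) : ℤ_[(p : ℕ)]) ^ k • Z

theorem Cg.symm {k : ℕ} {A B : Mat g ℤ_[(p : ℕ)]} (h : Cg k A B) : Cg k B A := by
  obtain ⟨Z, rfl⟩ := h
  exact ⟨-Z, by simp⟩

theorem Cg.mul_left {k : ℕ} {A B : Mat g ℤ_[(p : ℕ)]} (h : Cg k A B) (C : Mat g ℤ_[(p : ℕ)]) :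
    Cg k (C * A) (C * B) := by
  obtain ⟨Z, rfl⟩ := h
  exact ⟨C * Z, by rw [mul_add, mul_smul_comm]⟩

theorem Cg.mono {k l : ℕ} (hkl : k ≤ l) {A B : Mat g ℤ_[(p : ℕ)]} (h : Cg l A B) : Cg k A B := by
  obtain ⟨Z, rfl⟩ := h
  obtain ⟨m, rfl⟩ := Nat.exists_eq_add_of_le hkl
  exact ⟨((p : ℕ) : ℤ_[(p : ℕ)]) ^ m • Z, by rw [smul_smul, ← pow_add]⟩

theorem rho_apply (A : Mat g ℤ_[(p : ℕ)]) (i j) : rho g p A i j = PadicInt.toZMod (A i j) := rfl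

theorem rho_val (A : GL2g g ℤ_[(p : ℕ)]) : rho g p A.val = (red g p A).val := rfl

@[simp] theorem rho_smul (c : ℤ_[(p : ℕ)]) (A : Mat g ℤ_[(p : ℕ)]) :
    rho g p (c • A) = PadicInt.toZMod c • rho g p A := by
  ext i j
  simp [rho_apply]

theorem rho_J : rho g p (J (Fin g) ℤ_[(p : ℕ)]) = J (Fin g) (ZMod (p : ℕ)) := map_J (Fin g) _

theorem rho_nil (u : Fin g ⊕ Fin g → ℤ_[(p : ℕ)]) : rho g p (nil u) = nil (PadicInt.toZMod ∘ u) :=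
  map_nil _ u

theorem toZMod_p : PadicInt.toZMod ((p : ℕ) : ℤ_[(p : ℕ)]) = 0 := by simp

theorem toZMod_p_pow {k : ℕ} (hk : k ≠ 0) :
    PadicInt.toZMod (((p : ℕ) : ℤ_[(p : ℕ)]) ^ k) = 0 := by
  rw [map_pow, toZMod_p, zero_pow hk]

theorem toZMod_eq_zero {a : ℤ_[(p : ℕ)]} (h : PadicInt.toZMod a = 0) :
    ∃ b, a = ((p : ℕ) : ℤ_[(p : ℕ)]) * b := by
  have : a ∈ RingHom.ker (PadicInt.toZMod : ℤ_[(p : ℕ)] →+* _) := h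
  rw [PadicInt.ker_toZMod, PadicInt.maximalIdeal_eq_span_p, Ideal.mem_span_singleton] at this
  exact this

theorem exists_eq_smul_of_rho_eq_zero {A : Mat g ℤ_[(p : ℕ)]} (h : rho g p A = 0) :
    ∃ Z, A = ((p : ℕ) : ℤ_[(p : ℕ)]) • Z := by
  have : ∀ i j, ∃ b, A i j = ((p : ℕ) : ℤ_[(p : ℕ)]) * b := fun i j =>
    toZMod_eq_zero (congrFun (congrFun h i) j)
  choose b hb using this
  exact ⟨of b, by ext i j; rw [hb]; rfl⟩

theorem Cg_one_iff {A B : Mat g ℤ_[(p : ℕ)]} : Cg 1 A B ↔ rho g p A = rho g p B := by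
  constructor
  · rintro ⟨Z, rfl⟩
    simp
  · intro h
    obtain ⟨Z, hZ⟩ := exists_eq_smul_of_rho_eq_zero (A := A - B) (by rw [map_sub, h, sub_self])
    exact ⟨Z, by rw [pow_one, ← hZ, add_sub_cancel]⟩

theorem Cg_one_iff_red {A B : GL2g g ℤ_[(p : ℕ)]} : Cg 1 A.val B.val ↔ red g p A = red g p B := by
  rw [Cg_one_iff, rho_val, rho_val, Units.ext_iff]

theorem rho_surjective : Function.Surjective (rho g p) := by
  intro A
  choose b hb using fun i j => ZMod.ringHom_surjective (PadicInt.toZMod (p := (p : ℕ))) (A i j)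
  exact ⟨of b, by ext i j; exact hb i j⟩

/-- Separatedness of the p-adic filtration; with compactness it lets closed sets be tested by
congruences. -/
theorem eq_of_forall_Cg {A B : Mat g ℤ_[(p : ℕ)]} (h : ∀ k, Cg k A B) : A = B := by
  ext i j
  refine PadicInt.ext_of_toZModPow.1 fun n => ?_
  obtain ⟨Z, rfl⟩ := h n
  have : PadicInt.toZModPow n (((p : ℕ) : ℤ_[(p : ℕ)]) ^ n) = 0 := by
    rw [map_pow, map_natCast, ← Nat.cast_pow, ZMod.natCast_self]
  simp [this]

theorem smul_p_pow_injective (k : ℕ) :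
    Function.Injective fun A : Mat g ℤ_[(p : ℕ)] => ((p : ℕ) : ℤ_[(p : ℕ)]) ^ k • A :=
  smul_right_injective _ (pow_ne_zero _ (Nat.cast_ne_zero.2 p.2.ne_zero))

theorem isClosed_Cg (k : ℕ) (B : Mat g ℤ_[(p : ℕ)]) :
    IsClosed {A : GL2g g ℤ_[(p : ℕ)] | Cg k A.val B} := by
  have h : IsClosed (Set.range fun Z : Mat g ℤ_[(p : ℕ)] =>
      B + ((p : ℕ) : ℤ_[(p : ℕ)]) ^ k • Z) := by
    refine (isCompact_range ?_).isClosed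
    exact continuous_const.add ((continuous_id.const_smul (((p : ℕ) : ℤ_[(p : ℕ)]) ^ k)).congr fun _ => rfl)
  have h2 := h.preimage (Units.continuous_val (M := Mat g ℤ_[(p : ℕ)]))
  convert h2 using 1
  ext A
  simp only [Set.mem_ofPred_eq, Set.mem_preimage, Set.mem_range, Cg, eq_comm]

theorem mem_of_forall_exists_Cg {C : Set (GL2g g ℤ_[(p : ℕ)])} (hC : IsClosed C)
    {y : GL2g g ℤ_[(p : ℕ)]} (h : ∀ k, ∃ c ∈ C, Cg k c.val y.val) : y ∈ C := by
  obtain ⟨x, hx⟩ := IsCompact.nonempty_iInter_of_sequence_nonempty_isCompact_isClosed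
    (fun k => C ∩ {A | Cg k A.val y.val})
    (fun k x hx => ⟨hx.1, hx.2.mono k.le_succ⟩)
    (fun k => let ⟨c, hc, h'⟩ := h k; ⟨c, hc, h'⟩)
    (hC.inter (isClosed_Cg _ _)).isCompact
    (fun k => hC.inter (isClosed_Cg _ _))
  rw [Set.mem_iInter] at hx
  have : x = y := Units.ext (eq_of_forall_Cg fun k => (hx k).2)
  exact this ▸ (hx 0).1

end Congruence

/-! ### The graded pieces of a group of `p`-adic matrices -/

section Graded

variable {g : ℕ} {p : Nat.Primes}

/-- The matrices `X` modulo `p` such that `C` has an element congruent to `1 + p ^ k X`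
modulo `p ^ (k + 1)`. -/
def gr (C : Subgroup (GL2g g ℤ_[(p : ℕ)])) (k : ℕ) (hk : k ≠ 0) :
    AddSubgroup (Mat g (ZMod (p : ℕ))) where
  carrier := {X | ∃ x ∈ C, ∃ Y, x.val = 1 + ((p : ℕ) : ℤ_[(p : ℕ)]) ^ k • Y ∧ rho g p Y = X}
  zero_mem' := ⟨1, C.one_mem, 0, by simp, map_zero _⟩
  add_mem' := by
    rintro _ _ ⟨x, hx, Y, hxY, rfl⟩ ⟨x', hx', Y', hxY', rfl⟩
    refine ⟨x * x', C.mul_mem hx hx', Y + Y' + ((p : ℕ) : ℤ_[(p : ℕ)]) ^ k • (Y * Y'), ?_, ?_⟩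
    · rw [Units.val_mul, hxY, hxY', mul_add, add_mul, add_mul, mul_one, mul_one, smul_add,
        smul_add, one_mul, smul_mul_smul_comm, smul_smul]
      abel
    · rw [map_add, map_add, rho_smul, toZMod_p_pow hk, zero_smul, add_zero]
  neg_mem' := by
    rintro _ ⟨x, hx, Y, hxY, rfl⟩
    refine ⟨x⁻¹, C.inv_mem hx, -((x⁻¹).val * Y), ?_, ?_⟩
    · have h : (x⁻¹).val * x.val = 1 := by rw [← Units.val_mul]; simp
      rw [hxY, mul_add, mul_one, mul_smul_comm] at h
      rw [smul_neg, ← h]; simp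
    · have h : rho g p (x⁻¹).val = 1 := by
        have h : (x⁻¹).val * x.val = 1 := by rw [← Units.val_mul]; simp
        have h' := congrArg (rho g p) h
        rw [map_mul, map_one, hxY, map_add, rho_smul, toZMod_p_pow hk, map_one] at h'
        simpa using h'
      rw [map_neg, map_mul, h, one_mul]

theorem smul_mem_of_zmod {n : ℕ} [NeZero n] {M : Type*} [AddCommGroup M] [Module (ZMod n) M]
    (L : AddSubgroup M) (c : ZMod n) {x : M} (hx : x ∈ L) : c • x ∈ L := by
  have : c • x = c.val • x := by
    rw [← Nat.cast_smul_eq_nsmul (ZMod n), ZMod.natCast_zmod_val]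
  rw [this]
  exact L.nsmul_mem hx _

/-- Symmetric matrices are spanned by the squares u uᵀ: the off-diagonal ones come from polarization
and the diagonal ones are squares of basis vectors. No division by 2 occurs, so n = 2 is allowed. -/
theorem sym_mul_J_mem {n : ℕ} [NeZero n] {L : AddSubgroup (Mat g (ZMod n))} (h : ∀ u, nil u ∈ L)
    {S : Mat g (ZMod n)} (hS : Sᵀ = S) : S * J (Fin g) (ZMod n) ∈ L := by
  have hD : ∀ i, single i i (1 : ZMod n) * J (Fin g) (ZMod n) ∈ L := by
    intro i
    have : single i i (1 : ZMod n) = vecMulVec (Pi.single i 1) (Pi.single i 1) := by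
      rw [single_eq_single_vecMulVec_single]
    rw [this]
    exact h _
  have hU : ∀ i j, (single i j (1 : ZMod n) + single j i 1) * J (Fin g) (ZMod n) ∈ L := by
    intro i j
    have : (single i j (1 : ZMod n) + single j i 1) * J (Fin g) (ZMod n) =
        nil (Pi.single i 1 + Pi.single j 1) - nil (Pi.single i 1) - nil (Pi.single j 1) := by
      rw [nil, nil, nil, ← sub_mul, ← sub_mul]
      congr 1
      rw [add_vecMulVec, vecMulVec_add, vecMulVec_add, single_eq_single_vecMulVec_single,
        single_eq_single_vecMulVec_single]
      abel
    rw [this]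
    exact L.sub_mem (L.sub_mem (h _) (h _)) (h _)
  have hUU : ∀ U : Mat g (ZMod n), (U + Uᵀ) * J (Fin g) (ZMod n) ∈ L := by
    intro U
    have : (U + Uᵀ) * J (Fin g) (ZMod n) =
        ∑ i, ∑ j, U i j • ((single i j (1 : ZMod n) + single j i 1) * J (Fin g) (ZMod n)) := by
      simp only [← smul_mul_assoc, ← Finset.sum_mul]
      congr 1
      simp only [smul_add, Finset.sum_add_distrib, smul_single, smul_eq_mul, mul_one]
      congr 1
      · exact matrix_eq_sum_single U
      · rw [Finset.sum_comm]; exact matrix_eq_sum_single Uᵀ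
    rw [this]
    exact sum_mem fun i _ => sum_mem fun j _ => smul_mem_of_zmod L _ (hU i j)
  -- An auxiliary linear order on the indices, used only to form the strict upper triangle `U` of
  -- `S`.
  let r : Fin g ⊕ Fin g → ℕ := Sum.elim (fun i => i) (fun i => g + i)
  have hr : Function.Injective r := by
    rintro (a | a) (b | b) hab <;> simp [r, Fin.ext_iff] at hab ⊢ <;> omega
  let U : Mat g (ZMod n) := of fun i j => if r i < r j then S i j else 0
  have : S = U + Uᵀ + ∑ i, S i i • single i i (1 : ZMod n) := by
    ext i j
    have hij : S j i = S i j := congrFun (congrFun hS i) j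
    rw [Matrix.add_apply, Matrix.sum_apply]
    by_cases e : i = j
    · subst e
      rw [Finset.sum_eq_single i]
      · simp [U]
      · intro b _ hb; simp [hb]
      · simp
    · have hne : r i ≠ r j := fun h => e (hr h)
      rw [Finset.sum_eq_zero]
      · rcases lt_or_gt_of_ne hne with h | h
        · simp [U, h, h.le]
        · simp [U, h, h.le, hij]
      · intro b _
        rw [Matrix.smul_apply, single_apply_of_ne, smul_zero]
        rintro ⟨rfl, rfl⟩
        exact e rfl
  rw [this, add_mul, Finset.sum_mul]
  refine L.add_mem (hUU U) (sum_mem fun i _ => ?_)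
  rw [smul_mul_assoc]
  exact smul_mem_of_zmod L _ (hD i)

theorem infinitesimal_of_Sp {y : GL2g g ℤ_[(p : ℕ)]} (hy : y ∈ Sp g ℤ_[(p : ℕ)]) {k : ℕ}
    (hk : k ≠ 0) {Y : Mat g ℤ_[(p : ℕ)]} (h : y.val = 1 + ((p : ℕ) : ℤ_[(p : ℕ)]) ^ k • Y) :
    (rho g p Y)ᵀ * J (Fin g) (ZMod (p : ℕ)) + J (Fin g) (ZMod (p : ℕ)) * rho g p Y = 0 := by
  have h1 := mem_Sp.1 hy
  unfold IsSimilitude at h1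
  rw [h, transpose_add, transpose_one, transpose_smul, Units.val_one, one_smul] at h1
  have h2 : Yᵀ * J (Fin g) ℤ_[(p : ℕ)] + J (Fin g) ℤ_[(p : ℕ)] * Y +
      ((p : ℕ) : ℤ_[(p : ℕ)]) ^ k • (Yᵀ * J (Fin g) ℤ_[(p : ℕ)] * Y) = 0 := by
    refine smul_p_pow_injective k ?_
    simp only [add_mul, mul_add, one_mul, mul_one, smul_mul_assoc, mul_smul_comm, smul_add,
      smul_zero] at h1 ⊢
    have h3 := sub_eq_zero.2 h1
    rw [← h3]; abel
  have h4 := congrArg (rho g p) h2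
  rw [map_add, map_add, rho_smul, toZMod_p_pow hk, zero_smul, add_zero, map_mul, map_mul, rho_J,
    map_zero] at h4
  exact h4

/-- The symplectic Lie algebra is the space of symmetric matrices times `J`, in every
characteristic. -/
theorem eq_sym_mul_J {R : Type*} [CommRing R] {X : Mat g R}
    (h : Xᵀ * J (Fin g) R + J (Fin g) R * X = 0) :
    (-(X * J (Fin g) R))ᵀ = -(X * J (Fin g) R) ∧ -(X * J (Fin g) R) * J (Fin g) R = X := by
  have hJ := J_squared (Fin g) R
  constructor
  · rw [transpose_neg, transpose_mul, J_transpose, neg_mul, neg_neg]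
    have h1 : J (Fin g) R * (Xᵀ * J (Fin g) R + J (Fin g) R * X) * J (Fin g) R = 0 := by
      rw [h]; simp
    have h2 : J (Fin g) R * (Xᵀ * J (Fin g) R + J (Fin g) R * X) * J (Fin g) R =
        J (Fin g) R * Xᵀ * (J (Fin g) R * J (Fin g) R) +
        (J (Fin g) R * J (Fin g) R) * (X * J (Fin g) R) := by noncomm_ring
    rw [h2, hJ] at h1
    simp only [mul_neg, mul_one, neg_mul, one_mul] at h1
    have := eq_neg_of_add_eq_zero_left h1
    rw [neg_neg] at this
    rw [← this, neg_neg]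
  · rw [neg_mul, Matrix.mul_assoc, hJ]; simp

/-- A closed group of symplectic matrices all of whose graded pieces are everything contains the
principal congruence subgroup. -/
theorem mem_of_Cg_one {C : Subgroup (GL2g g ℤ_[(p : ℕ)])} (hC : IsClosed (C : Set (GL2g g ℤ_[(p : ℕ)])))
    (hCS : C ≤ Sp g ℤ_[(p : ℕ)]) (h : ∀ k hk u, nil u ∈ gr C k hk) {y : GL2g g ℤ_[(p : ℕ)]}
    (hy : y ∈ Sp g ℤ_[(p : ℕ)]) (h1 : Cg 1 y.val 1) : y ∈ C := by
  have : ∀ k, ∃ c ∈ C, Cg (k + 1) c.val y.val := by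
    intro k
    induction k with
    | zero => exact ⟨1, C.one_mem, h1.symm⟩
    | succ k ih =>
      obtain ⟨c, hc, hcy⟩ := ih
      have h2 : Cg (k + 1) (c⁻¹ * y).val 1 := by
        have := hcy.symm.mul_left (c⁻¹).val
        rwa [← Units.val_mul, ← Units.val_mul, inv_mul_cancel, Units.val_one] at this
      obtain ⟨Y, hY⟩ := h2
      -- The leading term of the error lies in the Lie algebra, hence in the graded piece of `C`;
      -- multiplying by an element of `C` with that leading term improves the approximation by one
      -- power of p.
      have h3 := infinitesimal_of_Sp (mul_mem (inv_mem (hCS hc)) hy) k.succ_ne_zero hY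
      obtain ⟨h4, h5⟩ := eq_sym_mul_J h3
      have h6 := sym_mul_J_mem (h (k + 1) k.succ_ne_zero) h4
      rw [h5] at h6
      obtain ⟨x, hx, Y', hxY, hYY⟩ := h6
      refine ⟨c * x, C.mul_mem hc hx, ?_⟩
      have h7 : Cg (k + 2) x.val (c⁻¹ * y).val := by
        obtain ⟨Z, rfl⟩ := Cg_one_iff.2 hYY
        refine ⟨Z, ?_⟩
        rw [hxY, hY, smul_add, smul_smul, ← pow_add, ← add_assoc]
      have := h7.mul_left c.val
      rwa [← Units.val_mul, ← Units.val_mul, mul_inv_cancel_left] at this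
  refine mem_of_forall_exists_Cg hC fun k => ?_
  obtain ⟨c, hc, h'⟩ := this k
  exact ⟨c, hc, h'.mono k.le_succ⟩

end Graded

/-! ### Lifting from the residue field, for odd `p` -/

section LiftOdd

/-- Binomial expansion with a cubic remainder, valid in a noncommutative ring because everything is
a polynomial in `m`. For n = p odd the quadratic coefficient is divisible by p. -/
theorem one_add_pow_cubic {A : Type*} [Ring A] (m : A) (n : ℕ) :
    ∃ z, (1 + m) ^ n = 1 + n • m + n.choose 2 • (m * m) + m * m * m * z := by
  induction n with
  | zero => exact ⟨0, by simp⟩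
  | succ n ih =>
    obtain ⟨z, hz⟩ := ih
    refine ⟨z + z * m + n.choose 2 • 1, ?_⟩
    rw [pow_succ, hz, Nat.choose_succ_succ' n 1, Nat.choose_one_right]
    simp only [add_smul, mul_add, add_mul, mul_one, one_mul, smul_mul_assoc, mul_smul_comm,
      one_smul, ← mul_assoc]
    abel

variable {g : ℕ} {p : Nat.Primes}

theorem choose_two_eq (hp : (p : ℕ) ≠ 2) : ∃ c, (p : ℕ).choose 2 = c * (p : ℕ) := by
  have h : (p : ℕ) ∣ (p : ℕ).choose 2 :=
    p.2.dvd_choose_self two_ne_zero (lt_of_le_of_ne p.2.two_le (Ne.symm hp))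
  obtain ⟨c, hc⟩ := h
  exact ⟨c, by rw [hc, mul_comm]⟩

/-- For odd `p`, raising to the power `p` carries each graded piece into the next. -/
theorem gr_le_succ (hp : (p : ℕ) ≠ 2) (C : Subgroup (GL2g g ℤ_[(p : ℕ)])) (k : ℕ) (hk : k ≠ 0) :
    gr C k hk ≤ gr C (k + 1) k.succ_ne_zero := by
  rintro _ ⟨x, hx, Y, hxY, rfl⟩
  obtain ⟨z, hz⟩ := one_add_pow_cubic (((p : ℕ) : ℤ_[(p : ℕ)]) ^ k • Y) (p : ℕ)
  obtain ⟨c, hc⟩ := choose_two_eq hp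
  obtain ⟨l, rfl⟩ := Nat.exists_eq_succ_of_ne_zero hk
  set π : ℤ_[(p : ℕ)] := ((p : ℕ) : ℤ_[(p : ℕ)]) with hπ
  refine ⟨x ^ (p : ℕ), C.pow_mem hx _, Y + π • ((π ^ l * c) • (Y * Y) + π ^ (2 * l) • (Y * Y * Y * z)),
    ?_, ?_⟩
  · rw [Units.val_pow_eq_pow_val, hxY, hz, hc, ← Nat.cast_smul_eq_nsmul ℤ_[(p : ℕ)],
      ← Nat.cast_smul_eq_nsmul ℤ_[(p : ℕ)], Nat.cast_mul, ← hπ]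
    simp only [smul_mul_assoc, mul_smul_comm, smul_smul, smul_add]
    rw [add_assoc, add_assoc]
    congr 1
    rw [← add_assoc, ← add_assoc]
    congr 1
    · congr 1
      · congr 1; rw [Nat.succ_eq_add_one]; ring
      · congr 1; rw [Nat.succ_eq_add_one]; ring
    · congr 1; rw [Nat.succ_eq_add_one]; ring
  · rw [map_add, rho_smul, toZMod_p, zero_smul, add_zero]

theorem conj_mem_gr {C : Subgroup (GL2g g ℤ_[(p : ℕ)])} {k : ℕ} {hk : k ≠ 0}
    {X : Mat g (ZMod (p : ℕ))} (hX : X ∈ gr C k hk) {c : GL2g g ℤ_[(p : ℕ)]} (hc : c ∈ C) :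
    (red g p c).val * X * (red g p c)⁻¹.val ∈ gr C k hk := by
  obtain ⟨x, hx, Y, hxY, rfl⟩ := hX
  refine ⟨c * x * c⁻¹, C.mul_mem (C.mul_mem hc hx) (C.inv_mem hc), c.val * Y * (c⁻¹).val, ?_, ?_⟩
  · rw [Units.val_mul, Units.val_mul, hxY, mul_add, add_mul, mul_one, mul_smul_comm,
      smul_mul_assoc]
    congr 1
    rw [← Units.val_mul]; simp
  · rw [map_mul, map_mul, rho_val, rho_val, map_inv]

theorem conj_nil {R : Type*} [CommRing R] {s : GL2g g R} (hs : s ∈ Sp g R)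
    (u : Fin g ⊕ Fin g → R) : s.val * nil u * (s⁻¹).val = nil (s.val *ᵥ u) := by
  refine ext_mulVec fun v => ?_
  rw [← mulVec_mulVec, ← mulVec_mulVec, nil_mulVec, nil_mulVec, mulVec_smul]
  congr 1
  rw [← om_mulVec hs, val_mulVec_inv]

theorem om_infinitesimal {R : Type*} [CommRing R] {X : Mat g R}
    (h : Xᵀ * J (Fin g) R + J (Fin g) R * X = 0) (v w : Fin g ⊕ Fin g → R) :
    om v (X *ᵥ w) = om w (X *ᵥ v) := by
  have h1 : om v (X *ᵥ w) + om (X *ᵥ v) w = v ⬝ᵥ ((Xᵀ * J (Fin g) R + J (Fin g) R * X) *ᵥ w) := by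
    rw [add_mulVec, dotProduct_add, om, om, ← mulVec_mulVec, ← mulVec_mulVec,
      dotProduct_mulVec v Xᵀ, vecMul_transpose, add_comm]
  rw [h, zero_mulVec, dotProduct_zero, om_swap (X *ᵥ v)] at h1
  linear_combination h1

theorem two_ne_zero_zmod (hp : (p : ℕ) ≠ 2) : (2 : ZMod (p : ℕ)) ≠ 0 := by
  intro h
  have : ((2 : ℕ) : ZMod (p : ℕ)) = 0 := by exact_mod_cast h
  rw [ZMod.natCast_eq_zero_iff] at this
  exact hp ((Nat.prime_dvd_prime_iff_eq p.2 Nat.prime_two).1 this)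

/-- The symplectic Lie algebra modulo an odd prime is irreducible under the symplectic group. -/
theorem nil_mem_of_conj_invariant (hp : (p : ℕ) ≠ 2) {L : AddSubgroup (Mat g (ZMod (p : ℕ)))}
    (hL : ∀ s ∈ Sp g (ZMod (p : ℕ)), ∀ X ∈ L, s.val * X * (s⁻¹).val ∈ L)
    {X : Mat g (ZMod (p : ℕ))} (hX : X ∈ L) (hX0 : X ≠ 0)
    (hXJ : Xᵀ * J (Fin g) (ZMod (p : ℕ)) + J (Fin g) (ZMod (p : ℕ)) * X = 0)
    (u : Fin g ⊕ Fin g → ZMod (p : ℕ)) : nil u ∈ L := by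
  have h2 := two_ne_zero_zmod hp
  obtain ⟨v, hv⟩ : ∃ v, om v (X *ᵥ v) ≠ 0 := by
    -- The pairing `om v (X *ᵥ w)` is symmetric, so for odd p it vanishes if its quadratic form
    -- does.
    by_contra! hcon
    refine hX0 (ext_mulVec fun v => ?_)
    rw [zero_mulVec]
    by_contra hne
    obtain ⟨y, hy⟩ := exists_om_eq_one hne
    have h1 := hcon (y + v)
    rw [mulVec_add, om_add_left, om_add_right, om_add_right, hcon, hcon, om_infinitesimal hXJ v y,
      om_swap y, hy] at h1
    apply h2
    linear_combination -h1
  have h3 : nil v ∈ L := by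
    -- With N = `nil v`, the sum of the conjugates by 1 + N and 1 - N is 2X - 2NXN, and NXN is a
    -- multiple of N.
    have e : (tv v 1).val * X * ((tv v 1)⁻¹).val + (tv v (-1)).val * X * ((tv v (-1))⁻¹).val
        - (2 : ZMod (p : ℕ)) • X = (-2 * om v (X *ᵥ v)) • nil v := by
      refine ext_mulVec fun w => ?_
      rw [tv_inv, tv_inv, neg_neg]
      simp only [sub_mulVec, add_mulVec, ← mulVec_mulVec, smul_mulVec, tv_mulVec, mulVec_add,
        mulVec_smul, nil_mulVec]
      module
    have h4 : (-2 * om v (X *ᵥ v)) • nil v ∈ L := by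
      rw [← e]
      exact L.sub_mem (L.add_mem (hL _ (tv_mem _ _) _ hX) (hL _ (tv_mem _ _) _ hX))
        (smul_mem_of_zmod L _ hX)
    have h5 := smul_mem_of_zmod L (-2 * om v (X *ᵥ v))⁻¹ h4
    rwa [smul_smul, inv_mul_cancel₀ (mul_ne_zero (neg_ne_zero.2 h2) hv), one_smul] at h5
  by_cases hu : u = 0
  · rw [hu]
    have : (nil 0 : Mat g (ZMod (p : ℕ))) = 0 := by simp [nil]
    rw [this]; exact L.zero_mem
  · have hv0 : v ≠ 0 := by
      rintro rfl
      simp at hv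
    obtain ⟨s, hs, rfl⟩ := exists_Sp_mulVec hv0 hu
    rw [← conj_nil hs]
    exact hL s hs _ h3

/-- A lift of a transvection commuting modulo `p ^ 2` with a lift of a suitable second
transvection has a `p`-th power that is nontrivial modulo `p ^ 2`. -/
theorem exists_pow_eq_of_nil_mul (hp : (p : ℕ) ≠ 2) {x : GL2g g ℤ_[(p : ℕ)]}
    {N Y : Mat g ℤ_[(p : ℕ)]} (hN : N * N = 0)
    (hx : x.val = 1 + N + ((p : ℕ) : ℤ_[(p : ℕ)]) • Y)
    (hNYN : rho g p N * rho g p Y * rho g p N = 0) :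
    ∃ B, (x ^ (p : ℕ)).val = 1 + ((p : ℕ) : ℤ_[(p : ℕ)]) ^ 1 • B ∧ rho g p B = rho g p N := by
  set π : ℤ_[(p : ℕ)] := ((p : ℕ) : ℤ_[(p : ℕ)]) with hπ
  set M := N + π • Y with hM
  set A := N * Y + Y * N + π • (Y * Y) with hA
  -- Since M² is divisible by p, the cubic remainder is p times A M z. The hypothesis on N Y N makes
  -- A M vanish modulo p, so this remainder does not affect the leading term.
  have h2 : M * M = π • A := by
    rw [hM, hA, mul_add, add_mul, add_mul, hN, mul_smul_comm, smul_mul_assoc, smul_mul_smul_comm,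
      smul_add, smul_add, smul_smul, zero_add]
    abel
  obtain ⟨z, hz⟩ := one_add_pow_cubic M (p : ℕ)
  obtain ⟨c, hc⟩ := choose_two_eq hp
  refine ⟨M + (c * π) • A + A * M * z, ?_, ?_⟩
  · rw [Units.val_pow_eq_pow_val, hx, add_assoc, ← hM, hz, hc, h2,
      ← Nat.cast_smul_eq_nsmul ℤ_[(p : ℕ)], ← Nat.cast_smul_eq_nsmul ℤ_[(p : ℕ)], Nat.cast_mul,
      ← hπ, pow_one]
    simp only [smul_mul_assoc, smul_smul, smul_add]
    rw [add_assoc, add_assoc, add_assoc]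
    congr 3
    congr 1; ring
  · have hMN : rho g p M = rho g p N := by
      rw [hM, map_add, rho_smul, hπ, toZMod_p, zero_smul, add_zero]
    have hNN : rho g p N * rho g p N = 0 := by rw [← map_mul, hN, map_zero]
    have hAM : rho g p (A * M) = 0 := by
      rw [map_mul, hMN, hA, map_add, map_add, rho_smul, hπ, toZMod_p, zero_smul, add_zero,
        map_mul, map_mul, add_mul, hNYN, mul_assoc, hNN, mul_zero, add_zero]
    rw [map_add, map_add, map_mul, hAM, rho_smul, map_mul, hπ, toZMod_p, mul_zero, zero_smul,
      hMN]
    simp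

/-- If the first graded piece vanished, commuting elements modulo p would have lifts in `C`
commuting modulo p². Applied to a transvection and a suitable unipotent element, this kills the
obstruction N Y N, and the p-th power of the lifted transvection is then 1 + pN modulo p², a
contradiction. The argument covers p = 3. -/
theorem gr_one_ne_bot (hg : 2 ≤ g) (hp : (p : ℕ) ≠ 2) {C : Subgroup (GL2g g ℤ_[(p : ℕ)])}
    (hC : Sp g (ZMod (p : ℕ)) ≤ C.map (red g p)) : gr C 1 one_ne_zero ≠ ⊥ := by
  intro hbot
  let a : Fin g := ⟨0, by omega⟩
  let b : Fin g := ⟨1, by omega⟩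
  have hab : a ≠ b := by simp [a, b, Fin.ext_iff]
  set π : ℤ_[(p : ℕ)] := ((p : ℕ) : ℤ_[(p : ℕ)]) with hπ
  let u := ve ℤ_[(p : ℕ)] a
  let w := ve ℤ_[(p : ℕ)] b
  let z := vf ℤ_[(p : ℕ)] b
  have huw : om u w = 0 := by rw [om_ve]; simp [w]
  have hwu : om w u = 0 := by rw [om_swap, huw, neg_zero]
  have hzu : om z u = 0 := by rw [om_vf]; simp [u, hab]
  have hzw : om z w = 1 := by rw [om_vf]; simp [w]
  let t := tv u (1 : ℤ_[(p : ℕ)])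
  -- Polarization gives the unipotent map v ↦ v + `om w v` u + `om u v` w. It commutes with `t`, and
  -- its last term lets pairing with `z` detect `om u`.
  let h := tv (u + w) (1 : ℤ_[(p : ℕ)]) * tv u (-1) * tv w (-1)
  have hh : ∀ v, h.val *ᵥ v = v + om w v • u + om u v • w := by
    intro v
    simp only [h, mul_val_mulVec, tv_mulVec, om_add_left, om_add_right, om_smul_right, huw, hwu,
      om_self]
    module
  have ht : ∀ v, t.val *ᵥ v = v + om u v • u := by
    intro v
    simp only [t, tv_mulVec, one_mul]
  have hcomm : h.val * t.val = t.val * h.val := by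
    refine ext_mulVec fun v => ?_
    simp only [← mulVec_mulVec, hh, ht, om_add_right, om_smul_right, huw, hwu, om_self]
    module
  have htS : t ∈ Sp g ℤ_[(p : ℕ)] := tv_mem _ _
  have hhS : h ∈ Sp g ℤ_[(p : ℕ)] := mul_mem (mul_mem (tv_mem _ _) (tv_mem _ _)) (tv_mem _ _)
  obtain ⟨x, hx, hxt⟩ := hC (map_mem_Sp PadicInt.toZMod htS)
  obtain ⟨y, hy, hyh⟩ := hC (map_mem_Sp PadicInt.toZMod hhS)
  obtain ⟨Y, hY⟩ := Cg_one_iff_red.2 hxt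
  obtain ⟨W, hW⟩ := Cg_one_iff_red.2 hyh
  rw [pow_one, ← hπ] at hY hW
  have hred : red g p x = red g p t := hxt
  have hredh : red g p y = red g p h := hyh
  have hc : Cg 1 (y * x * y⁻¹ * x⁻¹).val (1 : GL2g g ℤ_[(p : ℕ)]).val := by
    rw [Cg_one_iff_red]
    simp only [map_mul, map_inv, hred, hredh, map_one]
    have : h * t = t * h := Units.ext hcomm
    rw [← map_mul, this, map_mul]; group
  obtain ⟨Z, hZ⟩ := hc
  have hZ0 : rho g p Z = 0 := by
    have : rho g p Z ∈ gr C 1 one_ne_zero :=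
      ⟨_, C.mul_mem (C.mul_mem (C.mul_mem hy hx) (C.inv_mem hy)) (C.inv_mem hx), Z, hZ, rfl⟩
    rwa [hbot, AddSubgroup.mem_bot] at this
  obtain ⟨Z', rfl⟩ := exists_eq_smul_of_rho_eq_zero hZ0
  have hyx : y.val * x.val = x.val * y.val + π • π • (Z' * (x.val * y.val)) := by
    have e : (y * x).val = (y * x * y⁻¹ * x⁻¹).val * (x * y).val := by
      rw [← Units.val_mul]; congr 1; group
    rw [Units.val_mul, hZ, Units.val_mul, Units.val_one, add_mul, one_mul, pow_one,
      smul_mul_assoc, smul_mul_assoc] at e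
    exact e
  have heq : h.val * Y + W * t.val - (Y * h.val + t.val * W) =
      π • (Y * W - W * Y + Z' * (x.val * y.val)) := by
    refine smul_p_pow_injective 1 ?_
    simp only [pow_one, ← hπ]
    rw [smul_sub, smul_add, smul_add, smul_smul, smul_add, smul_sub, sub_eq_iff_eq_add]
    rw [smul_smul] at hyx
    set Q := Z' * (x.val * y.val)
    rw [hY, hW] at hyx
    simp only [mul_add, add_mul, smul_mul_assoc, mul_smul_comm, smul_add, smul_smul, hcomm] at hyx
    have h0 := sub_eq_zero.2 hyx
    rw [← sub_eq_zero, ← h0]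
    abel
  -- The commutation relation modulo p², divided by p, is evaluated at the common fixed vector `u`
  -- and paired with `z`; the terms containing `W` cancel.
  have hu : om (PadicInt.toZMod ∘ u) (rho g p Y *ᵥ (PadicInt.toZMod ∘ u)) = 0 := by
    have h0 : PadicInt.toZMod (om z ((h.val * Y + W * t.val - (Y * h.val + t.val * W)) *ᵥ u)) =
        0 := by
      rw [heq, smul_mulVec, om_smul_right, map_mul, hπ, toZMod_p, zero_mul]
    have h1 : om z ((h.val * Y + W * t.val - (Y * h.val + t.val * W)) *ᵥ u) = om u (Y *ᵥ u) := by
      have hhu : h.val *ᵥ u = u := by rw [hh, hwu, om_self]; simp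
      have htu : t.val *ᵥ u = u := by rw [ht, om_self]; simp
      simp only [sub_mulVec, add_mulVec, ← mulVec_mulVec, hhu, htu, hh, ht, om_sub_right,
        om_add_right, om_smul_right, hzu, hzw]
      ring
    rw [h1, map_om] at h0
    convert h0 using 2
    ext i
    simp [mulVec, dotProduct, rho_apply]
  obtain ⟨B, hB1, hB2⟩ := exists_pow_eq_of_nil_mul (x := x) hp (nil_mul_nil u) (Y := Y)
    (by rw [hY]; simp [t, tv_val, hπ]) (by
      rw [rho_nil]
      refine ext_mulVec fun v => ?_
      simp only [← mulVec_mulVec, nil_mulVec, mulVec_smul, hu]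
      simp)
  have hmem : rho g p B ∈ gr C 1 one_ne_zero := ⟨_, C.pow_mem hx _, B, hB1, rfl⟩
  rw [hbot, AddSubgroup.mem_bot, hB2, rho_nil] at hmem
  have h3 := congrArg (fun M => M *ᵥ vf (ZMod (p : ℕ)) a) hmem
  simp only [nil_mulVec, zero_mulVec] at h3
  have h4 := congrFun h3 (.inl a)
  have hru : (PadicInt.toZMod ∘ u : Fin g ⊕ Fin g → ZMod (p : ℕ)) = ve _ a := by
    ext i
    simp only [u, Function.comp, Pi.single_apply]
    split_ifs <;> simp
  rw [hru, om_ve] at h4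
  simp at h4

/-- A closed group of symplectic `p`-adic matrices, `p` odd, that reduces onto the symplectic group
modulo `p` is the whole symplectic group. -/
theorem Sp_le_of_red (hg : 2 ≤ g) (hp : (p : ℕ) ≠ 2) {C : Subgroup (GL2g g ℤ_[(p : ℕ)])}
    (hclosed : IsClosed (C : Set (GL2g g ℤ_[(p : ℕ)]))) (hCS : C ≤ Sp g ℤ_[(p : ℕ)])
    (hC : Sp g (ZMod (p : ℕ)) ≤ C.map (red g p)) : Sp g ℤ_[(p : ℕ)] ≤ C := by
  obtain ⟨⟨X, hX⟩, hX0⟩ := AddSubgroup.ne_bot_iff_exists_ne_zero.1 (gr_one_ne_bot hg hp hC)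
  have h1 : ∀ u, nil u ∈ gr C 1 one_ne_zero := by
    refine nil_mem_of_conj_invariant hp ?_ hX (fun h => hX0 (Subtype.ext h)) ?_
    · intro s hs X hX
      obtain ⟨c, hc, rfl⟩ := hC hs
      exact conj_mem_gr hX hc
    · obtain ⟨x, hx, Y, hxY, rfl⟩ := hX
      exact infinitesimal_of_Sp (hCS hx) one_ne_zero hxY
  have h2 : ∀ k hk u, nil u ∈ gr C k hk := by
    intro k hk u
    induction k with
    | zero => exact absurd rfl hk
    | succ k ih =>
      by_cases h : k = 0
      · subst h; exact h1 u
      · exact gr_le_succ hp C k h (ih h)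
  intro y hy
  obtain ⟨c, hc, hcy⟩ := hC (map_mem_Sp PadicInt.toZMod hy)
  have h3 : c⁻¹ * y ∈ C := by
    refine mem_of_Cg_one hclosed hCS h2 (mul_mem (inv_mem (hCS hc)) hy) ?_
    refine (Cg_one_iff_red (B := 1)).2 ?_
    rw [map_mul, map_inv, hcy, map_one]
    exact inv_mul_cancel _
  exact (Subgroup.mul_mem_cancel_left C (C.inv_mem hc)).1 h3

end LiftOdd

/-! ### Lifting symplectic matrices modulo p to p-adic ones -/

section LiftSurjective

variable {g : ℕ} {p : Nat.Primes}

theorem Sp_le_map_red : Sp g (ZMod (p : ℕ)) ≤ (Sp g ℤ_[(p : ℕ)]).map (red g p) := by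
  refine Sp_le_of_tv_mem fun u a => ?_
  choose b hb using ZMod.ringHom_surjective (PadicInt.toZMod (p := (p : ℕ)))
  refine ⟨tv (b ∘ u) (b a), tv_mem _ _, ?_⟩
  rw [red, map_tv, hb]
  congr 1
  ext i
  exact hb _

end LiftSurjective

/-! ### The symmetric group -/

section Letters

variable {g i : ℕ}

/-- There are 2g+i ≥ 5 letters, so the alternating group is the commutator subgroup of the symmetric
group on them; the statement is carried over from the subtype of moved letters. -/
theorem letters_le_commutator (hg : 2 ≤ g) (hi : i = 1 ∨ i = 2) :
    letters g i ⊓ alternatingGroup (Fin (2 * g + 2)) ≤ ⁅letters g i, letters g i⁆ := by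
  let P : Fin (2 * g + 2) → Prop := fun k => (k : ℕ) < 2 * g + i
  have hrange : letters g i = (Equiv.Perm.ofSubtype (p := P)).range := by
    ext σ
    rw [Equiv.Perm.mem_range_ofSubtype_iff]
    constructor
    · intro h x hx
      by_contra hx'
      exact (Equiv.Perm.mem_support.1 hx) (h x (not_lt.1 hx'))
    · intro h k hk
      by_contra hne
      exact absurd (h (Equiv.Perm.mem_support.2 hne)) (not_lt.2 hk)
  have hcard : 5 ≤ Nat.card (Subtype P) := by
    let f : Fin 5 → Subtype P := fun k => ⟨⟨k, by omega⟩, show (k : ℕ) < 2 * g + i by omega⟩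
    have hf : Function.Injective f := by
      intro a b hab
      simpa [f, Fin.ext_iff] using hab
    simpa using Nat.card_le_card_of_injective f hf
  rintro σ ⟨h1, h2⟩
  rw [hrange] at h1 ⊢
  obtain ⟨τ, rfl⟩ := h1
  have h3 : τ ∈ alternatingGroup (Subtype P) := by
    rw [Equiv.Perm.mem_alternatingGroup] at *
    rwa [← Equiv.Perm.sign_ofSubtype]
  rw [← alternatingGroup.commutator_perm_eq hcard, commutator_def] at h3
  rw [MonoidHom.range_eq_map, ← Subgroup.map_commutator]
  exact Subgroup.mem_map_of_mem _ h3

theorem commutator_letters_le :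
    ⁅letters g i, letters g i⁆ ≤ letters g i ⊓ alternatingGroup (Fin (2 * g + 2)) :=
  le_inf (Subgroup.commutator_le_self _)
    ((Subgroup.commutator_mono le_top le_top).trans alternatingGroup.commutator_perm_le)

theorem swap_mem_letters (hi : i = 1 ∨ i = 2) {j k : Fin (2 * g + 2)} (hj : (j : ℕ) < 2 * g + 1)
    (hk : (k : ℕ) < 2 * g + 1) : Equiv.swap j k ∈ letters g i := by
  intro l hl
  refine Equiv.swap_apply_of_ne_of_ne ?_ ?_
  · rintro rfl; omega
  · rintro rfl; omega

end Letters

/-! ### The action of permutations on W through symplectic matrices -/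

section PermMatrix

variable {g : ℕ} {b : Module.Basis (Fin g ⊕ Fin g) (ZMod 2) (W g)}

theorem permMatrix_mulVec (σ : Equiv.Perm (Fin (2 * g + 2))) (x : W g) :
    (permMatrix b σ).val *ᵥ b.repr x = b.repr ((permW g σ).val x) := by
  have h := GeneralLinearGroup.toLin'_apply b (permMatrix b σ) x
  have h2 : GeneralLinearGroup.toLin' b (permMatrix b σ) = permW g σ :=
    (GeneralLinearGroup.toLin' b).apply_symm_apply _
  rw [h2] at h
  have h3 : (permW g σ).val x = Fintype.linearCombination (ZMod 2) b
      ((permMatrix b σ).val *ᵥ b.repr x) := h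
  rw [h3, Fintype.linearCombination_apply]
  ext r
  rw [b.repr_sum_self]

theorem wForm_eq_om (hb : IsSymplecticBasis b) (x y : W g) :
    wForm g x y = om (b.repr x) (b.repr y) := by
  have h1 : wForm g x y = ∑ r, ∑ s, b.repr x r * (b.repr y s * J (Fin g) (ZMod 2) r s) := by
    conv_lhs => rw [← b.sum_repr x, ← b.sum_repr y]
    simp only [map_sum, LinearMap.sum_apply, map_smul, LinearMap.smul_apply, smul_eq_mul, hb _ _]
    rw [Finset.sum_comm]
    refine Finset.sum_congr rfl fun r _ => ?_
    simp only [Finset.mul_sum]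
    refine Finset.sum_congr rfl fun s _ => ?_
    ring
  rw [h1, om, dotProduct]
  refine Finset.sum_congr rfl fun r _ => ?_
  rw [← Finset.mul_sum]
  congr 1
  refine Finset.sum_congr rfl fun s _ => ?_
  ring

/-- The sum of two coordinate vectors, in the hyperplane. -/
def pairPerp (j k : Fin (2 * g + 2)) : tPerp g :=
  ⟨Pi.single j 1 + Pi.single k 1, by
    change (Pi.single j 1 + Pi.single k 1) ⬝ᵥ tVec g = 0
    rw [add_dotProduct, single_dotProduct, single_dotProduct]
    exact CharTwo.add_self_eq_zero _⟩

/-- The sum of two coordinate vectors, in `W`. -/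
def pair (j k : Fin (2 * g + 2)) : W g := Submodule.Quotient.mk (pairPerp j k)

theorem wForm_pair (j k : Fin (2 * g + 2)) (v : tPerp g) :
    wForm g (pair j k) (Submodule.Quotient.mk v) = v.1 j + v.1 k := by
  rw [pair, wForm_mk]
  change (Pi.single j 1 + Pi.single k 1) ⬝ᵥ v.1 = _
  rw [add_dotProduct, single_dotProduct, single_dotProduct, one_mul, one_mul]

/-- A transposition changes a vector only when its two coordinates differ, and then by adding 1 to
both. -/
theorem permW_swap {j k : Fin (2 * g + 2)} (hjk : j ≠ k) (x : W g) :
    (permW g (Equiv.swap j k)).val x = x + wForm g (pair j k) x • pair j k := by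
  obtain ⟨v, rfl⟩ := Submodule.Quotient.mk_surjective _ x
  rw [wForm_pair]
  change Submodule.Quotient.mk (permPerp g (Equiv.swap j k) v) =
    Submodule.Quotient.mk (v + (v.1 j + v.1 k) • pairPerp j k)
  congr 1
  refine Subtype.ext (funext fun l => ?_)
  rw [permPerp_apply]
  change v.1 ((Equiv.swap j k)⁻¹ l) = v.1 l + (v.1 j + v.1 k) *
    ((Pi.single j 1 : Fin (2 * g + 2) → ZMod 2) l + (Pi.single k 1 : Fin (2 * g + 2) → ZMod 2) l)
  rw [Equiv.swap_inv]
  have h2 : ∀ a : ZMod 2, a + a = 0 := CharTwo.add_self_eq_zero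
  by_cases h : l = j
  · subst h
    rw [Equiv.swap_apply_left]
    simp only [Pi.single_eq_same, Pi.single_eq_of_ne hjk, add_zero, mul_one]
    linear_combination -h2 (v.1 l)
  · by_cases h' : l = k
    · subst h'
      rw [Equiv.swap_apply_right]
      simp only [Pi.single_eq_same, Pi.single_eq_of_ne h, zero_add, mul_one]
      linear_combination -h2 (v.1 l)
    · rw [Equiv.swap_apply_of_ne_of_ne h h']
      simp [h, h']

theorem permMatrix_swap (hb : IsSymplecticBasis b) {j k : Fin (2 * g + 2)} (hjk : j ≠ k) :
    permMatrix b (Equiv.swap j k) = tv (b.repr (pair j k)) 1 := by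
  refine gl_ext fun v => ?_
  obtain ⟨x, rfl⟩ : ∃ x, ⇑(b.repr x) = v := ⟨b.equivFun.symm v, b.equivFun.apply_symm_apply v⟩
  rw [permMatrix_mulVec, permW_swap hjk, tv_mulVec, one_mul, ← wForm_eq_om hb, map_add, map_smul]
  rfl

theorem permMatrix_mem_Sp (hb : IsSymplecticBasis b) (σ : Equiv.Perm (Fin (2 * g + 2))) :
    permMatrix b σ ∈ Sp g (ZMod 2) := by
  induction σ using Equiv.Perm.swap_induction_on with
  | one => rw [map_one]; exact one_mem _
  | swap_mul f x y hxy hf =>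
    rw [map_mul, permMatrix_swap hb hxy]
    exact mul_mem (tv_mem _ _) hf

theorem symGrp_le_Sp (hb : IsSymplecticBasis b) (i : ℕ) : symGrp b i ≤ Sp g (ZMod 2) := by
  rintro _ ⟨σ, -, rfl⟩
  exact permMatrix_mem_Sp hb σ

theorem exists_ne_three (hg : 2 ≤ g) (a b c : Fin (2 * g + 2)) : ∃ d, d ≠ a ∧ d ≠ b ∧ d ≠ c := by
  have h : ({a, b, c} : Finset (Fin (2 * g + 2))).card < Finset.univ.card (α := Fin (2 * g + 2)) := by
    refine lt_of_le_of_lt Finset.card_le_three ?_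
    simp; omega
  obtain ⟨d, -, hd⟩ := Finset.exists_mem_notMem_of_card_lt_card h
  simp at hd
  exact ⟨d, hd.1, hd.2.1, hd.2.2⟩

/-- If σ moves `j` and acts trivially, it changes the pair {j, k} only by a multiple of t. The
change is nonzero at `σ j` but zero at a coordinate outside {j, k, σ j, σ k}, which exists because
2g+2 > 4. -/
theorem permMatrix_injective (hg : 2 ≤ g) : Function.Injective (permMatrix b) := by
  refine (injective_iff_map_eq_one _).2 fun σ hσ => ?_
  have h1 : permW g σ = 1 := by
    have := (GeneralLinearGroup.toLin' b).apply_symm_apply (permW g σ)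
    have h : (GeneralLinearGroup.toLin' b).symm (permW g σ) = 1 := hσ
    rw [← this, h, map_one]
  by_contra hne
  obtain ⟨j, hj⟩ : ∃ j, σ j ≠ j := by
    by_contra! h
    exact hne (Equiv.ext h)
  obtain ⟨k, hk1, hk2, -⟩ := exists_ne_three hg j (σ j) j
  have h2 : (permW g σ).val (pair j k) = pair j k := by rw [h1]; rfl
  have h3 : permPerp g σ (pairPerp j k) - pairPerp j k ∈ tLine g :=
    (Submodule.Quotient.eq _).1 h2
  obtain ⟨c, hc⟩ := Submodule.mem_span_singleton.1 (Submodule.mem_comap.1 h3)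
  have h4 : ∀ l, c = (pairPerp j k).1 (σ⁻¹ l) - (pairPerp j k).1 l := by
    intro l
    have := congrFun hc l
    simpa [tVec, permPerp_apply] using this
  have hpp : ∀ l, l ≠ j → l ≠ k → (pairPerp j k).1 l = 0 := by
    intro l h h'
    change (Pi.single j 1 + Pi.single k 1 : Fin (2 * g + 2) → ZMod 2) l = 0
    simp [h, h']
  have hpj : (pairPerp j k).1 j = 1 := by
    change (Pi.single j 1 + Pi.single k 1 : Fin (2 * g + 2) → ZMod 2) j = 1
    simp [hk1.symm]
  have h5 : c = 1 := by
    rw [h4 (σ j), hpp _ hj hk2.symm, sub_zero, ← hpj]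
    simp
  have h6 : ∃ l, l ≠ j ∧ l ≠ k ∧ l ≠ σ j ∧ l ≠ σ k := by
    have h : ({j, k, σ j, σ k} : Finset (Fin (2 * g + 2))).card <
        Finset.univ.card (α := Fin (2 * g + 2)) := by
      refine lt_of_le_of_lt Finset.card_le_four ?_
      simp; omega
    obtain ⟨d, -, hd⟩ := Finset.exists_mem_notMem_of_card_lt_card h
    simp at hd
    exact ⟨d, hd.1, hd.2.1, hd.2.2.1, hd.2.2.2⟩
  obtain ⟨l, h7, h8, h9, h10⟩ := h6
  have h11 := h4 l
  rw [hpp l h7 h8, hpp, h5] at h11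
  · simp at h11
  · rintro h; exact h9 (by rw [← h]; simp)
  · rintro h; exact h10 (by rw [← h]; simp)

theorem pair_ne_zero (hg : 2 ≤ g) {j k : Fin (2 * g + 2)} (hjk : j ≠ k) : pair j k ≠ 0 := by
  obtain ⟨l, h1, h2, -⟩ := exists_ne_three hg j k k
  intro h
  have h3 := wForm_pair j k (pairPerp j l)
  rw [h] at h3
  have h4 : (pairPerp j l).1 j + (pairPerp j l).1 k = 1 := by
    change (Pi.single j 1 + Pi.single l 1 : Fin (2 * g + 2) → ZMod 2) j +
      (Pi.single j 1 + Pi.single l 1 : Fin (2 * g + 2) → ZMod 2) k = 1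
    simp [h1.symm, h2.symm, hjk.symm]
  rw [h4] at h3
  simp at h3

theorem pair_self (j : Fin (2 * g + 2)) : pair j j = (0 : W g) := by
  have : pairPerp j j = (0 : tPerp g) := Subtype.ext (CharTwo.add_self_eq_zero _)
  rw [pair, this]; rfl

theorem pair_add (j k l : Fin (2 * g + 2)) : (pair j l + pair k l : W g) = pair j k := by
  have : pairPerp j l + pairPerp k l = pairPerp j k := by
    refine Subtype.ext ?_
    change (Pi.single j 1 + Pi.single l 1 + (Pi.single k 1 + Pi.single l 1) : Fin (2 * g + 2) → ZMod 2)
      = Pi.single j 1 + Pi.single k 1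
    have h : (Pi.single l 1 + Pi.single l 1 : Fin (2 * g + 2) → ZMod 2) = 0 :=
      CharTwo.add_self_eq_zero _
    linear_combination h
  exact congrArg (tLine g).mkQ this

/-- Adding t if necessary makes the coordinate `m` vanish; the support then avoids `m`. It has even
size, so the contributions of `l` cancel. -/
theorem exists_sum_pair (l : Fin (2 * g + 2)) (x : W g) (m : Fin (2 * g + 2)) :
    ∃ s : Finset (Fin (2 * g + 2)), m ∉ s ∧ x = ∑ j ∈ s, pair j l := by
  classical
  obtain ⟨v, rfl⟩ := Submodule.Quotient.mk_surjective _ x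
  have ht : tVec g ∈ tPerp g := by
    change tVec g ⬝ᵥ tVec g = 0
    simp only [tVec, dotProduct, mul_one, Finset.sum_const, Finset.card_univ, Fintype.card_fin]
    rw [nsmul_eq_mul, mul_one]
    push_cast
    have : (2 : ZMod 2) = 0 := rfl
    rw [this]; simp
  let v' : tPerp g := v + v.1 m • ⟨tVec g, ht⟩
  have hv : (Submodule.Quotient.mk v : W g) = Submodule.Quotient.mk v' := by
    rw [Submodule.Quotient.eq]
    refine Submodule.mem_span_singleton.2 ⟨-v.1 m, ?_⟩
    change (-v.1 m) • tVec g = v.1 - (v.1 + v.1 m • tVec g)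
    rw [neg_smul]; abel
  have hm : v'.1 m = 0 := by
    change v.1 m + v.1 m * 1 = 0
    rw [mul_one]
    exact CharTwo.add_self_eq_zero _
  refine ⟨Finset.univ.filter fun j => v'.1 j ≠ 0, by simp [hm], ?_⟩
  have hsum : v' = ∑ j ∈ Finset.univ.filter (fun j => v'.1 j ≠ 0), pairPerp j l := by
    refine Subtype.ext ?_
    have h1 : ∑ j, v'.1 j = 0 := by
      have : v'.1 ⬝ᵥ tVec g = 0 := v'.2
      simpa [dotProduct, tVec] using this
    have h2 : ∀ j, (if v'.1 j ≠ 0 then (1 : ZMod 2) else 0) = v'.1 j := by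
      intro j
      generalize v'.1 j = a
      revert a
      decide
    ext k
    rw [Submodule.coe_sum, Finset.sum_apply, Finset.sum_filter]
    have h3 : ∀ j, (if v'.1 j ≠ 0 then (pairPerp j l).1 k else 0) =
        v'.1 j * Pi.single (M := fun _ => ZMod 2) j 1 k +
        v'.1 j * Pi.single (M := fun _ => ZMod 2) l 1 k := by
      intro j
      rw [← mul_add]
      conv_rhs => rw [← h2 j]
      split_ifs
      · rw [one_mul]; rfl
      · rw [zero_mul]
    rw [Finset.sum_congr rfl fun j _ => h3 j, Finset.sum_add_distrib, ← Finset.sum_mul, h1,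
      zero_mul, add_zero, Finset.sum_eq_single k]
    · simp
    · intro j _ hj; simp [hj.symm]
    · simp
  rw [hv]
  conv_lhs => rw [hsum]
  exact map_sum (tLine g).mkQ _ _

theorem nil_add {R : Type*} [CommRing R] (u v : Fin g ⊕ Fin g → R) :
    nil (u + v) = nil u + nil v + (vecMulVec u v + vecMulVec v u) * J (Fin g) R := by
  rw [nil, nil, nil, ← add_mul, ← add_mul]
  congr 1
  rw [add_vecMulVec, vecMulVec_add, vecMulVec_add]
  abel

theorem vecMulVec_sum_right {R ι : Type*} [CommRing R] (s : Finset ι) (u : Fin g ⊕ Fin g → R)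
    (f : ι → Fin g ⊕ Fin g → R) : vecMulVec u (∑ j ∈ s, f j) = ∑ j ∈ s, vecMulVec u (f j) := by
  ext r t
  simp [vecMulVec_apply, Matrix.sum_apply, Finset.mul_sum]

theorem vecMulVec_sum_left {R ι : Type*} [CommRing R] (s : Finset ι) (u : Fin g ⊕ Fin g → R)
    (f : ι → Fin g ⊕ Fin g → R) : vecMulVec (∑ j ∈ s, f j) u = ∑ j ∈ s, vecMulVec (f j) u := by
  ext r t
  simp [vecMulVec_apply, Matrix.sum_apply, Finset.sum_mul]

/-- A vector is a sum of pairs through a fixed letter, and each cross term of its square is itself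
obtained from pairs, because `pair a l + pair j l = pair a j`. Only the first 2g+1 letters are used,
which serves both values of i. -/
theorem nil_mem_of_pair {L : AddSubgroup (Mat g (ZMod 2))}
    (h : ∀ j k : Fin (2 * g + 2), (j : ℕ) < 2 * g + 1 → (k : ℕ) < 2 * g + 1 → j ≠ k →
      nil (b.repr (pair j k)) ∈ L) (u : Fin g ⊕ Fin g → ZMod 2) : nil u ∈ L := by
  classical
  let l : Fin (2 * g + 2) := ⟨2 * g, by omega⟩
  let m : Fin (2 * g + 2) := ⟨2 * g + 1, by omega⟩
  have hlt : ∀ j, j ≠ m → (j : ℕ) < 2 * g + 1 := by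
    intro j hj
    have : (j : ℕ) ≠ 2 * g + 1 := fun e => hj (Fin.ext e)
    omega
  have h' : ∀ j k, j ≠ m → k ≠ m → nil (b.repr (pair j k)) ∈ L := by
    intro j k hj hk
    by_cases e : j = k
    · subst e
      rw [pair_self, map_zero]
      have : nil (⇑(0 : Fin g ⊕ Fin g →₀ ZMod 2)) = 0 := by simp [nil]
      rw [this]; exact L.zero_mem
    · exact h j k (hlt j hj) (hlt k hk) e
  have hlm : l ≠ m := by simp [l, m]
  have key : ∀ s : Finset (Fin (2 * g + 2)), m ∉ s → nil (∑ j ∈ s, ⇑(b.repr (pair j l))) ∈ L := by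
    intro s
    induction s using Finset.induction_on with
    | empty =>
      intro _
      have : nil (0 : Fin g ⊕ Fin g → ZMod 2) = 0 := by simp [nil]
      rw [Finset.sum_empty, this]; exact L.zero_mem
    | insert a s ha ih =>
      intro hm
      rw [Finset.mem_insert, not_or] at hm
      rw [Finset.sum_insert ha, nil_add]
      refine L.add_mem (L.add_mem (h' _ _ (Ne.symm hm.1) hlm) (ih hm.2)) ?_
      rw [vecMulVec_sum_right, vecMulVec_sum_left, ← Finset.sum_add_distrib, Finset.sum_mul]
      refine sum_mem fun j hj => ?_
      have hjm : j ≠ m := fun e => hm.2 (e ▸ hj)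
      have h1 := nil_add (⇑(b.repr (pair a l))) (⇑(b.repr (pair j l)))
      have h2 : ⇑(b.repr (pair a l)) + ⇑(b.repr (pair j l)) = ⇑(b.repr (pair a j)) := by
        rw [← Finsupp.coe_add, ← map_add, pair_add]
      rw [h2] at h1
      rw [← sub_eq_iff_eq_add'.2 h1]
      exact L.sub_mem (h' _ _ (Ne.symm hm.1) hjm)
        (L.add_mem (h' _ _ (Ne.symm hm.1) hlm) (h' _ _ hjm hlm))
  obtain ⟨s, hs, hx⟩ := exists_sum_pair l (b.equivFun.symm u) m
  have := key s hs
  have hu : u = ∑ j ∈ s, ⇑(b.repr (pair j l)) := by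
    have h1 := congrArg b.equivFun hx
    rw [LinearEquiv.apply_symm_apply, map_sum] at h1
    exact h1
  rwa [← hu] at this

end PermMatrix

/-! ### The 2-adic commutator subgroup -/

section Dyadic

variable {g : ℕ} {b : Module.Basis (Fin g ⊕ Fin g) (ZMod 2) (W g)} {i : ℕ}

/-- The similitude scaling the second half of the coordinates. -/
def dscale (g : ℕ) {R : Type*} [CommRing R] (m : Rˣ) : GL2g g R where
  val := fromBlocks 1 0 0 ((m : R) • 1)
  inv := fromBlocks 1 0 0 (((m⁻¹ : Rˣ) : R) • 1)
  val_inv := by simp [fromBlocks_multiply, smul_smul]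
  inv_val := by simp [fromBlocks_multiply, smul_smul]

theorem dscale_similitude {R : Type*} [CommRing R] (m : Rˣ) : IsSimilitude (dscale g m) m := by
  unfold IsSimilitude dscale J
  simp [fromBlocks_multiply, fromBlocks_transpose, fromBlocks_smul]

theorem dscale_mulVec_ve {R : Type*} [CommRing R] (m : Rˣ) (j : Fin g) :
    (dscale g m).val *ᵥ ve R j = ve R j := by
  ext r
  rcases r with r | r <;> simp [dscale, Pi.single_apply, one_apply, Matrix.col]

/-- The lift `u` is taken in the symplectic orbit of a basis vector, so that some similitude of
multiplier -1, trivial modulo 2, fixes it. Its commutator with the transvection along `u` has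
parameter -2. -/
theorem exists_lift_tv (hg : 2 ≤ g) (hb : IsSymplecticBasis b) (hi : i = 1 ∨ i = 2)
    {j k : Fin (2 * g + 2)} (hj : (j : ℕ) < 2 * g + 1)
    (hk : (k : ℕ) < 2 * g + 1) (hjk : j ≠ k) :
    ∃ u : Fin g ⊕ Fin g → ℤ_[(two : ℕ)], PadicInt.toZMod ∘ u = b.repr (pair j k) ∧
      tv u 2 ∈ ⁅preGSp2 g (symGrp b i), preGSp2 g (symGrp b i)⁆ := by
  let a : Fin g := ⟨0, by omega⟩
  have hne : (b.repr (pair j k) : Fin g ⊕ Fin g → ZMod 2) ≠ 0 := by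
    intro h
    have : b.repr (pair j k) = 0 := DFunLike.coe_injective h
    exact pair_ne_zero hg hjk (by simpa using this)
  have ha : ve (ZMod 2) a ≠ 0 := by simp
  obtain ⟨s, hs, hsu⟩ := exists_Sp_mulVec ha hne
  obtain ⟨t, ht, rfl⟩ := Sp_le_map_red (p := two) hs
  set u := t.val *ᵥ ve ℤ_[(two : ℕ)] a with hu
  have hru : PadicInt.toZMod ∘ u = b.repr (pair j k) := by
    rw [← hsu, hu, ← map_mulVec_comp]
    congr 1
    ext r
    simp only [Function.comp, Pi.single_apply]
    split_ifs <;> simp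
  refine ⟨u, hru, ?_⟩
  let D : GL2g g ℤ_[(two : ℕ)] := t * dscale g (-1) * t⁻¹
  have hDsim : IsSimilitude D (-1) := by
    have := (IsSimilitude.mul (mem_Sp.1 ht) (dscale_similitude (g := g) (-1))).mul
      (IsSimilitude.inv (mem_Sp.1 ht))
    simpa using this
  have hDu : D.val *ᵥ u = u := by
    rw [hu]
    simp only [D, mul_val_mulVec, val_inv_mulVec, dscale_mulVec_ve]
  have hDred : red g two D = 1 := by
    have h1 : red g two (dscale g (-1)) = 1 := by
      refine Units.ext ?_
      rw [← rho_val]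
      ext r s
      rw [rho_apply]
      rcases r with r | r <;> rcases s with s | s <;>
        simp [dscale, one_apply, apply_ite PadicInt.toZMod]
    simp only [D, map_mul, h1, mul_one, map_inv, mul_inv_cancel]
  have hDmem : D ∈ preGSp2 g (symGrp b i) := by
    refine ⟨⟨-1, Subgroup.mem_top _, hDsim⟩, ?_⟩
    change red g two D ∈ symGrp b i
    rw [hDred]; exact one_mem _
  have htv : tv u 1 ∈ preGSp2 g (symGrp b i) := by
    refine ⟨⟨1, Subgroup.mem_top _, mem_Sp.1 (tv_mem _ _)⟩, ?_⟩
    change red g two (tv u 1) ∈ symGrp b i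
    rw [red, map_tv, hru, map_one]
    refine ⟨Equiv.swap j k, swap_mem_letters hi hj hk, ?_⟩
    rw [permMatrix_swap hb hjk]
  have hcomm : D * tv u 1 * D⁻¹ * (tv u 1)⁻¹ = (tv u 2)⁻¹ := by
    rw [conj_tv hDsim, hDu, tv_inv, tv_inv, ← tv_add]
    congr 1
    simp
    norm_num
  rw [← inv_mem_iff, ← hcomm]
  exact Subgroup.commutator_mem_commutator hDmem htv

/-- The preimage of the alternating group is contained in every closed group of symplectic
matrices containing the commutators of the preimage of the symmetric group. -/
theorem preSp2_altGrp_le (hg : 2 ≤ g) (hb : IsSymplecticBasis b) (hi : i = 1 ∨ i = 2)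
    {C : Subgroup (GL2g g ℤ_[(two : ℕ)])}
    (hclosed : IsClosed (C : Set (GL2g g ℤ_[(two : ℕ)]))) (hCS : C ≤ Sp g ℤ_[(two : ℕ)])
    (hC : ⁅preGSp2 g (symGrp b i), preGSp2 g (symGrp b i)⁆ ≤ C) :
    preSp2 g (altGrp b i) ≤ C := by
  have h1 : ∀ k hk u, nil u ∈ gr C k hk := by
    intro k hk
    refine nil_mem_of_pair (b := b) fun j l hj hl hjl => ?_
    obtain ⟨u, hu, hmem⟩ := exists_lift_tv hg hb hi hj hl hjl
    obtain ⟨n, rfl⟩ := Nat.exists_eq_succ_of_ne_zero hk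
    -- This power is exactly 1 + 2^(n+1) `nil u`, so it represents `nil u` in the layer k = n + 1.
    refine ⟨tv u 2 ^ 2 ^ n, C.pow_mem (hC hmem) _, nil u, ?_, ?_⟩
    · rw [tv_pow, tv_val]
      congr 2
      push_cast
      rw [pow_succ]
    · rw [rho_nil, hu]
  have h2 : symGrp b i ≤ (preGSp2 g (symGrp b i)).map (red g two) := by
    intro s hs
    obtain ⟨t, ht, rfl⟩ := Sp_le_map_red (p := two) (symGrp_le_Sp hb i hs)
    exact ⟨t, ⟨⟨1, Subgroup.mem_top _, mem_Sp.1 ht⟩, hs⟩, rfl⟩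
  have h3 : altGrp b i ≤ C.map (red g two) := by
    refine (Subgroup.map_mono (letters_le_commutator hg hi)).trans ?_
    rw [Subgroup.map_commutator]
    refine (Subgroup.commutator_mono h2 h2).trans ?_
    rw [← Subgroup.map_commutator]
    exact Subgroup.map_mono hC
  rintro y ⟨hy, hy2⟩
  obtain ⟨c, hc, hcy⟩ := h3 hy2
  have h4 : c⁻¹ * y ∈ C := by
    refine mem_of_Cg_one hclosed hCS h1 (mul_mem (inv_mem (hCS hc)) hy) ?_
    refine (Cg_one_iff_red (B := 1)).2 ?_
    rw [map_mul, map_inv, hcy, map_one]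
    exact inv_mul_cancel _
  exact (Subgroup.mul_mem_cancel_left C (C.inv_mem hc)).1 h4

end Dyadic

/-! ### Elementary abelian subgroups of symplectic groups in coprime characteristic -/

section Rank

variable {g : ℕ} {K : Type*} [Field K]

/-- X^q - 1 is separable, so each operator is diagonalizable, and commuting diagonalizable operators
are so simultaneously. -/
theorem span_common_eigenvectors [IsAlgClosed K] {V : Type*} [AddCommGroup V] [Module K V]
    [FiniteDimensional K V] {S : Type*} {q : ℕ} (hq : (q : K) ≠ 0) (f : S → Module.End K V)
    (hcomm : ∀ a b, Commute (f a) (f b)) (hexp : ∀ a, f a ^ q = 1) :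
    ⊤ ≤ Submodule.span K {v | ∃ χ : S → K, ∀ a, f a v = χ a • v} := by
  have hss : ∀ a, (f a).IsFinitelySemisimple := by
    intro a
    refine Module.End.IsSemisimple.isFinitelySemisimple ?_
    refine Module.End.isSemisimple_of_squarefree_aeval_eq_zero (p := Polynomial.X ^ q - 1) ?_ ?_
    · exact (Polynomial.X_pow_sub_one_separable_iff.2 hq).squarefree
    · simp [hexp]
  have h := Module.End.iSup_iInf_maxGenEigenspace_eq_top_of_iSup_maxGenEigenspace_eq_top_of_commute
    f (fun a b _ => hcomm a b) (fun a => Module.End.iSup_maxGenEigenspace_eq_top (f a))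
  rw [← h]
  refine iSup_le fun χ v hv => Submodule.subset_span ⟨χ, fun a => ?_⟩
  have := (Submodule.mem_iInf _).1 hv a
  rw [(hss a).maxGenEigenspace_eq_eigenspace] at this
  exact Module.End.mem_eigenspace_iff.1 this

/-- The Gram determinant is nonzero by nondegeneracy, hence so is some term of its Leibniz
expansion. -/
theorem exists_perm_gram_ne_zero {ι : Type*} [Fintype ι] [DecidableEq ι]
    (e : Module.Basis ι K (Fin g ⊕ Fin g → K)) :
    ∃ σ : Equiv.Perm ι, ∀ j, om (e (σ j)) (e j) ≠ 0 := by
  have hdet : (of fun j k => om (e j) (e k)).det ≠ 0 := by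
    intro h
    obtain ⟨v, hv0, hv⟩ := exists_mulVec_eq_zero_iff.2 h
    have hw : (∑ k, v k • e k) ≠ 0 := by
      intro h0
      exact hv0 (funext ((Fintype.linearIndependent_iff.1 e.linearIndependent) v h0))
    obtain ⟨y, hy⟩ := exists_om_eq_one hw
    have h1 : ∀ x, om x (∑ k, v k • e k) = 0 := by
      intro x
      have hsum : ∀ (s : Finset ι) (x : Fin g ⊕ Fin g → K) (c : ι → Fin g ⊕ Fin g → K),
          om x (∑ k ∈ s, c k) = ∑ k ∈ s, om x (c k) := by
        intro s x c
        simp only [om, mulVec_sum, dotProduct_sum]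
      have hbasis : ∀ j, om (e j) (∑ k, v k • e k) = 0 := by
        intro j
        rw [hsum]
        have := congrFun hv j
        simpa [mulVec, dotProduct, mul_comm] using this
      rw [om_swap, ← e.sum_repr x, hsum, neg_eq_zero]
      refine Finset.sum_eq_zero fun j _ => ?_
      rw [om_smul_right, om_swap, hbasis, neg_zero, mul_zero]
    rw [om_swap, h1] at hy
    simp at hy
  rw [det_apply] at hdet
  obtain ⟨σ, -, hσ⟩ := Finset.exists_ne_zero_of_sum_ne_zero hdet
  refine ⟨σ, fun j hj => hσ ?_⟩
  rw [Finset.prod_eq_zero (Finset.mem_univ j) (by simpa using hj), smul_zero]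

theorem two_mul_card_orbits_le {ι : Type*} [Fintype ι] (σ : Equiv.Perm ι) (h : ∀ j, σ j ≠ j) :
    2 * Nat.card (Quotient (Equiv.Perm.SameCycle.setoid σ)) ≤ Fintype.card ι := by
  let Q := Quotient (Equiv.Perm.SameCycle.setoid σ)
  let F : Q × Bool → ι := fun x => if x.2 then x.1.out else σ x.1.out
  have hF : ∀ x, Quotient.mk (Equiv.Perm.SameCycle.setoid σ) (F x) = x.1 := by
    rintro ⟨x, b⟩
    cases b
    · conv_rhs => rw [← Quotient.out_eq x]
      refine Quotient.sound (s := Equiv.Perm.SameCycle.setoid σ) ?_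
      exact (Equiv.Perm.sameCycle_apply_left.2 (Equiv.Perm.SameCycle.refl σ _))
    · exact Quotient.out_eq x
  have hinj : Function.Injective F := by
    rintro ⟨x, b⟩ ⟨y, c⟩ hxy
    have h1 : x = y := by
      have := hF ⟨x, b⟩
      rw [hxy, hF] at this
      exact this.symm
    subst h1
    cases b <;> cases c
    · rfl
    · exact absurd hxy (h _)
    · exact absurd hxy.symm (h _)
    · rfl
  have := Nat.card_le_card_of_injective F hinj
  rw [Nat.card_prod, Nat.card_eq_fintype_card (α := Bool), Fintype.card_bool,
    Nat.card_eq_fintype_card (α := ι)] at this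
  change 2 * Nat.card Q ≤ _
  omega

/-- In a basis of common eigenvectors with characters χ_j, the permutation σ pairs non-orthogonal
vectors, whence χ_{σ j} χ_j = 1. One character on each cycle determines the others. Since σ has no
fixed point, there are at most g cycles, and each character takes values in the q-th roots of unity.
-/
theorem card_le_pow_of_isAlgClosed [IsAlgClosed K] {S : Type*} [Group S] {q : ℕ} (hq0 : q ≠ 0)
    (hq : (q : K) ≠ 0) (hcomm : ∀ a b : S, a * b = b * a) (hexp : ∀ a : S, a ^ q = 1)
    (ρ : S →* GL2g g K) (hinj : Function.Injective ρ) (hSp : ∀ a, ρ a ∈ Sp g K) :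
    Nat.card S ≤ q ^ g := by
  classical
  let f : S → Module.End K (Fin g ⊕ Fin g → K) := fun a => toLin' (ρ a).val
  have hf : ∀ a v, f a v = (ρ a).val *ᵥ v := fun a v => toLin'_apply _ _
  have hfpow : ∀ a n v, (f a ^ n) v = (ρ (a ^ n)).val *ᵥ v := by
    intro a n
    induction n with
    | zero => intro v; simp
    | succ n ih =>
      intro v
      rw [pow_succ, Module.End.mul_apply, hf, ih, pow_succ, map_mul, mul_val_mulVec]
  have hspan := span_common_eigenvectors hq f
    (fun a b => LinearMap.ext fun v => by
      change f a (f b v) = f b (f a v)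
      rw [hf, hf, hf, hf, ← mul_val_mulVec, ← mul_val_mulVec, ← map_mul, ← map_mul, hcomm])
    (fun a => LinearMap.ext fun v => by
      rw [hfpow, hexp, map_one, Units.val_one, one_mulVec]
      rfl)
  let e := Module.Basis.ofSpan hspan
  have hfin := FiniteDimensional.fintypeBasisIndex e
  have he : ∀ j, ∃ χ : S → K, ∀ a, f a (e j) = χ a • e j := fun j =>
    Module.Basis.ofSpan_subset hspan ⟨j, rfl⟩
  choose χ hχ using he
  obtain ⟨σ, hσ⟩ := exists_perm_gram_ne_zero e
  have hfix : ∀ j, σ j ≠ j := fun j h => hσ j (by rw [h, om_self])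
  have hmul : ∀ j a, χ (σ j) a * χ j a = 1 := by
    intro j a
    have h1 := om_mulVec (hSp a) (e (σ j)) (e j)
    rw [← hf, ← hf, hχ, hχ, om_smul_left, om_smul_right, ← mul_assoc] at h1
    exact mul_right_cancel₀ (hσ j) (h1.trans (one_mul _).symm)
  have hpow : ∀ j a, χ j a ^ q = 1 := by
    intro j a
    have h1 : ∀ n, ((ρ (a ^ n)).val *ᵥ e j) = χ j a ^ n • e j := by
      intro n
      induction n with
      | zero => simp
      | succ n ih =>
        rw [pow_succ, map_mul, mul_val_mulVec, ← hf a, hχ, mulVec_smul, ih, smul_smul, pow_succ,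
          mul_comm]
    have h2 := h1 q
    rw [hexp, map_one, Units.val_one, one_mulVec] at h2
    have h3 : (χ j a ^ q - 1) • e j = 0 := by rw [sub_smul, one_smul, ← h2, sub_self]
    exact sub_eq_zero.1 ((smul_eq_zero.1 h3).resolve_right (e.ne_zero j))
  have hcyc : ∀ a a' j k, σ.SameCycle j k → (χ j a = χ j a' ↔ χ k a = χ k a') := by
    intro a a'
    have hstep : ∀ j, χ j a = χ j a' ↔ χ (σ j) a = χ (σ j) a' := by
      intro j
      rw [eq_inv_of_mul_eq_one_left (hmul j a), eq_inv_of_mul_eq_one_left (hmul j a'), _root_.inv_inj]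
    rintro j k ⟨n, rfl⟩
    induction n with
    | zero => simp
    | succ n ih => rw [ih, hstep, ← Equiv.Perm.mul_apply, ← _root_.zpow_one_add, add_comm 1]
    | pred n ih =>
      rw [ih, hstep ((σ ^ (-(n : ℤ) - 1)) j), ← Equiv.Perm.mul_apply, ← _root_.zpow_one_add]
      rw [show (1 + (-(n : ℤ) - 1)) = -(n : ℤ) by ring]
  let Q := Quotient (Equiv.Perm.SameCycle.setoid σ)
  have hQ : Nat.card Q ≤ g := by
    have h1 := two_mul_card_orbits_le σ hfix
    have h2 : Fintype.card _ = Module.finrank K (Fin g ⊕ Fin g → K) :=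
      (Module.finrank_eq_card_basis e).symm
    rw [h2, Module.finrank_fintype_fun_eq_card, Fintype.card_sum, Fintype.card_fin] at h1
    change Nat.card Q ≤ g
    change 2 * Nat.card Q ≤ _ at h1
    omega
  have : NeZero q := ⟨hq0⟩
  let Φ : S → Q → rootsOfUnity q K := fun a o => rootsOfUnity.mkOfPowEq (χ o.out a) (hpow _ a)
  have hΦ : Function.Injective Φ := by
    intro a a' h
    refine hinj (Units.ext (toLin'.injective (e.ext fun j => ?_)))
    change f a (e j) = f a' (e j)
    rw [hχ, hχ]
    congr 1
    have h1 := congrArg (fun x : rootsOfUnity q K => ((x : Kˣ) : K))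
      (congrFun h (Quotient.mk (Equiv.Perm.SameCycle.setoid σ) j))
    simp only [Φ, rootsOfUnity.coe_mkOfPowEq] at h1
    refine (hcyc a a' _ _ ?_).1 h1
    exact Quotient.exact (Quotient.out_eq (Quotient.mk (Equiv.Perm.SameCycle.setoid σ) j))
  calc Nat.card S ≤ Nat.card (Q → rootsOfUnity q K) := Nat.card_le_card_of_injective Φ hΦ
    _ = Nat.card (rootsOfUnity q K) ^ Nat.card Q := Nat.card_fun
    _ ≤ q ^ Nat.card Q := Nat.pow_le_pow_left (card_rootsOfUnity K q) _
    _ ≤ q ^ g := Nat.pow_le_pow_right (Nat.pos_of_ne_zero hq0) hQ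

/-- An elementary abelian `q`-group of symplectic matrices of size `2g` over a field of
characteristic different from `q` has order at most `q ^ g`. -/
theorem card_le_pow {S : Type*} [Group S] {q : ℕ} (hq0 : q ≠ 0)
    (hq : (q : K) ≠ 0) (hcomm : ∀ a b : S, a * b = b * a) (hexp : ∀ a : S, a ^ q = 1)
    (ρ : S →* GL2g g K) (hinj : Function.Injective ρ) (hSp : ∀ a, ρ a ∈ Sp g K) :
    Nat.card S ≤ q ^ g := by
  let φ := algebraMap K (AlgebraicClosure K)
  refine card_le_pow_of_isAlgClosed (K := AlgebraicClosure K) hq0 ?_ hcomm hexp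
    ((GeneralLinearGroup.map φ).comp ρ) ?_ fun a => map_mem_Sp _ (hSp a)
  · rw [← map_natCast φ]
    exact (map_ne_zero φ).2 hq
  · intro a a' h
    refine hinj (Units.ext (Matrix.map_injective φ.injective ?_))
    exact congrArg Units.val h

end Rank

/-! ### A large elementary abelian subgroup -/

section Siegel

variable {g q : ℕ}

/-- A family of symmetric matrices of dimension `g + 1`. -/
def symBlock {R : Type*} [CommRing R] (a b : Fin g) (c : Option (Fin g) → R) :
    Matrix (Fin g) (Fin g) R :=
  diagonal (fun j => c (some j)) + c none • (single a b 1 + single b a 1)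

theorem symBlock_add {R : Type*} [CommRing R] (a b : Fin g) (c d : Option (Fin g) → R) :
    symBlock a b (c + d) = symBlock a b c + symBlock a b d := by
  simp only [symBlock, Pi.add_apply, add_smul, ← diagonal_add]
  abel

theorem symBlock_transpose {R : Type*} [CommRing R] (a b : Fin g) (c : Option (Fin g) → R) :
    (symBlock a b c)ᵀ = symBlock a b c := by
  simp only [symBlock, transpose_add, diagonal_transpose, transpose_smul, transpose_single]
  rw [add_comm (single b a _)]

/-- The unipotent matrices with upper right block in the family `symBlock`. -/
def unip {R : Type*} [CommRing R] (a b : Fin g) :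
    Multiplicative (Option (Fin g) → R) →* GL2g g R where
  toFun c :=
    { val := fromBlocks 1 (symBlock a b c.toAdd) 0 1
      inv := fromBlocks 1 (symBlock a b (-c.toAdd)) 0 1
      val_inv := by
        rw [fromBlocks_multiply]
        simp [← symBlock_add]
        simp [symBlock]
      inv_val := by
        rw [fromBlocks_multiply]
        simp [← symBlock_add]
        simp [symBlock] }
  map_one' := by
    refine Units.ext ?_
    simp [symBlock]
  map_mul' c d := by
    refine Units.ext ?_
    simp [fromBlocks_multiply, symBlock_add, add_comm]

theorem unip_mem_Sp {R : Type*} [CommRing R] (a b : Fin g)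
    (c : Multiplicative (Option (Fin g) → R)) : unip a b c ∈ Sp g R := by
  rw [mem_Sp]
  unfold IsSimilitude J
  change (fromBlocks 1 (symBlock a b c.toAdd) 0 1)ᵀ * _ * fromBlocks 1 (symBlock a b c.toAdd) 0 1 = _
  simp [fromBlocks_multiply, fromBlocks_transpose, symBlock_transpose]

theorem unip_injective {R : Type*} [CommRing R] {a b : Fin g} (hab : a ≠ b) :
    Function.Injective (unip (R := R) a b) := by
  intro c d h
  have h1 : fromBlocks 1 (symBlock a b c.toAdd) 0 1 = fromBlocks 1 (symBlock a b d.toAdd) 0 1 :=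
    congrArg Units.val h
  have h2 := (fromBlocks_inj.1 h1).2.1
  refine Multiplicative.toAdd.injective (funext fun j => ?_)
  cases j with
  | none =>
    have := congrFun (congrFun h2 a) b
    simpa [symBlock, hab, hab.symm] using this
  | some j =>
    have := congrFun (congrFun h2 j) j
    have h3 : ∀ e : Option (Fin g) → R, symBlock a b e j j = e (some j) := by
      intro e
      have h4 : ∀ x : R, single a b x j j = 0 := fun x =>
        single_apply_of_ne _ _ _ _ _ fun h => hab (h.1.trans h.2.symm)
      have h5 : ∀ x : R, single b a x j j = 0 := fun x =>
        single_apply_of_ne _ _ _ _ _ fun h => hab (h.2.trans h.1.symm)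
      simp [symBlock, h4, h5]
    rwa [h3, h3] at this

/-- The symplectic group over a prime field contains an elementary abelian subgroup of rank
`g + 1`. -/
theorem exists_elementary_abelian (hg : 2 ≤ g) [Fact q.Prime] :
    ∃ E : Subgroup (GL2g g (ZMod q)), E ≤ Sp g (ZMod q) ∧ Nat.card E = q ^ (g + 1) ∧
      (∀ x ∈ E, ∀ y ∈ E, x * y = y * x) ∧ ∀ x ∈ E, x ^ q = 1 := by
  let a : Fin g := ⟨0, by omega⟩
  let b : Fin g := ⟨1, by omega⟩
  have hab : a ≠ b := by simp [a, b, Fin.ext_iff]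
  refine ⟨(unip (R := ZMod q) a b).range, ?_, ?_, ?_, ?_⟩
  · rintro _ ⟨c, rfl⟩
    exact unip_mem_Sp a b c
  · rw [← Nat.card_congr (MonoidHom.ofInjective (unip_injective hab)).toEquiv,
      Nat.card_congr Multiplicative.toAdd, Nat.card_fun]
    simp
  · rintro _ ⟨c, rfl⟩ _ ⟨d, rfl⟩
    rw [← map_mul, ← map_mul, mul_comm]
  · rintro _ ⟨c, rfl⟩
    rw [← map_pow]
    have : c ^ q = 1 := by
      refine Multiplicative.toAdd.injective (funext fun j => ?_)
      rw [toAdd_pow, Pi.smul_apply, nsmul_eq_mul]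
      simp
    rw [this, map_one]

end Siegel

/-! ### Independence of the reductions at different primes -/

section Pair

/-- Take a Sylow q-subgroup of the preimage of `E` in the joint image: its image in the q-group `E`
is again Sylow, hence all of `E`. -/
theorem exists_pGroup_lift {G X Y : Type*} [Group G] [Group X] [Group Y] [Finite X] [Finite Y]
    (α : G →* X) (β : G →* Y) (q : ℕ) [Fact q.Prime] {E : Subgroup Y} (hE : IsPGroup q E)
    (hEβ : E ≤ β.range) :
    ∃ S : Subgroup (X × Y), S ≤ (α.prod β).range ∧ IsPGroup q S ∧ S.map (MonoidHom.snd X Y) = E := by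
  let F : Subgroup (X × Y) := (α.prod β).range ⊓ E.comap (MonoidHom.snd X Y)
  let f : F →* E := ((MonoidHom.snd X Y).comp F.subtype).codRestrict E fun x => x.2.2
  have hf : Function.Surjective f := by
    rintro ⟨y, hy⟩
    obtain ⟨x, rfl⟩ := hEβ hy
    exact ⟨⟨(α x, β x), ⟨x, rfl⟩, hy⟩, rfl⟩
  obtain ⟨P⟩ : Nonempty (Sylow q F) := inferInstance
  refine ⟨P.1.map F.subtype, ?_, P.2.map _, ?_⟩
  · rintro _ ⟨x, -, rfl⟩
    exact x.2.1
  · have h1 : ((P.mapSurjective hf : Sylow q E) : Subgroup E) = ⊤ :=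
      (P.mapSurjective hf).is_maximal' (Q := ⊤) (hE.to_subgroup ⊤) le_top |>.symm
    have h2 : P.1.map f = ⊤ := h1
    have h3 := congrArg (Subgroup.map E.subtype) h2
    rw [Subgroup.map_map, ← MonoidHom.range_eq_map, Subgroup.range_subtype] at h3
    rw [Subgroup.map_map, ← h3]
    rfl

variable {g q : ℕ} [Fact q.Prime]

theorem eq_one_of_sq_of_isPGroup {Z : Type*} [Group Z] (hq : q ≠ 2) {S : Subgroup Z}
    (hS : IsPGroup q S) {s : Z} (hs : s ∈ S) (h : s ^ 2 = 1) : s = 1 := by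
  obtain ⟨k, hk⟩ := hS ⟨s, hs⟩
  have hk' : s ^ q ^ k = 1 := congrArg Subtype.val hk
  have hc : Nat.Coprime 2 (q ^ k) :=
    Nat.Coprime.pow_right _ ((Nat.coprime_primes Nat.prime_two Fact.out).2 (Ne.symm hq))
  have := pow_gcd_eq_one.2 ⟨h, hk'⟩
  rwa [hc, pow_one] at this

/-- If the kernel of `α` does not map onto the symplectic group modulo `q`, then a large `q`-group
embeds into the image of `α`. -/
theorem Sp_le_or_exists_pGroup (hg : 2 ≤ g) (hq : q ≠ 2) {G X : Type*} [Group G] [Group X]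
    [Finite X] (α : G →* X) (β : G →* GL2g g (ZMod q)) (hβ : β.range = Sp g (ZMod q)) :
    Sp g (ZMod q) ≤ α.ker.map β ∨
      ∃ S : Subgroup (X × GL2g g (ZMod q)), S ≤ (α.prod β).range ∧ IsPGroup q S ∧
        Set.InjOn Prod.fst (S : Set (X × GL2g g (ZMod q))) ∧
        q ^ (g + 1) ∣ Nat.card S ∧ (Set.InjOn Prod.snd (S : Set (X × GL2g g (ZMod q))) →
          Nat.card S = q ^ (g + 1) ∧ (∀ x ∈ S, ∀ y ∈ S, x * y = y * x) ∧ ∀ x ∈ S, x ^ q = 1) := by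
  have hnorm : ∀ s ∈ Sp g (ZMod q), ∀ a ∈ α.ker.map β, s * a * s⁻¹ ∈ α.ker.map β := by
    rintro s hs _ ⟨x, hx, rfl⟩
    rw [← hβ] at hs
    obtain ⟨y, rfl⟩ := hs
    refine ⟨y * x * y⁻¹, ?_, by simp⟩
    exact (MonoidHom.normal_ker α).conj_mem x hx y
  rcases normal_dichotomy hg hq hnorm with h | h
  · exact .inl h
  right
  obtain ⟨E, hE1, hE2, hE3, hE4⟩ := exists_elementary_abelian (q := q) hg
  obtain ⟨S, hS1, hS2, hS3⟩ := exists_pGroup_lift α β q (E := E)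
    (fun x => ⟨1, Subtype.ext (by rw [pow_one]; exact hE4 x.1 x.2)⟩) (by rwa [hβ])
  refine ⟨S, hS1, hS2, ?_, ?_, ?_⟩
  -- An element of `S` with trivial first coordinate has square 1 by the dichotomy, and a q-group
  -- with q odd has no such element but 1.
  · have key : ∀ s ∈ S, s.1 = 1 → s = 1 := by
      intro s hs h1
      obtain ⟨x, rfl⟩ := hS1 hs
      have hx : x ∈ α.ker := h1
      refine eq_one_of_sq_of_isPGroup hq hS2 hs ?_
      refine Prod.ext ?_ ?_
      · change α x ^ 2 = 1
        rw [show α x = 1 from h1, one_pow]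
      · exact h _ ⟨x, hx, rfl⟩ (hβ ▸ ⟨x, rfl⟩)
    intro s hs t ht hst
    have := key (s * t⁻¹) (S.mul_mem hs (S.inv_mem ht)) (by
      change s.1 * t.1⁻¹ = 1
      rw [hst, mul_inv_cancel])
    exact mul_inv_eq_one.1 this
  · rw [← hE2, ← hS3]
    exact Subgroup.card_map_dvd _ _
  · intro hinj
    have hmem : ∀ x ∈ S, x.2 ∈ E := fun x hx => hS3 ▸ ⟨x, hx, rfl⟩
    refine ⟨?_, ?_, ?_⟩
    · rw [← hE2, ← hS3]
      exact (Nat.card_congr (Equiv.Set.imageOfInjOn Prod.snd (S : Set (X × GL2g g (ZMod q))) hinj))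
    · intro x hx y hy
      exact hinj (S.mul_mem hx hy) (S.mul_mem hy hx) (hE3 _ (hmem x hx) _ (hmem y hy))
    · intro x hx
      exact hinj (S.pow_mem hx q) S.one_mem (hE4 _ (hmem x hx))

/-- The embedded q-group would have order dividing that of the image of `α`. This settles the prime
2, where the image consists of permutations. -/
theorem Sp_le_of_not_dvd (hg : 2 ≤ g) (hq : q ≠ 2) {G X : Type*} [Group G] [Group X]
    [Finite X] (α : G →* X) (β : G →* GL2g g (ZMod q)) (hβ : β.range = Sp g (ZMod q))
    (hX : ¬ q ^ (g + 1) ∣ Nat.card α.range) : Sp g (ZMod q) ≤ α.ker.map β := by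
  rcases Sp_le_or_exists_pGroup hg hq α β hβ with h | ⟨S, hS1, -, hS3, hS4, -⟩
  · exact h
  refine absurd (hS4.trans ?_) hX
  have h1 : Nat.card S = Nat.card (S.map (MonoidHom.fst X _)) :=
    Nat.card_congr (Equiv.Set.imageOfInjOn Prod.fst (S : Set (X × GL2g g (ZMod q))) hS3)
  rw [h1]
  refine Subgroup.card_dvd_of_le ?_
  rintro _ ⟨s, hs, rfl⟩
  obtain ⟨x, rfl⟩ := hS1 hs
  exact ⟨x, rfl⟩

/-- If the kernel of `β` has full image under `α`, an element can be corrected to lie in the kernel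
of `α`. Otherwise both kernels have images of exponent two, so the q-group embeds through both
projections: it is elementary abelian of rank g+1 and sits in Sp modulo p, against the bound g. -/
theorem Sp_le_of_ne (hg : 2 ≤ g) (hq : q ≠ 2) {p : ℕ} [Fact p.Prime] (hp : p ≠ 2) (hpq : p ≠ q)
    {G : Type*} [Group G] (α : G →* GL2g g (ZMod p)) (hα : α.range = Sp g (ZMod p))
    (β : G →* GL2g g (ZMod q)) (hβ : β.range = Sp g (ZMod q)) :
    Sp g (ZMod q) ≤ α.ker.map β := by
  rcases Sp_le_or_exists_pGroup hg hq α β hβ with h | ⟨S, hS1, hS2, hS3, -, hS5⟩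
  · exact h
  have hnorm : ∀ s ∈ Sp g (ZMod p), ∀ a ∈ β.ker.map α, s * a * s⁻¹ ∈ β.ker.map α := by
    rintro s hs _ ⟨x, hx, rfl⟩
    rw [← hα] at hs
    obtain ⟨y, rfl⟩ := hs
    refine ⟨y * x * y⁻¹, ?_, by simp⟩
    exact (MonoidHom.normal_ker β).conj_mem x hx y
  rcases normal_dichotomy hg hp hnorm with h | h
  · intro y hy
    rw [← hβ] at hy
    obtain ⟨x, rfl⟩ := hy
    obtain ⟨k, hk, hkx⟩ := h (hα ▸ ⟨x, rfl⟩ : α x ∈ Sp g (ZMod p))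
    have hk' : β k = 1 := hk
    refine ⟨x * k⁻¹, ?_, by simp [hk']⟩
    change α (x * k⁻¹) = 1
    rw [map_mul, map_inv, hkx, mul_inv_cancel]
  exfalso
  have hinj : Set.InjOn Prod.snd (S : Set (GL2g g (ZMod p) × GL2g g (ZMod q))) := by
    have key : ∀ s ∈ S, s.2 = 1 → s = 1 := by
      intro s hs h1
      obtain ⟨x, rfl⟩ := hS1 hs
      have hx : x ∈ β.ker := h1
      refine eq_one_of_sq_of_isPGroup hq hS2 hs ?_
      refine Prod.ext ?_ ?_
      · exact h _ ⟨x, hx, rfl⟩ (hα ▸ ⟨x, rfl⟩)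
      · change β x ^ 2 = 1
        rw [show β x = 1 from h1, one_pow]
    intro s hs t ht hst
    have := key (s * t⁻¹) (S.mul_mem hs (S.inv_mem ht)) (by
      change s.2 * t.2⁻¹ = 1
      rw [hst, mul_inv_cancel])
    exact mul_inv_eq_one.1 this
  obtain ⟨h1, h2, h3⟩ := hS5 hinj
  have hqp : (q : ZMod p) ≠ 0 := by
    rw [Ne, ZMod.natCast_eq_zero_iff, Nat.prime_dvd_prime_iff_eq Fact.out Fact.out]
    exact hpq
  have h4 := card_le_pow (K := ZMod p) (g := g) (S := S) (q := q)
    (Nat.Prime.ne_zero Fact.out) hqp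
    (fun a b => Subtype.ext (h2 a.1 a.2 b.1 b.2)) (fun a => Subtype.ext (h3 a.1 a.2))
    ((MonoidHom.fst _ _).comp S.subtype)
    (fun a b hab => Subtype.ext (hS3 a.2 b.2 hab))
    (fun a => by
      obtain ⟨x, hx⟩ := hS1 a.2
      change a.1.1 ∈ _
      rw [← hx, ← hα]
      exact ⟨x, rfl⟩)
  rw [h1] at h4
  exact absurd h4 (not_le.2 (Nat.pow_lt_pow_right (Nat.Prime.one_lt Fact.out) g.lt_succ_self))

/-- Legendre's formula gives (q-1) v_q((2g+2)!) < 2g+2, and q - 1 ≥ 2. -/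
theorem not_dvd_card_perm (hq : q ≠ 2) :
    ¬ q ^ (g + 1) ∣ Nat.card (Equiv.Perm (Fin (2 * g + 2))) := by
  rw [Nat.card_perm, Nat.card_eq_fintype_card, Fintype.card_fin]
  intro h
  have h1 : g + 1 ≤ padicValNat q (2 * g + 2).factorial :=
    (padicValNat_dvd_iff_le (Nat.factorial_ne_zero _)).1 h
  have h2 := sub_one_mul_padicValNat_factorial_lt_of_ne_zero (p := q) (n := 2 * g + 2) (by omega)
  have h3 : 2 ≤ q - 1 := by
    have := (Fact.out : q.Prime).two_le
    omega
  have h4 := Nat.mul_le_mul h3 h1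
  omega

end Pair

/-! ### Topology and components of matrices over the profinite integers -/

section Components

variable {g : ℕ}

theorem continuous_GL_map {R S : Type*} [CommRing R] [CommRing S] [TopologicalSpace R]
    [TopologicalSpace S] {f : R →+* S} (hf : Continuous f) :
    Continuous (GeneralLinearGroup.map (n := Fin g ⊕ Fin g) f) :=
  Continuous.units_map (M := Mat g R) (N := Mat g S) (f.mapMatrix : Mat g R →+* Mat g S).toMonoidHom
    (continuous_id.matrix_map hf)

theorem continuous_adic (p : Nat.Primes) : Continuous (adic g p) :=
  continuous_GL_map (continuous_apply p)

instance t2Space_GL2g {R : Type*} [CommRing R] [TopologicalSpace R] [IsTopologicalRing R]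
    [T2Space R] : T2Space (GL2g g R) :=
  have : T2Space (Mat g R) := inferInstanceAs (T2Space (Fin g ⊕ Fin g → Fin g ⊕ Fin g → R))
  T2Space.of_injective_continuous Units.val_injective (Units.continuous_val (M := Mat g R))

theorem eq_of_adic_eq {x y : GL2g g ZHat} (h : ∀ p, adic g p x = adic g p y) : x = y := by
  refine Units.ext ?_
  ext i j p
  exact congrArg (fun A : GL2g g ℤ_[(p : ℕ)] => A.val i j) (h p)

/-- Compactness: conditions on all components follow from those on finitely many. -/
theorem exists_mem_forall_adic_eq {C : Set (GL2g g ZHat)} (hC : IsClosed C) {ι : Type*}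
    (f : ι → Nat.Primes) (v : GL2g g ZHat)
    (h : ∀ P : Finset ι, ∃ n ∈ C, ∀ p ∈ P, adic g (f p) n = adic g (f p) v) :
    ∃ n ∈ C, ∀ p, adic g (f p) n = adic g (f p) v := by
  obtain ⟨n, hn, hn'⟩ := hC.isCompact.inter_iInter_nonempty
    (fun p : ι => {m : GL2g g ZHat | adic g (f p) m = adic g (f p) v})
    (fun p => isClosed_singleton.preimage (continuous_adic (f p)))
    (fun P => by
      obtain ⟨n, hn, hnP⟩ := h P
      exact ⟨n, hn, Set.mem_iInter₂.2 hnP⟩)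
  exact ⟨n, hn, Set.mem_iInter.1 hn'⟩

theorem isSimilitude_ZHat {x : GL2g g ZHat} {m : ZHatˣ} : IsSimilitude x m ↔
    ∀ p : Nat.Primes, IsSimilitude (adic g p x)
      (Units.map (Pi.evalRingHom (fun q : Nat.Primes => ℤ_[(q : ℕ)]) p).toMonoidHom m) := by
  refine ⟨fun h p => map_similitude _ h, fun h => ?_⟩
  unfold IsSimilitude
  have hp : ∀ p : Nat.Primes, ((x.val)ᵀ * J (Fin g) ZHat * x.val).map
      (Pi.evalRingHom (fun q : Nat.Primes => ℤ_[(q : ℕ)]) p) =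
      ((m : ZHat) • J (Fin g) ZHat).map
      (Pi.evalRingHom (fun q : Nat.Primes => ℤ_[(q : ℕ)]) p) := by
    intro p
    have h1 := h p
    unfold IsSimilitude at h1
    rw [Matrix.map_mul, Matrix.map_mul, map_J, Matrix.map_smul' _ _ _ (by intros; simp), map_J]
    exact h1
  ext i j p
  exact congrFun (congrFun (hp p) i) j

theorem mem_Sp_ZHat {x : GL2g g ZHat} :
    x ∈ Sp g ZHat ↔ ∀ p : Nat.Primes, adic g p x ∈ Sp g ℤ_[(p : ℕ)] := by
  simp only [mem_Sp, isSimilitude_ZHat, map_one]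

theorem isClosed_similitude {R : Type*} [CommRing R] [TopologicalSpace R] [IsTopologicalRing R]
    [T2Space R] (m : Rˣ) : IsClosed {S : GL2g g R | IsSimilitude S m} := by
  have : T2Space (Mat g R) := inferInstanceAs (T2Space (Fin g ⊕ Fin g → Fin g ⊕ Fin g → R))
  have hc : Continuous fun S : GL2g g R => (S.val : Mat g R) := Units.continuous_val (M := Mat g R)
  exact isClosed_eq (((hc.matrix_transpose).matrix_mul continuous_const).matrix_mul hc)
    continuous_const

theorem isClosed_Sp {R : Type*} [CommRing R] [TopologicalSpace R] [IsTopologicalRing R]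
    [T2Space R] : IsClosed (Sp g R : Set (GL2g g R)) := by
  convert isClosed_similitude (g := g) (1 : Rˣ) using 1
  ext S
  exact mem_Sp

theorem commutator_GSp_le_Sp {R : Type*} [CommRing R] : ⁅GSp g R, GSp g R⁆ ≤ Sp g R := by
  rw [Subgroup.commutator_le]
  rintro x ⟨m, -, hx⟩ y ⟨n, -, hy⟩
  rw [mem_Sp]
  have := ((hx.mul hy).mul hx.inv).mul hy.inv
  have e : m * n * m⁻¹ * n⁻¹ = 1 := by
    rw [mul_comm m n]; simp
  rwa [e] at this

theorem isClosed_red_eq (p : Nat.Primes) (y : GL2g g (ZMod (p : ℕ))) :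
    IsClosed {x : GL2g g ℤ_[(p : ℕ)] | red g p x = y} := by
  obtain ⟨Y, hY⟩ := rho_surjective y.val
  convert isClosed_Cg 1 Y using 1
  ext x
  rw [Set.mem_ofPred_eq, Set.mem_ofPred_eq, Cg_one_iff, hY, rho_val, Units.ext_iff]

theorem isClosed_red_mem (p : Nat.Primes) (A : Set (GL2g g (ZMod (p : ℕ)))) :
    IsClosed {x : GL2g g ℤ_[(p : ℕ)] | red g p x ∈ A} := by
  have : {x : GL2g g ℤ_[(p : ℕ)] | red g p x ∈ A} = ⋃ y ∈ A, {x | red g p x = y} := by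
    ext x
    simp
  rw [this]
  exact (Set.toFinite A).isClosed_biUnion fun y _ => isClosed_red_eq p y

theorem one_add_pow_quadratic {A : Type*} [Ring A] (m : A) (n : ℕ) :
    ∃ z, (1 + m) ^ n = 1 + n • m + m * m * z := by
  obtain ⟨z, hz⟩ := one_add_pow_cubic m n
  refine ⟨n.choose 2 • 1 + m * z, ?_⟩
  rw [hz, mul_add, mul_smul_comm, mul_one, ← mul_assoc]
  abel

theorem Cg_pow_p {p : Nat.Primes} {k : ℕ} (hk : k ≠ 0) {x : Mat g ℤ_[(p : ℕ)]} (h : Cg k x 1) :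
    Cg (k + 1) (x ^ (p : ℕ)) 1 := by
  obtain ⟨Y, rfl⟩ := h
  obtain ⟨z, hz⟩ := one_add_pow_quadratic (((p : ℕ) : ℤ_[(p : ℕ)]) ^ k • Y) (p : ℕ)
  obtain ⟨l, rfl⟩ := Nat.exists_eq_succ_of_ne_zero hk
  refine ⟨Y + ((p : ℕ) : ℤ_[(p : ℕ)]) ^ l • (Y * Y * z), ?_⟩
  rw [hz, ← Nat.cast_smul_eq_nsmul ℤ_[(p : ℕ)], smul_smul, smul_mul_smul_comm, smul_mul_assoc,
    smul_add, smul_smul, add_assoc, Nat.succ_eq_add_one]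
  congr 3 <;> ring

theorem Cg_pow_p_pow {p : Nat.Primes} {x : Mat g ℤ_[(p : ℕ)]} (h : Cg 1 x 1) (k : ℕ) :
    Cg (k + 1) (x ^ (p : ℕ) ^ k) 1 := by
  induction k with
  | zero => simpa using h
  | succ k ih =>
    rw [pow_succ, pow_mul]
    exact Cg_pow_p k.succ_ne_zero ih

end Components

/-! ### Closed groups with large reductions -/

section Assembly

variable {g : ℕ} {N : Subgroup (GL2g g ZHat)}

/-- The reduction modulo `p` of matrices over the profinite integers. -/
noncomputable abbrev redHat (g : ℕ) (p : Nat.Primes) : GL2g g ZHat →* GL2g g (ZMod (p : ℕ)) :=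
  (red g p).comp (adic g p)

theorem isClosed_redHat_eq (p : Nat.Primes) (y : GL2g g (ZMod (p : ℕ))) :
    IsClosed {x : GL2g g ZHat | redHat g p x = y} :=
  (isClosed_red_eq p y).preimage (continuous_adic p)

theorem range_redHat_comp_subtype (p : Nat.Primes) :
    ((redHat g p).comp N.subtype).range = N.map (redHat g p) := by
  rw [MonoidHom.range_comp, Subgroup.range_subtype]

theorem Sp_le_map_ker (hg : 2 ≤ g) {b : Module.Basis (Fin g ⊕ Fin g) (ZMod 2) (W g)} {i : ℕ}
    (h2 : N.map (redHat g two) ≤ symGrp b i)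
    (hodd : ∀ p : Nat.Primes, p ≠ two → N.map (redHat g p) = Sp g (ZMod (p : ℕ)))
    {p q : Nat.Primes} (hq : q ≠ two) (hpq : p ≠ q) :
    Sp g (ZMod (q : ℕ)) ≤ (N ⊓ (redHat g p).ker).map (redHat g q) := by
  have hne : ∀ r : Nat.Primes, r ≠ two → (r : ℕ) ≠ 2 := fun r hr h => hr (Subtype.ext h)
  have key : Sp g (ZMod (q : ℕ)) ≤
      ((redHat g p).comp N.subtype).ker.map ((redHat g q).comp N.subtype) := by
    have hβ : ((redHat g q).comp N.subtype).range = Sp g (ZMod (q : ℕ)) := by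
      rw [range_redHat_comp_subtype, hodd q hq]
    by_cases hp : p = two
    · subst hp
      refine Sp_le_of_not_dvd hg (hne q hq) _ _ hβ fun h => ?_
      refine not_dvd_card_perm (g := g) (hne q hq) (h.trans ?_)
      rw [range_redHat_comp_subtype]
      refine (Subgroup.card_dvd_of_le h2).trans ?_
      exact (Subgroup.card_map_dvd _ _).trans (Subgroup.card_subgroup_dvd_card _)
    · exact Sp_le_of_ne hg (hne q hq) (hne p hp) (fun h => hpq (Subtype.ext h)) _
        (by rw [range_redHat_comp_subtype, hodd p hp]) _ hβ
  intro s hs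
  obtain ⟨x, hx, rfl⟩ := key hs
  exact ⟨x.1, ⟨x.2, hx⟩, rfl⟩

/-- An element trivial modulo p and equal to a transvection modulo q has p-power powers that tend to
1 at p. A limit point is exactly 1 at p and still the transvection modulo q, which has no exponent
two, so the dichotomy gives everything. -/
theorem Sp_le_map_adic_ker (hg : 2 ≤ g) {b : Module.Basis (Fin g ⊕ Fin g) (ZMod 2) (W g)} {i : ℕ}
    (hN : IsClosed (N : Set (GL2g g ZHat)))
    (h2 : N.map (redHat g two) ≤ symGrp b i)
    (hodd : ∀ p : Nat.Primes, p ≠ two → N.map (redHat g p) = Sp g (ZMod (p : ℕ)))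
    {p q : Nat.Primes} (hq : q ≠ two) (hpq : p ≠ q) :
    Sp g (ZMod (q : ℕ)) ≤ (N ⊓ (adic g p).ker).map (redHat g q) := by
  have hq2 : (q : ℕ) ≠ 2 := fun h => hq (Subtype.ext h)
  let a : Fin g := ⟨0, by omega⟩
  let y := tv (ve (ZMod (q : ℕ)) a) 1
  obtain ⟨n, ⟨hn, hnp⟩, hnq⟩ := Sp_le_map_ker hg h2 hodd hq hpq (tv_mem (ve (ZMod (q : ℕ)) a) 1)
  have hcg : Cg 1 (adic g p n).val 1 := by
    refine (Cg_one_iff_red (B := 1)).2 ?_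
    rw [map_one]
    exact hnp
  have hp0 : ((p : ℕ) : ZMod (q : ℕ)) ≠ 0 := by
    rw [Ne, ZMod.natCast_eq_zero_iff, Nat.prime_dvd_prime_iff_eq q.2 p.2]
    exact fun h => hpq (Subtype.ext h.symm)
  obtain ⟨x, hx⟩ := IsCompact.nonempty_iInter_of_sequence_nonempty_isCompact_isClosed
    (fun k => ((N : Set (GL2g g ZHat)) ∩ {m | redHat g q m = y}) ∩ {m | Cg k (adic g p m).val 1})
    (fun k m hm => ⟨hm.1, hm.2.mono k.le_succ⟩)
    (fun k => by
      -- The factor q - 1 in the exponent makes the power congruent to 1 modulo q by Fermat, so the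
      -- image modulo q does not change.
      refine ⟨n ^ (p : ℕ) ^ (((q : ℕ) - 1) * k), ⟨N.pow_mem hn _, ?_⟩, ?_⟩
      · change redHat g q (n ^ _) = y
        rw [map_pow, hnq, tv_pow]
        congr 1
        rw [Nat.cast_pow, pow_mul, ZMod.pow_card_sub_one_eq_one hp0]
        simp
      · change Cg k (adic g p (n ^ _)).val 1
        rw [map_pow, Units.val_pow_eq_pow_val]
        refine (Cg_pow_p_pow hcg _).mono ?_
        have : 1 ≤ (q : ℕ) - 1 := by have := q.2.two_le; omega
        nlinarith)
    (((hN.inter (isClosed_redHat_eq q y)).inter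
      ((isClosed_Cg 0 1).preimage (continuous_adic p))).isCompact)
    (fun k => ((hN.inter (isClosed_redHat_eq q y)).inter
      ((isClosed_Cg k 1).preimage (continuous_adic p))))
  rw [Set.mem_iInter] at hx
  have hxp : adic g p x = 1 := Units.ext (eq_of_forall_Cg fun k => (hx k).2)
  have hmem : y ∈ (N ⊓ (adic g p).ker).map (redHat g q) := ⟨x, ⟨(hx 0).1.1, hxp⟩, (hx 0).1.2⟩
  have hnorm : ∀ s ∈ Sp g (ZMod (q : ℕ)), ∀ c ∈ (N ⊓ (adic g p).ker).map (redHat g q),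
      s * c * s⁻¹ ∈ (N ⊓ (adic g p).ker).map (redHat g q) := by
    rintro s hs _ ⟨c, ⟨hc, hcp⟩, rfl⟩
    rw [← hodd q hq] at hs
    obtain ⟨t, ht, rfl⟩ := hs
    exact ⟨t * c * t⁻¹, ⟨N.mul_mem (N.mul_mem ht hc) (N.inv_mem ht),
      (MonoidHom.normal_ker (adic g p)).conj_mem c hcp t⟩, by simp⟩
  rcases normal_dichotomy hg hq2 hnorm with h | h
  · exact h
  exfalso
  have h3 := h y hmem (tv_mem _ _)
  rw [tv_pow] at h3
  have h4 := congrArg (fun A : GL2g g (ZMod (q : ℕ)) => (A.val *ᵥ vf (ZMod (q : ℕ)) a) (.inl a)) h3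
  simp only [tv_mulVec, om_ve, Units.val_one, one_mulVec] at h4
  simp at h4
  exact two_ne_zero_zmod hq2 h4

/-- A commutator of an element trivial on `P` with one trivial at `p` is trivial on both; since Sp
modulo q is perfect, such commutators still generate it. -/
theorem Sp_le_map_iInf_ker (hg : 2 ≤ g) {q : Nat.Primes} (hq : q ≠ two)
    (hNq : N.map (redHat g q) = Sp g (ZMod (q : ℕ)))
    (h : ∀ p, p ≠ q → Sp g (ZMod (q : ℕ)) ≤ (N ⊓ (adic g p).ker).map (redHat g q))
    (P : Finset {p : Nat.Primes // p ≠ q}) :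
    ∀ y ∈ Sp g (ZMod (q : ℕ)), ∃ n ∈ N, redHat g q n = y ∧ ∀ p ∈ P, adic g p.1 n = 1 := by
  classical
  have hq2 : (q : ℕ) ≠ 2 := fun h => hq (Subtype.ext h)
  induction P using Finset.induction_on with
  | empty =>
    intro y hy
    rw [← hNq] at hy
    obtain ⟨n, hn, rfl⟩ := hy
    exact ⟨n, hn, rfl, by simp⟩
  | insert p P _ ih =>
    have hK : ∀ (Q : Finset {p : Nat.Primes // p ≠ q}) (n : GL2g g ZHat),
        n ∈ N ⊓ ⨅ p ∈ Q, (adic g p.1).ker ↔ n ∈ N ∧ ∀ p ∈ Q, adic g p.1 n = 1 := by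
      intro Q n
      simp only [Subgroup.mem_inf, Subgroup.mem_iInf, MonoidHom.mem_ker]
    have h1 : Sp g (ZMod (q : ℕ)) ≤ (N ⊓ ⨅ p ∈ P, (adic g p.1).ker).map (redHat g q) := by
      intro y hy
      obtain ⟨n, hn, hny, hnP⟩ := ih y hy
      exact ⟨n, (hK P n).2 ⟨hn, hnP⟩, hny⟩
    have h2 : ⁅N ⊓ ⨅ p ∈ P, (adic g p.1).ker, N ⊓ (adic g p.1).ker⁆ ≤
        N ⊓ ⨅ r ∈ insert p P, (adic g r.1).ker := by
      rw [Subgroup.commutator_le]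
      rintro x hx y ⟨hy, hyp⟩
      obtain ⟨hx, hxP⟩ := (hK P x).1 hx
      refine (hK _ _).2 ⟨N.mul_mem (N.mul_mem (N.mul_mem hx hy) (N.inv_mem hx)) (N.inv_mem hy), ?_⟩
      intro r hr
      rw [commutatorElement_def]
      simp only [map_mul, map_inv]
      rcases Finset.mem_insert.1 hr with rfl | hr
      · have : adic g r.1 y = 1 := hyp
        simp [this]
      · simp [hxP r hr]
    intro y hy
    rw [← commutator_Sp hg hq2] at hy
    have h3 := Subgroup.commutator_mono h1 (h p.1 p.2) hy
    rw [← Subgroup.map_commutator] at h3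
    obtain ⟨n, hn, hny⟩ := h3
    obtain ⟨hnN, hnP⟩ := (hK _ n).1 (h2 hn)
    exact ⟨n, hnN, hny, hnP⟩

/-- A closed group with large reductions contains the factor at every odd prime. -/
theorem exists_mem_adic_eq (hg : 2 ≤ g) {b : Module.Basis (Fin g ⊕ Fin g) (ZMod 2) (W g)} {i : ℕ}
    (hN : IsClosed (N : Set (GL2g g ZHat))) (hNS : N ≤ Sp g ZHat)
    (h2 : N.map (redHat g two) ≤ symGrp b i)
    (hodd : ∀ p : Nat.Primes, p ≠ two → N.map (redHat g p) = Sp g (ZMod (p : ℕ)))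
    {q : Nat.Primes} (hq : q ≠ two) {y : GL2g g ℤ_[(q : ℕ)]} (hy : y ∈ Sp g ℤ_[(q : ℕ)]) :
    ∃ n ∈ N, adic g q n = y ∧ ∀ p, p ≠ q → adic g p n = 1 := by
  have hq2 : (q : ℕ) ≠ 2 := fun h => hq (Subtype.ext h)
  let K : Subgroup (GL2g g ZHat) := N ⊓ ⨅ p : {p : Nat.Primes // p ≠ q}, (adic g p.1).ker
  have hclosed1 : ∀ p : Nat.Primes, IsClosed {m : GL2g g ZHat | adic g p m = 1} := fun p =>
    isClosed_singleton.preimage (continuous_adic p)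
  have hKmem : ∀ n, n ∈ K ↔ n ∈ N ∧ ∀ p : {p : Nat.Primes // p ≠ q}, adic g p.1 n = 1 := by
    intro n
    rw [Subgroup.mem_inf, Subgroup.mem_iInf]
    rfl
  have hK : IsClosed (K : Set (GL2g g ZHat)) := by
    have : (K : Set (GL2g g ZHat)) = (N : Set (GL2g g ZHat)) ∩ ⋂ p : {p : Nat.Primes // p ≠ q},
        {m : GL2g g ZHat | adic g p.1 m = 1} := by
      ext n
      rw [Set.mem_inter_iff, Set.mem_iInter]
      exact hKmem n
    rw [this]
    exact hN.inter (isClosed_iInter fun p => hclosed1 p.1)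
  have hsurj : Sp g (ZMod (q : ℕ)) ≤ (K.map (adic g q)).map (red g q) := by
    rw [Subgroup.map_map]
    intro z hz
    have hC : IsClosed {n : GL2g g ZHat | n ∈ N ∧ redHat g q n = z} :=
      hN.inter (isClosed_redHat_eq q z)
    obtain ⟨n, ⟨hn, hnz⟩, hn'⟩ := exists_mem_forall_adic_eq hC
      (fun p : {p : Nat.Primes // p ≠ q} => p.1) 1 (fun P => by
        obtain ⟨n, hn, hnz, hnP⟩ := Sp_le_map_iInf_ker hg hq (hodd q hq)
          (fun p hp => Sp_le_map_adic_ker hg hN h2 hodd hq hp) P z hz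
        exact ⟨n, ⟨hn, hnz⟩, fun p hp => (hnP p hp).trans (map_one _).symm⟩)
    exact ⟨n, (hKmem n).2 ⟨hn, fun p => (hn' p).trans (map_one _)⟩, hnz⟩
  have hC : IsClosed (K.map (adic g q) : Set (GL2g g ℤ_[(q : ℕ)])) :=
    (hK.isCompact.image (continuous_adic q)).isClosed
  have hCS : K.map (adic g q) ≤ Sp g ℤ_[(q : ℕ)] := by
    rintro _ ⟨n, hn, rfl⟩
    exact mem_Sp_ZHat.1 (hNS ((hKmem n).1 hn).1) q
  obtain ⟨n, hn, rfl⟩ := Sp_le_of_red hg hq2 hC hCS hsurj hy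
  exact ⟨n, ((hKmem n).1 hn).1, rfl, fun p hp => ((hKmem n).1 hn).2 ⟨p, hp⟩⟩

theorem mem_prodSp {B : Subgroup (GL2g g ℤ_[(two : ℕ)])} {x : GL2g g ZHat} :
    x ∈ prodSp g B ↔ adic g two x ∈ B ∧ ∀ p : Nat.Primes, p ≠ two →
      adic g p x ∈ Sp g ℤ_[(p : ℕ)] := by
  have h3 : ∀ p : Nat.Primes, 3 ≤ (p : ℕ) ↔ p ≠ two := by
    intro p
    have h1 := p.2.two_le
    constructor
    · rintro h rfl
      exact absurd h (by norm_num)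
    · intro h
      have : (p : ℕ) ≠ 2 := fun e => h (Subtype.ext e)
      omega
  simp only [prodSp, Subgroup.mem_inf, Subgroup.mem_iInf, Subgroup.mem_comap, h3]

theorem prodSp_le (hg : 2 ≤ g) {b : Module.Basis (Fin g ⊕ Fin g) (ZMod 2) (W g)} {i : ℕ}
    (hN : IsClosed (N : Set (GL2g g ZHat))) (hNS : N ≤ Sp g ZHat)
    (h2 : N.map (redHat g two) ≤ symGrp b i)
    (hodd : ∀ p : Nat.Primes, p ≠ two → N.map (redHat g p) = Sp g (ZMod (p : ℕ))) :
    prodSp g (N.map (adic g two)) ≤ N := by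
  classical
  intro y hy
  obtain ⟨⟨n₀, hn₀, hn₀y⟩, hyodd⟩ := mem_prodSp.1 hy
  have hfin : ∀ P : Finset Nat.Primes, ∃ n ∈ N, adic g two n = adic g two y ∧
      ∀ p ∈ P, adic g p n = adic g p y := by
    intro P
    induction P using Finset.induction_on with
    | empty => exact ⟨n₀, hn₀, hn₀y, by simp⟩
    | insert p P _ ih =>
      obtain ⟨n, hn, hn2, hnP⟩ := ih
      by_cases hp : p = two
      · refine ⟨n, hn, hn2, fun r hr => ?_⟩
        rcases Finset.mem_insert.1 hr with rfl | hr
        · rw [hp]; exact hn2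
        · exact hnP r hr
      -- The correction at `p` is trivial at all other primes, so the components already matched are
      -- undisturbed.
      · obtain ⟨m, hm, hmp, hm1⟩ := exists_mem_adic_eq hg hN hNS h2 hodd hp
          (mul_mem (inv_mem (mem_Sp_ZHat.1 (hNS hn) p)) (hyodd p hp))
        refine ⟨n * m, N.mul_mem hn hm, ?_, fun r hr => ?_⟩
        · rw [map_mul, hm1 two (Ne.symm hp), mul_one, hn2]
        · by_cases hrp : r = p
          · subst hrp
            rw [map_mul, hmp, mul_inv_cancel_left]
          · rw [map_mul, hm1 r hrp, mul_one]
            exact hnP r ((Finset.mem_insert.1 hr).resolve_left hrp)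
  obtain ⟨x, hxN, hx⟩ := exists_mem_forall_adic_eq hN id y (fun P => by
    obtain ⟨n, hn, -, hnP⟩ := hfin P
    exact ⟨n, hn, hnP⟩)
  have : x = y := eq_of_adic_eq hx
  exact this ▸ hxN

end Assembly

/-! ### The closed commutator subgroup -/

section Main

variable {g : ℕ} {b : Module.Basis (Fin g ⊕ Fin g) (ZMod 2) (W g)} {i : ℕ}

theorem altGrp_le_symGrp : altGrp b i ≤ symGrp b i := Subgroup.map_mono inf_le_left

theorem commutator_symGrp_le : ⁅symGrp b i, symGrp b i⁆ ≤ altGrp b i := by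
  rw [symGrp, ← Subgroup.map_commutator]
  exact Subgroup.map_mono commutator_letters_le

theorem prodSp_preSp2 (A : Subgroup (GL2g g (ZMod 2))) :
    prodSp g (preSp2 g A) = preSpHat g A := by
  ext x
  rw [mem_prodSp]
  constructor
  · rintro ⟨⟨h1, h2⟩, h3⟩
    refine ⟨mem_Sp_ZHat.2 fun p => ?_, h2⟩
    by_cases hp : p = two
    · subst hp; exact h1
    · exact h3 p hp
  · rintro ⟨h1, h2⟩
    exact ⟨⟨mem_Sp_ZHat.1 h1 two, h2⟩, fun p _ => mem_Sp_ZHat.1 h1 p⟩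

theorem closedComm_eq (hg : 2 ≤ g) (hi : i = 1 ∨ i = 2) (hb : IsSymplecticBasis b)
    {H : Subgroup (GL2g g ZHat)} (hH : H ≤ GSp g ZHat)
    (h2 : H.map (adic g two) = preGSp2 g (symGrp b i))
    (hodd : ∀ p : Nat.Primes, 3 ≤ (p : ℕ) →
      Sp g (ZMod (p : ℕ)) ≤ H.map ((red g p).comp (adic g p))) :
    closedComm H = prodSp g (preSp2 g (altGrp b i)) := by
  have hN : IsClosed (closedComm H : Set (GL2g g ZHat)) := Subgroup.isClosed_topologicalClosure _
  have hle : ⁅H, H⁆ ≤ closedComm H := Subgroup.le_topologicalClosure _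
  have hNS : closedComm H ≤ Sp g ZHat :=
    Subgroup.topologicalClosure_minimal _
      ((Subgroup.commutator_mono hH hH).trans commutator_GSp_le_Sp) isClosed_Sp
  have hNalt : closedComm H ≤ (altGrp b i).comap (redHat g two) := by
    refine Subgroup.topologicalClosure_minimal _ ?_
      ((isClosed_red_mem two (altGrp b i : Set (GL2g g (ZMod 2)))).preimage (continuous_adic two))
    rw [← Subgroup.map_le_iff_le_comap, Subgroup.map_commutator, ← Subgroup.map_map, h2]
    have h3 : (preGSp2 g (symGrp b i)).map (red g two) ≤ symGrp b i := by
      rw [Subgroup.map_le_iff_le_comap]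
      exact inf_le_right
    exact (Subgroup.commutator_mono h3 h3).trans commutator_symGrp_le
  have hNodd : ∀ p : Nat.Primes, p ≠ two →
      (closedComm H).map (redHat g p) = Sp g (ZMod (p : ℕ)) := by
    intro p hp
    have hp2 : (p : ℕ) ≠ 2 := fun h => hp (Subtype.ext h)
    have hp3 : 3 ≤ (p : ℕ) := by
      have := p.2.two_le
      omega
    refine le_antisymm ?_ ?_
    · rintro _ ⟨n, hn, rfl⟩
      exact map_mem_Sp _ (map_mem_Sp _ (hNS hn))
    · rw [← commutator_Sp hg hp2]
      refine (Subgroup.commutator_mono (hodd p hp3) (hodd p hp3)).trans ?_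
      rw [← Subgroup.map_commutator]
      exact Subgroup.map_mono hle
  have hN2 : preSp2 g (altGrp b i) ≤ (closedComm H).map (adic g two) := by
    refine preSp2_altGrp_le hg hb hi (hN.isCompact.image (continuous_adic two)).isClosed ?_ ?_
    · rintro _ ⟨n, hn, rfl⟩
      exact mem_Sp_ZHat.1 (hNS hn) two
    · rw [← h2, ← Subgroup.map_commutator]
      exact Subgroup.map_mono hle
  refine le_antisymm ?_ ?_
  · rw [prodSp_preSp2]
    exact fun n hn => ⟨hNS hn, hNalt hn⟩
  · refine le_trans ?_ (prodSp_le hg hN hNS ((Subgroup.map_le_iff_le_comap.2 hNalt).trans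
      altGrp_le_symGrp) hNodd)
    intro x hx
    rw [mem_prodSp] at hx ⊢
    exact ⟨hN2 hx.1, hx.2⟩

theorem preSpHat_mono {A B : Subgroup (GL2g g (ZMod 2))} (h : A ≤ B) :
    preSpHat g A ≤ preSpHat g B := inf_le_inf_left _ (Subgroup.comap_mono h)

/-- The nontrivial coset is represented by a lift of a transposition; the sign separates the cosets
because the permutation action is faithful. -/
theorem relIndex_preSpHat (hg : 2 ≤ g) (hi : i = 1 ∨ i = 2) (hb : IsSymplecticBasis b) :
    (preSpHat g (altGrp b i)).relIndex (preSpHat g (symGrp b i)) = 2 := by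
  let j : Fin (2 * g + 2) := ⟨0, by omega⟩
  let k : Fin (2 * g + 2) := ⟨1, by omega⟩
  have hjk : j ≠ k := by simp [j, k]
  let f : ZHat →+* ZMod 2 :=
    (PadicInt.toZMod (p := (two : ℕ))).comp (Pi.evalRingHom (fun q : Nat.Primes => ℤ_[(q : ℕ)]) two)
  choose c hc using ZMod.ringHom_surjective f
  let u : Fin g ⊕ Fin g → ZHat := c ∘ b.repr (pair j k)
  have hu : redHat g two (tv u 1) = permMatrix b (Equiv.swap j k) := by
    change GeneralLinearGroup.map f (tv u 1) = _
    rw [map_tv, permMatrix_swap hb hjk, map_one]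
    congr 1
    ext r
    exact hc _
  have hswap : Equiv.swap j k ∈ letters g i := by
    refine swap_mem_letters hi ?_ ?_
    · change 0 < _; omega
    · change 1 < _; omega
  have halt : ∀ σ ∈ letters g i, (permMatrix b σ ∈ altGrp b i ↔ Equiv.Perm.sign σ = 1) := by
    intro σ hσ
    constructor
    · rintro ⟨τ, ⟨-, hτ⟩, h⟩
      rw [← permMatrix_injective hg h]
      exact hτ
    · intro h
      exact ⟨σ, ⟨hσ, h⟩, rfl⟩
  refine Subgroup.relIndex_eq_two_iff.2 ⟨tv u 1, ⟨tv_mem _ _, ?_⟩, ?_⟩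
  · change redHat g two (tv u 1) ∈ symGrp b i
    rw [hu]
    exact ⟨_, hswap, rfl⟩
  · rintro x ⟨hx, σ, hσ, hxσ⟩
    have h1 : x ∈ preSpHat g (altGrp b i) ↔ Equiv.Perm.sign σ = 1 := by
      rw [← halt σ hσ, hxσ]
      exact ⟨fun h => h.2, fun h => ⟨hx, h⟩⟩
    have h2 : x * tv u 1 ∈ preSpHat g (altGrp b i) ↔ Equiv.Perm.sign (σ * Equiv.swap j k) = 1 := by
      rw [← halt _ (mul_mem hσ hswap), map_mul, hxσ, ← hu, ← map_mul]
      exact ⟨fun h => h.2, fun h => ⟨mul_mem hx (tv_mem _ _), h⟩⟩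
    rw [h1, h2, Equiv.Perm.sign_mul, Equiv.Perm.sign_swap hjk]
    rcases Int.units_eq_one_or (Equiv.Perm.sign σ) with h | h <;> simp [h, Xor]

theorem closedComm_index (hg : 2 ≤ g) (hi : i = 1 ∨ i = 2) (hb : IsSymplecticBasis b)
    {H : Subgroup (GL2g g ZHat)} (h : closedComm H = prodSp g (preSp2 g (altGrp b i))) :
    closedComm H ≤ preSpHat g (symGrp b i) ∧
      (closedComm H).relIndex (preSpHat g (symGrp b i)) = 2 := by
  rw [h, prodSp_preSp2]
  exact ⟨preSpHat_mono altGrp_le_symGrp, relIndex_preSpHat hg hi hb⟩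

end Main

/-! ### Groups of similitudes cut out by the cyclotomic character -/

section Cyclotomic

variable {g : ℕ}

theorem exists_forall_adic_eq (S : ∀ p : Nat.Primes, GL2g g ℤ_[(p : ℕ)]) :
    ∃ x : GL2g g ZHat, ∀ p, adic g p x = S p := by
  refine ⟨⟨Matrix.of fun i j p => (S p).val i j, Matrix.of fun i j p => (S p)⁻¹.val i j, ?_, ?_⟩,
    fun p => Units.ext rfl⟩
  · ext i j p
    have h := congrArg (fun A : Mat g ℤ_[(p : ℕ)] => A i j) (S p).mul_inv
    simp only [Matrix.mul_apply, Matrix.one_apply, Matrix.of_apply, Finset.sum_apply,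
      Pi.mul_apply] at h ⊢
    rw [h]
    split_ifs <;> rfl
  · ext i j p
    have h := congrArg (fun A : Mat g ℤ_[(p : ℕ)] => A i j) (S p).inv_mul
    simp only [Matrix.mul_apply, Matrix.one_apply, Matrix.of_apply, Finset.sum_apply,
      Pi.mul_apply] at h ⊢
    rw [h]
    split_ifs <;> rfl

variable {K : Type*} [Field K]

theorem map_cyclo (σ : AlgebraicClosure K ≃ₐ[K] AlgebraicClosure K) (p : Nat.Primes) :
    Units.map (Pi.evalRingHom (fun q : Nat.Primes => ℤ_[(q : ℕ)]) p).toMonoidHom (cyclo K σ) =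
      cycloP K (p : ℕ) σ := Units.ext rfl

variable {b : Module.Basis (Fin g ⊕ Fin g) (ZMod 2) (W g)} {i : ℕ}

theorem hypGSp_le_GSp : hypGSp b i K ≤ GSp g ZHat := by
  rintro S ⟨⟨m, -, hm⟩, -⟩
  exact ⟨m, trivial, hm⟩

theorem map_hypGSp_two (hK : Function.Surjective (cycloP K 2)) :
    (hypGSp b i K).map (adic g two) = preGSp2 g (symGrp b i) := by
  classical
  refine le_antisymm ?_ ?_
  · rintro _ ⟨S, ⟨⟨m, -, hm⟩, hS⟩, rfl⟩
    exact ⟨⟨_, trivial, map_similitude _ hm⟩, hS⟩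
  · rintro S ⟨⟨m, -, hm⟩, hS⟩
    obtain ⟨σ, hσ⟩ := hK m
    -- The same Galois element must give the multiplier at every prime; away from 2 the diagonal
    -- similitudes realize it, with no further condition there.
    obtain ⟨x, hx⟩ := exists_forall_adic_eq
      (Function.update (fun p => dscale g (cycloP K (p : ℕ) σ)) two S)
    have hx2 : adic g two x = S := by rw [hx, Function.update_self]
    refine ⟨x, ⟨⟨_, ⟨σ, rfl⟩, isSimilitude_ZHat.2 fun p => ?_⟩, ?_⟩, hx2⟩
    · rw [map_cyclo]
      by_cases hp : p = two
      · subst hp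
        rw [hx2, show cycloP K (two : ℕ) σ = m from hσ]
        exact hm
      · rw [hx, Function.update_of_ne hp]
        exact dscale_similitude _
    · change red g two (adic g two x) ∈ symGrp b i
      rw [hx2]
      exact hS

/-- Elements of multiplier 1 supported at the single prime `p` suffice. -/
theorem Sp_le_map_hypGSp {p : Nat.Primes} (hp : 3 ≤ (p : ℕ)) :
    Sp g (ZMod (p : ℕ)) ≤ (hypGSp b i K).map ((red g p).comp (adic g p)) := by
  classical
  intro y hy
  obtain ⟨S, hS, rfl⟩ := Sp_le_map_red hy
  obtain ⟨x, hx⟩ := exists_forall_adic_eq (Function.update (fun _ => 1) p S)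
  have hxp : adic g p x = S := by rw [hx, Function.update_self]
  have h2 : adic g two x = 1 := by
    rw [hx, Function.update_of_ne]
    rintro rfl
    exact absurd hp (by norm_num)
  refine ⟨x, ⟨⟨1, one_mem _, mem_Sp.1 (mem_Sp_ZHat.2 fun q => ?_)⟩, ?_⟩, ?_⟩
  · by_cases hq : q = p
    · subst hq
      rw [hxp]
      exact hS
    · rw [hx, Function.update_of_ne hq]
      exact one_mem _
  · change red g two (adic g two x) ∈ symGrp b i
    rw [h2, map_one]
    exact one_mem _
  · change red g p (adic g p x) = _
    rw [hxp]

theorem closedComm_hypGSp (hg : 2 ≤ g) (hi : i = 1 ∨ i = 2) (hb : IsSymplecticBasis b)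
    (hK : Function.Surjective (cycloP K 2)) :
    closedComm (hypGSp b i K) ≤ preSpHat g (symGrp b i) ∧
      (closedComm (hypGSp b i K)).relIndex (preSpHat g (symGrp b i)) = 2 :=
  closedComm_index hg hi hb
    (closedComm_eq hg hi hb hypGSp_le_GSp (map_hypGSp_two hK) fun _ hp => Sp_le_map_hypGSp hp)

theorem continuous_cycloP (p : ℕ) [Fact p.Prime] : Continuous (cycloP K p) :=
  cyclotomicCharacter.continuous p K (AlgebraicClosure K)

/-- Irreducibility makes all primitive p^n-th roots of unity conjugate, so each residue of the unit
modulo p^n is attained; compactness of the Galois group gives one element for all n. -/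
theorem cycloP_surjective [CharZero K] (p : ℕ) [Fact p.Prime]
    (hirr : ∀ n, Irreducible (Polynomial.cyclotomic (p ^ n) K)) :
    Function.Surjective (cycloP K p) := by
  intro u
  have hp : p ≠ 0 := (Fact.out : p.Prime).ne_zero
  let C : ℕ → Set (AlgebraicClosure K ≃ₐ[K] AlgebraicClosure K) := fun n =>
    {σ | ‖(cycloP K p σ : ℤ_[p]) - u‖ ≤ (p : ℝ) ^ (-n : ℤ)}
  have hclosed : ∀ n, IsClosed (C n) := fun n =>
    isClosed_le ((Units.continuous_val.comp (continuous_cycloP p)).sub continuous_const).norm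
      continuous_const
  have hmem : ∀ n σ, σ ∈ C n ↔
      PadicInt.toZModPow n (cycloP K p σ : ℤ_[p]) = PadicInt.toZModPow n (u : ℤ_[p]) := by
    intro n σ
    change ‖_‖ ≤ _ ↔ _
    rw [PadicInt.norm_le_pow_iff_mem_span_pow, ← PadicInt.ker_toZModPow, RingHom.mem_ker, map_sub,
      sub_eq_zero]
  obtain ⟨σ, hσ⟩ := IsCompact.nonempty_iInter_of_sequence_nonempty_isCompact_isClosed C
    (fun n σ hσ => by
      refine le_trans (Set.mem_ofPred_eq ▸ hσ) ?_
      have hp1 : (1 : ℝ) ≤ p := by exact_mod_cast (Fact.out : p.Prime).one_le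
      exact zpow_le_zpow_right₀ hp1 (by push_cast; omega))
    (fun n => by
      have : NeZero (p ^ n) := ⟨pow_ne_zero n hp⟩
      have : NeZero ((p ^ n : ℕ) : AlgebraicClosure K) :=
        ⟨by exact_mod_cast pow_ne_zero n hp⟩
      obtain ⟨ζ, hζ⟩ := HasEnoughRootsOfUnity.exists_primitiveRoot (AlgebraicClosure K) (p ^ n)
      let a : (ZMod (p ^ n))ˣ := Units.map (PadicInt.toZModPow n).toMonoidHom u
      have ha : IsPrimitiveRoot (ζ ^ (a : ZMod (p ^ n)).val) (p ^ n) :=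
        hζ.pow_of_coprime _ (ZMod.val_coe_unit_coprime a)
      have hconj : IsConjRoot K (ζ ^ (a : ZMod (p ^ n)).val) ζ := by
        rw [IsConjRoot, ← hζ.minpoly_eq_cyclotomic_of_irreducible (hirr n),
          ← ha.minpoly_eq_cyclotomic_of_irreducible (hirr n)]
      obtain ⟨σ, hσ⟩ := hconj.exists_algEquiv
      refine ⟨σ, (hmem n σ).2 ?_⟩
      have h1 := cyclotomicCharacter.spec p (L := AlgebraicClosure K) (n := n) σ.toRingEquiv ζ hζ.pow_eq_one
      have h2 : ζ ^ (a : ZMod (p ^ n)).val =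
          ζ ^ (PadicInt.toZModPow n (cycloP K p σ : ℤ_[p])).val := hσ.symm.trans h1
      exact (ZMod.val_injective _ (hζ.pow_inj (ZMod.val_lt _) (ZMod.val_lt _) h2)).symm)
    (hclosed 0).isCompact hclosed
  rw [Set.mem_iInter] at hσ
  exact ⟨σ, Units.ext (PadicInt.ext_of_toZModPow.1 fun n => (hmem n σ).1 (hσ n))⟩

theorem cycloP_rat_surjective (p : ℕ) [Fact p.Prime] : Function.Surjective (cycloP ℚ p) :=
  cycloP_surjective p fun n =>
    Polynomial.cyclotomic.irreducible_rat (pow_pos (Fact.out : p.Prime).pos n)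

end Cyclotomic

end HypSp

theorem lemma3p3 (g : ℕ) (hg : 2 ≤ g) (i : ℕ) (hi : i = 1 ∨ i = 2)
    (b : Module.Basis (Fin g ⊕ Fin g) (ZMod 2) (W g)) (hb : IsSymplecticBasis b) :
    (∀ H : Subgroup (GL2g g ZHat), H ≤ GSp g ZHat → IsClosed (H : Set (GL2g g ZHat)) →
      H.map (adic g two) = preGSp2 g (symGrp b i) →
      (∀ p : Nat.Primes, 3 ≤ (p : ℕ) →
        Sp g (ZMod (p : ℕ)) ≤ H.map ((red g p).comp (adic g p))) →
      closedComm H = prodSp g (preSp2 g (altGrp b i)) ∧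
      closedComm H ≤ preSpHat g (symGrp b i) ∧
      (closedComm H).relIndex (preSpHat g (symGrp b i)) = 2) ∧
    (∀ (K : Type u) [Field K] [NumberField K], Function.Surjective (cycloP K 2) →
      closedComm (hypGSp b i K) ≤ preSpHat g (symGrp b i) ∧
      (closedComm (hypGSp b i K)).relIndex (preSpHat g (symGrp b i)) = 2) ∧
    (closedComm (hypGSp b i ℚ) ≤ preSpHat g (symGrp b i) ∧
      (closedComm (hypGSp b i ℚ)).relIndex (preSpHat g (symGrp b i)) = 2) := by
  refine ⟨fun H hH _ h2 hodd => ?_, fun K _ _ hK => closedComm_hypGSp hg hi hb hK,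
    closedComm_hypGSp hg hi hb (cycloP_rat_surjective 2)⟩
  have h := closedComm_eq hg hi hb hH h2 hodd
  exact ⟨h, closedComm_index hg hi hb h⟩
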